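/- A dynamic graph on the vertex set $\{0,\dots,n-1\}$, $n\ge 2$, starts as the graph $G_0$ without edges; the $i$-th update inserts one absent edge or deletes one present edge and turns $G_{i-1}$ into $G_i$. Let $\alpha(G)$ denote the arboricity of $G$, i.e. the least number of forests into which the edges of $G$ can be partitioned. There are a randomized data structure (a fixed pair of word-RAM programs, one for initialization and one for processing an update, both independent of $n$, with unit-cost instructions including the drawing of a uniformly random integer from $\{0,\dots,k\}$ for a $k$ stored in a register) and constants $c,C$ such that the following holds for every $n\ge 2$, every word length $w\ge c\lceil\log_2 n\rceil$, and every sequence of $m\ge 0$ updates that is fixed before the data structure draws its random numbers (oblivious adversary). 1. (Explicit adaptive proper coloring.) Whatever the random outcomes, after the initialization ($i=0$) and after the $i$-th update has been processed ($1\le i\le m$), an array in memory of length $n$, at a fixed position, contains a proper coloring of the current graph $G_i$ with colors from $\{1,2,\dots\}$, each at most $C\cdot\max\{\alpha(G_i),1\}\cdot\log_2 n$; that is, an $O(\alpha\log n)$-coloring, where $\alpha$ is the current arboricity. 2. (Running time.) The expected total time for processing the $m$ updates is at most $C\,m\,\log_2^2 n$, i.e. the expected amortized update time is $O(\log^2 n)$;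 the expected time of the initialization is at most $C\,n\log_2^2 n$. In particular, the initialization and every update terminate with probability $1$. -/

import Mathlib

/-- The arboricity of a (finite) graph: the least number of forests into which its edges can be
partitioned. It is `0` for a graph without edges. -/
noncomputable def SimpleGraph.arboricity {V : Type*} [Finite V] (G : SimpleGraph V) : ℕ :=
  sInf {k : ℕ | ∃ F : Fin k → SimpleGraph V,
    (∀ j, (F j).IsAcyclic) ∧ (∀ i j, i ≠ j → Disjoint (F i) (F j)) ∧ (⨆ j, F j) = G}

namespace DynColoring

/-! ### Dynamic graphs -/

/-- An update of a graph on the vertex set `{0, …, n-1}`: the insertion or the deletion of the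
edge between `u` and `v`. -/
structure EdgeUpdate (n : ℕ) where
  isInsert : Bool
  u : Fin n
  v : Fin n

/-- The graph after an update. -/
def EdgeUpdate.apply {n : ℕ} (G : SimpleGraph (Fin n)) (e : EdgeUpdate n) :
    SimpleGraph (Fin n) :=
  if e.isInsert then G ⊔ SimpleGraph.edge e.u e.v else G.deleteEdges {s(e.u, e.v)}

/-- The graph `G_i` obtained from the graph without edges by the first `i` updates of `σ`. -/
def graphAfter {n : ℕ} (σ : List (EdgeUpdate n)) (i : ℕ) : SimpleGraph (Fin n) :=
  (σ.take i).foldl EdgeUpdate.apply ⊥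

/-- Every update of `σ` inserts an edge that is absent or deletes an edge that is present, so
that consecutive graphs differ by exactly one edge. -/
def ValidUpdates {n : ℕ} (σ : List (EdgeUpdate n)) : Prop :=
  ∀ (i : ℕ) (e : EdgeUpdate n), σ[i]? = some e →
    e.u ≠ e.v ∧ (e.isInsert = true ↔ ¬ (graphAfter σ i).Adj e.u e.v)

/-! ### A randomized word RAM -/

/-- Instructions of the word RAM. The letters `d`, `a`, `b` stand for numbers of registers. -/
inductive Instr where
  /-- `d ← k` -/
  | const (d k : ℕ)
  /-- `d ← a + b` -/
  | add (d a b : ℕ)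
  /-- `d ← a - b` -/
  | sub (d a b : ℕ)
  /-- `d ← a * b` -/
  | mul (d a b : ℕ)
  /-- `d ← ⌊a / b⌋` (and `0` if `b` holds `0`) -/
  | div (d a b : ℕ)
  /-- `d ← a mod b` (and `a` if `b` holds `0`) -/
  | mod (d a b : ℕ)
  /-- `d ← memory[a]` -/
  | load (d a : ℕ)
  /-- `memory[a] ← b` -/
  | store (a b : ℕ)
  /-- `d ←` a fresh uniformly random element of `{0, …, a}` -/
  | rand (d a : ℕ)
  /-- if `a < b`, go to instruction number `l` -/
  | jlt (a b l : ℕ)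
  /-- if `a = b`, go to instruction number `l` -/
  | jeq (a b l : ℕ)

/-- A program; it halts when the program counter leaves the list. -/
abbrev Program := List Instr

/-- A configuration of the machine: program counter, registers, and memory. -/
structure Config where
  pc : ℕ
  reg : ℕ → ℕ
  mem : ℕ → ℕ

/-- Write `x` into register `d` and advance the program counter. -/
def Config.put (c : Config) (d x : ℕ) : Config :=
  { pc := c.pc + 1, reg := Function.update c.reg d x, mem := c.mem }

/-- The (random) effect of one instruction on a machine with words of `w` bits: all arithmetic is
modulo `2 ^ w`. -/
noncomputable def Instr.exec (w : ℕ) : Instr → Config → PMF Config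
  | .const d k, c => PMF.pure (c.put d (k % 2 ^ w))
  | .add d a b, c => PMF.pure (c.put d ((c.reg a + c.reg b) % 2 ^ w))
  | .sub d a b, c => PMF.pure (c.put d ((c.reg a + 2 ^ w - c.reg b) % 2 ^ w))
  | .mul d a b, c => PMF.pure (c.put d ((c.reg a * c.reg b) % 2 ^ w))
  | .div d a b, c => PMF.pure (c.put d (c.reg a / c.reg b))
  | .mod d a b, c => PMF.pure (c.put d (c.reg a % c.reg b))
  | .load d a, c => PMF.pure (c.put d (c.mem (c.reg a)))
  | .store a b, c => PMF.pure
      { pc := c.pc + 1, reg := c.reg, mem := Function.update c.mem (c.reg a) (c.reg b) }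
  | .rand d a, c =>
      (PMF.uniformOfFintype (Fin (c.reg a + 1))).map (fun x => c.put d (x : ℕ))
  | .jlt a b l, c => PMF.pure { c with pc := if c.reg a < c.reg b then l else c.pc + 1 }
  | .jeq a b l, c => PMF.pure { c with pc := if c.reg a = c.reg b then l else c.pc + 1 }

/-! ### Randomized dynamic data structures -/

/-- A randomized dynamic data structure: a program that initializes it and a program that
processes one update. Neither depends on the number of vertices or on the word length. -/
structure DataStructure where
  init : Program
  update : Program

/-- A situation during the processing of an update sequence: the number of updates that the
machine has received so far, and the configuration of the machine. -/
structure Situation where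
  received : ℕ
  cfg : Config

namespace DataStructure

/-- The program that is running: initialization before the first update is received, and the
update program from then on. -/
def program (D : DataStructure) (s : Situation) : Program :=
  if s.received = 0 then D.init else D.update

/-- The machine is executing an instruction (it has not halted). -/
def Busy (D : DataStructure) (s : Situation) : Prop :=
  s.cfg.pc < (D.program s).length

/-- At the start registers and memory are zero, except that register `0` holds `n`. -/
def start (w n : ℕ) : Situation where
  received := 0
  cfg := { pc := 0, reg := Function.update (fun _ => 0) 0 (n % 2 ^ w), mem := fun _ => 0 }

/-- A new update is handed to the machine: register `0` tells whether it is an insertion (`1`) or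
a deletion (`0`), registers `1` and `2` receive the endpoints of the edge, everything else is kept,
and the update program is started. -/
def receive (w : ℕ) {n : ℕ} (e : EdgeUpdate n) (s : Situation) : Situation where
  received := s.received + 1
  cfg :=
    { pc := 0
      reg := Function.update (Function.update (Function.update s.cfg.reg
        0 ((if e.isInsert then 1 else 0) % 2 ^ w)) 1 ((e.u : ℕ) % 2 ^ w)) 2 ((e.v : ℕ) % 2 ^ w)
      mem := s.cfg.mem }

/-- One step on the update sequence `σ`: a busy machine executes one instruction; a machine that
has halted receives the next update; nothing happens after the last update. -/
noncomputable def step (D : DataStructure) (w : ℕ) {n : ℕ} (σ : List (EdgeUpdate n))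
    (s : Situation) : PMF Situation :=
  match (D.program s)[s.cfg.pc]? with
  | some ins => (ins.exec w s.cfg).map (fun c => { s with cfg := c })
  | none =>
    match σ[s.received]? with
    | some e => PMF.pure (receive w e s)
    | none => PMF.pure s

/-- The distribution of the situation after `t` steps. The sequence `σ` is fixed in advance, that
is, the adversary is oblivious. -/
noncomputable def dist (D : DataStructure) (w : ℕ) {n : ℕ} (σ : List (EdgeUpdate n)) :
    ℕ → PMF Situation
  | 0 => PMF.pure (start w n)
  | t + 1 => (dist D w σ t).bind (D.step w σ)

/-- The expected number of instructions executed during the initialization. It is infinite if the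
initialization runs forever with positive probability. -/
noncomputable def expectedInitTime (D : DataStructure) (w : ℕ) {n : ℕ}
    (σ : List (EdgeUpdate n)) : ENNReal :=
  ∑' t, (D.dist w σ t).toOuterMeasure {s | D.Busy s ∧ s.received = 0}

/-- The expected number of instructions executed in total for all updates of `σ`, from the end
of the initialization on. It is infinite if some update runs forever with positive
probability. -/
noncomputable def expectedUpdateTime (D : DataStructure) (w : ℕ) {n : ℕ}
    (σ : List (EdgeUpdate n)) : ENNReal :=
  ∑' t, (D.dist w σ t).toOuterMeasure {s | D.Busy s ∧ s.received ≠ 0}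

end DataStructure

end DynColoring

/-!
The vertices are kept on `O(log² n)` levels. Every level `l` has a degree scale `d = scale n l`, a
power of two that doubles after each group of `⌈log₂ n⌉ + 2` levels, and a palette of `16 * d`
colors of its own. A vertex is `Settled` if at most `12 * d` of its neighbors are on its own level
or above, and if at least `4 * d'` of them are on the level below or above, where `d'` is the
scale of the level below. A vertex that violates the first condition moves up, one that violates
the second moves down; in both cases it loses its color. A settled vertex without color draws a
random one among the colors of its palette that no neighbor has, and there are at least `4 * d` of
these. Vertices that may need treatment wait on a stack.

*Number of colors.* A graph of arboricity `α` has at most `α |Z|` edges within a set `Z` of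
vertices (`sum_card_adj_le`). Apply this to the set of the settled vertices on level `l` or above:
if `α ≤ scale n l`, at most half of them are above level `l` (`two_mul_card_le`). So no vertex is
above the first group of levels whose scale is at least `α` (`lvl_lt_of_settled`), and the
palettes up to this group contain `O(α log n)` colors (`base_groups_le`).

*Time for the levels.* The time of a move is proportional to the number of neighbors on the old
level or above, plus the time for drawing a color on the new level. The natural number `levelPot`
drops by at least this much at each move (`levelPot_move`), and an update raises it only by a
constant times the number of levels (`levelPot_change`).

*Time for the colors.* Drawing a color on a level of scale `d` takes time `O(d)`. Besides moves, a
vertex loses its color when an edge to a vertex of the same color is inserted and, with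
probability `1 / d`, at each insertion of an edge at the vertex; the expected cost of the latter
is `O(1)`. For the former, `matchPot` sums over the pairs of vertices of equal color and level the
expected number of future insertions of an edge between them that happen before one of the coins
discards a color, multiplied by `d`. As the updates do not depend on the random choices, this is
determined by the current coloring. Because of the coins, the weights of the pairs at one vertex
sum up to at most `d ^ 2` (`sum_weight_le`), and a random color meets each of them with
probability at most `1 / (4 * d)`: a drawing raises the potential by `O(d)` in expectation
(`matchPot_recolor`), as much as its own time. A conflict frees the potential of the pair, which
pays for both drawings (`matchPot_cons_conflict`).

*Expected cost of programs.* The data structure is written in a small structured language (`Cmd`)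
that is compiled to the word RAM. The expected total cost `DataStructure.total` of the random
process from a situation on satisfies a one-step equation (`DataStructure.total_eq`). For the
language there are weakest-precondition rules (`Machine.wp`): the cost of a command followed by a
continuation is bounded by the cost of the continuation plus the time of the command;
`Machine.Tri` is the special case of a command with a bounded running time and a postcondition. As
the cost of halting with a wrong coloring is set to infinity (`updateCost`), one finite bound on
the expected total cost proves the running time and, whatever the random choices, the correctness
of the coloring.
-/

open scoped ENNReal

namespace DynColoring

/-! ### Expected total cost of a random process -/

/-- The expectation of `f` under `p`. -/
noncomputable def ev {α : Type*} (p : PMF α) (f : α → ℝ≥0∞) : ℝ≥0∞ := ∑' a, p a * f a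

lemma ev_pure {α : Type*} (a : α) (f : α → ℝ≥0∞) : ev (PMF.pure a) f = f a := by
  unfold ev
  rw [tsum_eq_single a]
  · simp
  · intro b hb; simp [hb]

lemma ev_bind {α β : Type*} (p : PMF α) (g : α → PMF β) (f : β → ℝ≥0∞) :
    ev (p.bind g) f = ev p (fun a => ev (g a) f) := by
  unfold ev
  simp only [PMF.bind_apply, ← ENNReal.tsum_mul_right, ← ENNReal.tsum_mul_left]
  rw [ENNReal.tsum_comm]
  simp only [mul_assoc]

lemma ev_map {α β : Type*} (p : PMF α) (g : α → β) (f : β → ℝ≥0∞) :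
    ev (p.map g) f = ev p (fun a => f (g a)) := by
  rw [← PMF.bind_pure_comp, ev_bind]
  simp only [Function.comp, ev_pure]

lemma ev_tsum {α : Type*} (p : PMF α) (f : ℕ → α → ℝ≥0∞) :
    ev p (fun a => ∑' t, f t a) = ∑' t, ev p (f t) := by
  unfold ev
  simp only [← ENNReal.tsum_mul_left]
  rw [ENNReal.tsum_comm]

lemma ev_mono {α : Type*} (p : PMF α) {f g : α → ℝ≥0∞} (h : ∀ a, f a ≤ g a) :
    ev p f ≤ ev p g :=
  ENNReal.tsum_le_tsum fun a => by gcongr; exact h a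

lemma ev_uniform (k : ℕ) (f : Fin (k + 1) → ℝ≥0∞) :
    ev (PMF.uniformOfFintype (Fin (k + 1))) f = (∑ x, f x) / (k + 1 : ℕ) := by
  unfold ev
  rw [tsum_fintype]
  simp only [PMF.uniformOfFintype_apply, Fintype.card_fin]
  rw [← Finset.mul_sum, mul_comm, ENNReal.div_eq_inv_mul, mul_comm]

namespace DataStructure

variable (D : DataStructure) (w : ℕ) {n : ℕ} (σ : List (EdgeUpdate n))

/-- The distribution of the situation `t` steps after the situation `s`. Unlike `dist`, it
unfolds at the first step. -/
noncomputable def run : ℕ → Situation → PMF Situation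
  | 0, s => PMF.pure s
  | t + 1, s => (D.step w σ s).bind (run t)

lemma run_succ' (t : ℕ) (s : Situation) :
    D.run w σ (t + 1) s = (D.run w σ t s).bind (D.step w σ) := by
  induction t generalizing s with
  | zero => simp [run]
  | succ t ih =>
    rw [run, run, PMF.bind_bind]
    congr 1
    funext s'
    exact ih s'

lemma dist_eq_run (t : ℕ) : D.dist w σ t = D.run w σ t (start w n) := by
  induction t with
  | zero => rfl
  | succ t ih => rw [run_succ', ← ih]; rfl

/-- The expected total cost of the process started in `s`, if every visit of a situation `s'`
costs `κ s'`. -/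
noncomputable def total (κ : Situation → ℝ≥0∞) (s : Situation) : ℝ≥0∞ :=
  ∑' t, ev (D.run w σ t s) κ

lemma total_eq (κ : Situation → ℝ≥0∞) (s : Situation) :
    D.total w σ κ s = κ s + ev (D.step w σ s) (D.total w σ κ) := by
  unfold total
  rw [tsum_eq_zero_add' ENNReal.summable, ev_tsum]
  simp only [run, ev_pure, ev_bind]

/-- A situation that does not change and costs nothing has total cost zero. -/
lemma total_eq_zero_of_fixed (κ : Situation → ℝ≥0∞) (s : Situation) (hs : κ s = 0)
    (h : D.step w σ s = PMF.pure s) : D.total w σ κ s = 0 := by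
  have hrun : ∀ t, D.run w σ t s = PMF.pure s := by
    intro t
    induction t with
    | zero => rfl
    | succ t ih => rw [run, h, PMF.pure_bind, ih]
  simp [total, hrun, ev_pure, hs]

lemma expected_eq_total (P : Situation → Prop) [DecidablePred P] :
    ∑' t, (D.dist w σ t).toOuterMeasure {s | P s} =
      D.total w σ (fun s => if P s then 1 else 0) (start w n) := by
  unfold total
  congr 1
  funext t
  rw [← dist_eq_run, PMF.toOuterMeasure_apply, ev]
  congr 1
  funext s
  by_cases h : P s <;> simp [h]

lemma total_mono {κ κ' : Situation → ℝ≥0∞} (h : ∀ s, κ s ≤ κ' s) (s : Situation) :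
    D.total w σ κ s ≤ D.total w σ κ' s :=
  ENNReal.tsum_le_tsum fun _ => ev_mono _ h

/-- If the expected total cost is finite, situations of infinite cost are never reached. -/
lemma not_mem_support_of_total_ne_top (κ : Situation → ℝ≥0∞)
    (h : D.total w σ κ (start w n) ≠ ⊤) (t : ℕ) (s : Situation)
    (hs : s ∈ (D.dist w σ t).support) : κ s ≠ ⊤ := by
  intro htop
  apply h
  have h1 : ev (D.run w σ t (start w n)) κ = ⊤ := by
    rw [← dist_eq_run, ← top_le_iff]
    refine le_trans ?_ (ENNReal.le_tsum s)
    rw [htop, ENNReal.mul_top]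
    exact (PMF.mem_support_iff _ _).1 hs
  rw [← top_le_iff, ← h1]
  exact ENNReal.le_tsum t

/-- The number of received updates never decreases, so a cost that vanishes from the first update
on contributes nothing afterwards. -/
lemma total_eq_zero_of_received (κ : Situation → ℝ≥0∞) (hκ : ∀ s, s.received ≠ 0 → κ s = 0)
    (s : Situation) (hs : s.received ≠ 0) : D.total w σ κ s = 0 := by
  have hrun : ∀ t, ∀ s, s.received ≠ 0 → ev (D.run w σ t s) κ = 0 := by
    intro t
    induction t with
    | zero => intro s hs; simp [run, ev_pure, hκ s hs]
    | succ t ih =>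
      intro s hs
      rw [run, ev_bind, step]
      split
      · rw [ev_map]
        have : ∀ c : Config, ev (D.run w σ t { s with cfg := c }) κ = 0 := fun c => ih _ hs
        simp only [this]; simp [ev]
      · split
        · rw [ev_pure]; exact ih _ (by simp [receive])
        · rw [ev_pure]; exact ih _ hs
  simp [total, hrun _ s hs]

end DataStructure

/-! ### A structured language and its compilation to the word RAM -/

/-- Expressions. `rd k a b c` reads the cell with index `(a, b, c)` of the `k`-th array. -/
inductive Ex where
  | var (i : ℕ)
  | lit (k : ℕ)
  | add (a b : Ex)
  | sub (a b : Ex)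
  | mul (a b : Ex)
  | rd (k : ℕ) (a b c : Ex)

/-- Commands: `asg` assigns to a variable, `wr` writes the value of `e` to the cell `(a, b, c)` of
the `k`-th array, and `rnd` assigns a random element of `{0, …, e}`. The condition of `ite` and
`loop` is `a < b`. -/
inductive Cmd where
  | skip
  | asg (x : ℕ) (e : Ex)
  | wr (k : ℕ) (a b c e : Ex)
  | rnd (x : ℕ) (e : Ex)
  | seq (c₁ c₂ : Cmd)
  | ite (a b : Ex) (c₁ c₂ : Cmd)
  | loop (a b : Ex) (c : Cmd)

/-- `c₁` followed by `c₂`. -/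
infixr:60 " ;; " => Cmd.seq

/-- A state of the structured language: variables, and a memory of three-dimensional arrays. -/
structure St where
  r : ℕ → ℕ
  m : ℕ → ℕ → ℕ → ℕ → ℕ

/-- The state after `x` has been assigned to variable `i`. -/
def St.set (s : St) (i x : ℕ) : St := { s with r := fun j => if j = i then x else s.r j }

/-- The state after `x` has been written to a cell. -/
def St.upd (s : St) (k a b c x : ℕ) : St :=
  { s with m := fun k' a' b' c' =>
      if k' = k ∧ a' = a ∧ b' = b ∧ c' = c then x else s.m k' a' b' c' }

@[simp] lemma St.set_r (s : St) (i x j : ℕ) :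
    (s.set i x).r j = if j = i then x else s.r j := rfl
@[simp] lemma St.set_m (s : St) (i x : ℕ) : (s.set i x).m = s.m := rfl
@[simp] lemma St.upd_r (s : St) (k a b c x : ℕ) : (s.upd k a b c x).r = s.r := rfl
@[simp] lemma St.upd_m (s : St) (k a b c x k' a' b' c' : ℕ) :
    (s.upd k a b c x).m k' a' b' c' =
      if k' = k ∧ a' = a ∧ b' = b ∧ c' = c then x else s.m k' a' b' c' := rfl

/-- The value of an expression, in exact arithmetic. -/
def Ex.eval (s : St) : Ex → ℕ
  | var i => s.r i
  | lit k => k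
  | add a b => a.eval s + b.eval s
  | sub a b => a.eval s - b.eval s
  | mul a b => a.eval s * b.eval s
  | rd k a b c => s.m k (a.eval s) (b.eval s) (c.eval s)

/-- The evaluation of the expression involves no overflow, no index out of range, and no
undefined subtraction. Variables have numbers below `32`; variable `3` holds the stride `M` of the
arrays. -/
def Ex.Ok (M W : ℕ) (s : St) : Ex → Prop
  | var i => i < 32
  | lit k => k < W
  | add a b => a.Ok M W s ∧ b.Ok M W s ∧ a.eval s + b.eval s < W
  | sub a b => a.Ok M W s ∧ b.Ok M W s ∧ b.eval s ≤ a.eval s ∧ a.eval s < W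
  | mul a b => a.Ok M W s ∧ b.Ok M W s ∧ a.eval s * b.eval s < W
  | rd k a b c => s.r 3 = M ∧ k < 16 ∧ (a.Ok M W s ∧ a.eval s < M) ∧ (b.Ok M W s ∧ b.eval s < M) ∧
      (c.Ok M W s ∧ c.eval s < M)

/-- The address of the cell with index `(a, b, c)` of the `k`-th array. -/
def addr (M k a b c : ℕ) : ℕ := ((k * M + a) * M + b) * M + c

lemma addr_inj {M k a b c k' a' b' c' : ℕ} (ha : a < M) (hb : b < M) (hc : c < M)
    (ha' : a' < M) (hb' : b' < M) (hc' : c' < M) (h : addr M k a b c = addr M k' a' b' c') :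
    k = k' ∧ a = a' ∧ b = b' ∧ c = c' := by
  have key : ∀ {x y x' y' : ℕ}, y < M → y' < M → x * M + y = x' * M + y' → x = x' ∧ y = y' := by
    intro x y x' y' hy hy' h
    have h1 := congrArg (· / M) h
    have h2 := congrArg (· % M) h
    have hM : 0 < M := by omega
    simp only [Nat.mul_comm _ M, Nat.mul_add_div hM, Nat.div_eq_of_lt hy, Nat.div_eq_of_lt hy',
      Nat.mul_add_mod, Nat.mod_eq_of_lt hy, Nat.mod_eq_of_lt hy', add_zero] at h1 h2
    exact ⟨h1, h2⟩
  unfold addr at h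
  obtain ⟨h, h1⟩ := key hc hc' h
  obtain ⟨h, h2⟩ := key hb hb' h
  obtain ⟨h, h3⟩ := key ha ha' h
  exact ⟨h, h3, h2, h1⟩

/-- Code that computes the address of a cell in register `t`, from code for the indices. -/
def addrCode (k t : ℕ) (ca cb cc : Program) : Program :=
  [.const t k] ++ (ca ++ ([.mul t t 3, .add t t (t + 1)] ++ (cb ++ ([.mul t t 3, .add t t (t + 1)]
    ++ (cc ++ [.mul t t 3, .add t t (t + 1)])))))

/-- Code that leaves the value of the expression in register `t` and changes no register below
`t`. As the machine has no instruction that copies a register, it divides by `1`. -/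
def Ex.code : Ex → ℕ → Program
  | var i, t => [.const t 1, .div t i t]
  | lit k, t => [.const t k]
  | add a b, t => a.code t ++ (b.code (t + 1) ++ [.add t t (t + 1)])
  | sub a b, t => a.code t ++ (b.code (t + 1) ++ [.sub t t (t + 1)])
  | mul a b, t => a.code t ++ (b.code (t + 1) ++ [.mul t t (t + 1)])
  | rd k a b c, t =>
      addrCode k t (a.code (t + 1)) (b.code (t + 1)) (c.code (t + 1)) ++ [.load t t]

/-- The number of instructions of the code for an expression. -/
def Ex.len : Ex → ℕ
  | var _ => 2
  | lit _ => 1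
  | add a b => a.len + b.len + 1
  | sub a b => a.len + b.len + 1
  | mul a b => a.len + b.len + 1
  | rd _ a b c => a.len + b.len + c.len + 8

@[simp] lemma Ex.length_code (e : Ex) (t : ℕ) : (e.code t).length = e.len := by
  induction e generalizing t <;> simp [Ex.code, Ex.len, addrCode, *] <;> omega

/-- The number of instructions of a command. -/
def Cmd.len : Cmd → ℕ
  | skip => 0
  | asg _ e => e.len + 2
  | wr _ a b c e => a.len + b.len + c.len + 7 + (e.len + 1)
  | rnd _ e => e.len + 1
  | seq c₁ c₂ => c₁.len + c₂.len
  | ite a b c₁ c₂ => a.len + (b.len + (1 + (c₂.len + (1 + c₁.len))))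
  | loop a b c => a.len + (b.len + (2 + (c.len + 1)))

/-- The code of a command, to be placed at address `p`. Registers from `32` on hold intermediate
results. -/
def Cmd.code : Cmd → ℕ → Program
  | skip, _ => []
  | asg x e, _ => e.code 32 ++ [.const 33 1, .div x 32 33]
  | wr k a b c e, _ =>
      addrCode k 32 (a.code 33) (b.code 33) (c.code 33) ++ (e.code 33 ++ [.store 32 33])
  | rnd x e, _ => e.code 32 ++ [.rand x 32]
  | seq c₁ c₂, p => c₁.code p ++ c₂.code (p + c₁.len)
  | ite a b c₁ c₂, p =>
      a.code 32 ++ (b.code 33 ++ ([.jlt 32 33 (p + a.len + b.len + 1 + c₂.len + 1)] ++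
        (c₂.code (p + a.len + b.len + 1) ++
          ([.jeq 32 32 (p + a.len + b.len + 1 + c₂.len + 1 + c₁.len)] ++
            c₁.code (p + a.len + b.len + 1 + c₂.len + 1)))))
  | loop a b c, p =>
      a.code 32 ++ (b.code 33 ++ ([.jlt 32 33 (p + a.len + b.len + 2),
        .jeq 32 32 (p + a.len + b.len + 2 + c.len + 1)] ++
          (c.code (p + a.len + b.len + 2) ++ [.jeq 32 32 p])))

@[simp] lemma Cmd.length_code (c : Cmd) (p : ℕ) : (c.code p).length = c.len := by
  induction c generalizing p <;> simp [Cmd.code, Cmd.len, addrCode, *] <;> omega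

/-! ### Expected cost of structured programs -/

/-- A program on a machine with words of `w` bits, together with an expected cost `X` from each
configuration on to which every executed instruction contributes at most `τ`; `M` is the stride of
the arrays. -/
structure Machine where
  prog : Program
  w : ℕ
  M : ℕ
  τ : ℝ≥0∞
  X : Config → ℝ≥0∞
  le_of_step : ∀ (c : Config) (ins : Instr), prog[c.pc]? = some ins →
    X c ≤ τ + ev (ins.exec w c) X
  stride_le : 16 * M ^ 3 ≤ 2 ^ w
  one_lt : 1 < 2 ^ w

/-- `code` stands at address `p` of `prog`. -/
def CodeAt (prog : Program) (p : ℕ) (code : Program) : Prop :=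
  ∀ i ins, code[i]? = some ins → prog[p + i]? = some ins

lemma CodeAt.left {prog : Program} {p : ℕ} {c₁ c₂ : Program} (h : CodeAt prog p (c₁ ++ c₂)) :
    CodeAt prog p c₁ := by
  intro i ins hi
  apply h
  have : i < c₁.length := by
    by_contra hc
    rw [List.getElem?_eq_none (by omega)] at hi
    cases hi
  rw [List.getElem?_append_left this, hi]

lemma CodeAt.right {prog : Program} {p : ℕ} {c₁ c₂ : Program} (h : CodeAt prog p (c₁ ++ c₂)) :
    CodeAt prog (p + c₁.length) c₂ := by
  intro i ins hi
  rw [add_assoc]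
  apply h
  rw [List.getElem?_append_right (by omega), Nat.add_sub_cancel_left, hi]

lemma CodeAt.right' {prog : Program} {p q : ℕ} {c₁ c₂ : Program} (h : CodeAt prog p (c₁ ++ c₂))
    (hq : q = p + c₁.length) : CodeAt prog q c₂ := hq ▸ h.right

lemma CodeAt.head {prog : Program} {p : ℕ} {ins : Instr} {c : Program}
    (h : CodeAt prog p (ins :: c)) : prog[p]? = some ins := h 0 ins rfl

lemma CodeAt.tail {prog : Program} {p : ℕ} {ins : Instr} {c : Program}
    (h : CodeAt prog p (ins :: c)) : CodeAt prog (p + 1) c :=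
  CodeAt.right (c₁ := [ins]) h

/-- The configuration represents the state: it agrees on the variables and on all cells with
indices below the stride. -/
def Rep (M : ℕ) (s : St) (c : Config) : Prop :=
  (∀ i < 32, c.reg i = s.r i) ∧
    ∀ k a b d, a < M → b < M → d < M → c.mem (addr M k a b d) = s.m k a b d

namespace Machine

variable (K : Machine)

lemma step_pure {c c' : Config} {ins : Instr} (h : K.prog[c.pc]? = some ins)
    (he : ins.exec K.w c = PMF.pure c') : K.X c ≤ K.τ + K.X c' := by
  have := K.le_of_step c ins h
  rwa [he, ev_pure] at this

/-- From `c` on, the machine deterministically executes the `k` next instructions, which advance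
the program counter by `k`, leave the registers below `t` and the memory unchanged, and put `x`
into register `t`. -/
def Computes (c : Config) (k t x : ℕ) (c' : Config) : Prop :=
  c'.pc = c.pc + k ∧ (∀ i < t, c'.reg i = c.reg i) ∧ c'.reg t = x ∧ c'.mem = c.mem ∧
    K.X c ≤ K.τ * k + K.X c'

variable {K}

lemma Computes.trans {c c' c'' : Config} {k k' t t' x x' : ℕ} (h : K.Computes c k t x c')
    (h' : K.Computes c' k' t' x' c'') (ht : t ≤ t') : c''.pc = c.pc + (k + k') ∧
      (∀ i < t, c''.reg i = c.reg i) ∧ (t < t' → c''.reg t = x) ∧ c''.reg t' = x' ∧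
        c''.mem = c.mem ∧ K.X c ≤ K.τ * (k + k' : ℕ) + K.X c'' := by
  obtain ⟨h1, h2, h3, h4, h5⟩ := h
  obtain ⟨g1, g2, g3, g4, g5⟩ := h'
  refine ⟨by omega, fun i hi => by rw [g2 i (by omega), h2 i hi], fun hlt => by rw [g2 t hlt, h3],
    g3, by rw [g4, h4], ?_⟩
  calc K.X c ≤ K.τ * k + K.X c' := h5
    _ ≤ K.τ * k + (K.τ * k' + K.X c'') := by gcongr
    _ = _ := by push_cast; ring

/-- A single instruction that puts `x` into register `t`. -/
lemma computes_put {c : Config} {ins : Instr} {t x : ℕ} (h : K.prog[c.pc]? = some ins)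
    (he : ins.exec K.w c = PMF.pure (c.put t x)) : K.Computes c 1 t x (c.put t x) := by
  refine ⟨rfl, fun i hi => ?_, by simp [Config.put], rfl, ?_⟩
  · simp [Config.put, Function.update_of_ne (by omega : i ≠ t)]
  · simpa using K.step_pure h he

/-- Two computations in the same register. -/
lemma Computes.comp {c c' c'' : Config} {k k' t x x' : ℕ} (h : K.Computes c k t x c')
    (h' : K.Computes c' k' t x' c'') : K.Computes c (k + k') t x' c'' := by
  obtain ⟨a, b, _, d, e, f⟩ := h.trans h' le_rfl
  exact ⟨a, b, d, e, f⟩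

/-- A computation in register `t`, one in register `t + 1`, and an instruction that combines the
results. -/
lemma Computes.binop {c c₁ c₂ : Config} {k₁ k₂ t x y z : ℕ} {ins : Instr}
    (h₁ : K.Computes c k₁ t x c₁) (h₂ : K.Computes c₁ k₂ (t + 1) y c₂)
    (h : K.prog[c₂.pc]? = some ins)
    (he : c₂.reg t = x → c₂.reg (t + 1) = y → (∀ i < t, c₂.reg i = c.reg i) → c₂.mem = c.mem →
      ins.exec K.w c₂ = PMF.pure (c₂.put t z)) :
    K.Computes c (k₁ + k₂ + 1) t z (c₂.put t z) := by
  obtain ⟨a, b, d, e, f, g⟩ := h₁.trans h₂ (by omega)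
  have := computes_put h (he (d (by omega)) e b f)
  obtain ⟨a', b', d', e', f'⟩ := this
  refine ⟨by omega, fun i hi => by rw [b' i hi, b i hi], d', by rw [e', f], ?_⟩
  refine g.trans ?_
  calc _ ≤ K.τ * (k₁ + k₂ : ℕ) + (K.τ * (1 : ℕ) + K.X (c₂.put t z)) := by gcongr
    _ = _ := by push_cast; ring

lemma _root_.DynColoring.Rep.of_computes {s : St} {c c' : Config} {k t x : ℕ} (h : Rep K.M s c)
    (hc : K.Computes c k t x c') (ht : 32 ≤ t) : Rep K.M s c' :=
  ⟨fun i hi => by rw [hc.2.1 i (by omega), h.1 i hi],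
    fun k a b d ha hb hd => by rw [hc.2.2.2.1, h.2 k a b d ha hb hd]⟩

/-- Multiplication of register `t` by the stride and addition of an index. -/
lemma Computes.index {s : St} {c c₁ c₂ : Config} {k₁ k₂ t x y : ℕ} (hs : Rep K.M s c)
    (ht : 32 ≤ t) (hM : s.r 3 = K.M) (hW : x * K.M + y < 2 ^ K.w)
    (h₁ : K.Computes c k₁ t x c₁) (h₂ : K.Computes c₁ k₂ (t + 1) y c₂)
    (h : CodeAt K.prog c₂.pc [.mul t t 3, .add t t (t + 1)]) :
    ∃ c', K.Computes c (k₁ + k₂ + 2) t (x * K.M + y) c' := by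
  obtain ⟨a, b, d, e, f, g⟩ := h₁.trans h₂ (by omega)
  have hM3 : c₂.reg 3 = K.M := by rw [b 3 (by omega), hs.1 3 (by omega), hM]
  have hx : c₂.reg t = x := d (by omega)
  have s1 := computes_put (K := K) (t := t) (x := x * K.M) h.head
    (by rw [Instr.exec, hM3, hx, Nat.mod_eq_of_lt (by omega)])
  have s2 := computes_put (K := K) (c := c₂.put t (x * K.M)) (t := t) (x := x * K.M + y)
    (ins := .add t t (t + 1)) (by exact h.tail.head)
    (by
      have h1 : (c₂.put t (x * K.M)).reg t = x * K.M := by simp [Config.put]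
      have h2 : (c₂.put t (x * K.M)).reg (t + 1) = y := by
        simp [Config.put, e]
      rw [Instr.exec, h1, h2, Nat.mod_eq_of_lt hW])
  obtain ⟨a', b', d', e', f'⟩ := s1.comp s2
  refine ⟨_, by rw [a', a]; ring, fun i hi => by rw [b' i hi, b i hi], d', by rw [e', f], ?_⟩
  refine g.trans ?_
  calc _ ≤ K.τ * (k₁ + k₂ : ℕ) + (K.τ * (1 + 1 : ℕ) + _) := by gcongr
    _ = _ := by push_cast; ring

/-- The code for an expression evaluates it. -/
def Evaluates (K : Machine) (s : St) (t : ℕ) (e : Ex) : Prop :=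
  ∀ c, Rep K.M s c → CodeAt K.prog c.pc (e.code t) →
    ∃ c', K.Computes c e.len t (e.eval s) c'

lemma addr_lt {k a b d : ℕ} (hk : k < 16) (ha : a < K.M) (hb : b < K.M) (hd : d < K.M) :
    k * K.M + a < 2 ^ K.w ∧ (k * K.M + a) * K.M + b < 2 ^ K.w ∧ addr K.M k a b d < 2 ^ K.w := by
  have hW := K.stride_le
  have h1 : k * K.M + a + 1 ≤ 16 * K.M := by nlinarith
  have h2 : (k * K.M + a) * K.M + b + 1 ≤ 16 * K.M ^ 2 := by nlinarith
  have h3 : addr K.M k a b d + 1 ≤ 16 * K.M ^ 3 := by unfold addr; nlinarith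
  have hM : 1 ≤ K.M := by omega
  have h4 : K.M ≤ K.M ^ 2 := by nlinarith
  have h5 : K.M ^ 2 ≤ K.M ^ 3 := by nlinarith
  refine ⟨by omega, by omega, by omega⟩

lemma computes_addr {s : St} {c : Config} {t k : ℕ} {a b d : Ex} (hs : Rep K.M s c) (ht : 32 ≤ t)
    (hM : s.r 3 = K.M) (hk : k < 16)
    (ha : Evaluates K s (t + 1) a) (hb : Evaluates K s (t + 1) b) (hd : Evaluates K s (t + 1) d)
    (ha' : a.eval s < K.M) (hb' : b.eval s < K.M) (hd' : d.eval s < K.M)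
    (h : CodeAt K.prog c.pc
      (addrCode k t (a.code (t + 1)) (b.code (t + 1)) (d.code (t + 1)))) :
    ∃ c', K.Computes c (a.len + b.len + d.len + 7) t
      (addr K.M k (a.eval s) (b.eval s) (d.eval s)) c' := by
  obtain ⟨l1, l2, l3⟩ := addr_lt hk ha' hb' hd'
  unfold addrCode at h
  have hk' : k < 2 ^ K.w := by
    have : k ≤ k * K.M := Nat.le_mul_of_pos_right _ (by omega)
    omega
  have s1 := computes_put (K := K) (t := t) (x := k) h.left.head
    (by rw [Instr.exec, Nat.mod_eq_of_lt hk'])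
  have h2 := h.right
  obtain ⟨c2, s2⟩ := ha _ (DynColoring.Rep.of_computes hs s1 ht) h2.left
  have h3 := h2.right' (q := c2.pc) (by rw [s2.1]; simp [Config.put])
  obtain ⟨c3, s3⟩ := Computes.index hs ht hM l1 s1 s2 h3.left
  have h4 := h3.right' (q := c3.pc) (by rw [s3.1, s2.1]; simp [Config.put]; omega)
  obtain ⟨c4, s4⟩ := hb _ (DynColoring.Rep.of_computes hs s3 ht) h4.left
  have h5 := h4.right' (q := c4.pc) (by rw [s4.1]; simp)
  obtain ⟨c5, s5⟩ := Computes.index hs ht hM l2 s3 s4 h5.left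
  have h6 := h5.right' (q := c5.pc) (by rw [s5.1, s4.1, s3.1]; simp; omega)
  obtain ⟨c6, s6⟩ := hd _ (DynColoring.Rep.of_computes hs s5 ht) h6.left
  have h7 := h6.right' (q := c6.pc) (by rw [s6.1]; simp)
  obtain ⟨c7, s7⟩ := Computes.index hs ht hM l3 s5 s6 h7
  have hlen : a.len + b.len + d.len + 7 = 1 + a.len + 2 + b.len + 2 + d.len + 2 := by omega
  exact ⟨c7, hlen ▸ s7⟩

lemma evaluates {s : St} (e : Ex) {t : ℕ} (ht : 32 ≤ t) (h : e.Ok K.M (2 ^ K.w) s) :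
    Evaluates K s t e := by
  induction e generalizing t with
  | var i =>
    intro c hs hc
    change i < 32 at h
    have s1 := computes_put (K := K) (t := t) (x := 1) hc.head
      (by rw [Instr.exec, Nat.mod_eq_of_lt K.one_lt])
    have s2 := computes_put (K := K) (c := c.put t 1) (t := t) (x := s.r i) (ins := .div t i t)
      (by exact hc.tail.head)
      (by
        have h1 : (c.put t 1).reg t = 1 := by simp [Config.put]
        have h2 : (c.put t 1).reg i = s.r i := by
          simp [Config.put, Function.update_of_ne (by omega : i ≠ t), hs.1 i h]
        rw [Instr.exec, h1, h2, Nat.div_one])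
    exact ⟨_, s1.comp s2⟩
  | lit k =>
    intro c hs hc
    change k < 2 ^ K.w at h
    exact ⟨_, computes_put (K := K) (t := t) (x := k) hc.head
      (by rw [Instr.exec, Nat.mod_eq_of_lt h])⟩
  | add a b iha ihb =>
    obtain ⟨h1, h2, h3⟩ := h
    intro c hs hc
    unfold Ex.code at hc
    obtain ⟨c1, s1⟩ := iha ht h1 c hs hc.left
    have hc1 := hc.right' (q := c1.pc) (by rw [s1.1]; simp)
    obtain ⟨c2, s2⟩ := ihb (t := t + 1) (by omega) h2 c1 (DynColoring.Rep.of_computes hs s1 ht) hc1.left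
    have hc2 := hc1.right' (q := c2.pc) (by rw [s2.1]; simp)
    refine ⟨_, Computes.binop s1 s2 hc2.head fun e1 e2 _ _ => ?_⟩
    rw [Instr.exec, e1, e2, Nat.mod_eq_of_lt h3]; rfl
  | sub a b iha ihb =>
    obtain ⟨h1, h2, h3, h4⟩ := h
    intro c hs hc
    unfold Ex.code at hc
    obtain ⟨c1, s1⟩ := iha ht h1 c hs hc.left
    have hc1 := hc.right' (q := c1.pc) (by rw [s1.1]; simp)
    obtain ⟨c2, s2⟩ := ihb (t := t + 1) (by omega) h2 c1 (DynColoring.Rep.of_computes hs s1 ht) hc1.left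
    have hc2 := hc1.right' (q := c2.pc) (by rw [s2.1]; simp)
    refine ⟨_, Computes.binop s1 s2 hc2.head fun e1 e2 _ _ => ?_⟩
    have : a.eval s + 2 ^ K.w - b.eval s = (a.eval s - b.eval s) + 2 ^ K.w := by omega
    rw [Instr.exec, e1, e2, this, Nat.add_mod_right, Nat.mod_eq_of_lt (by omega)]; rfl
  | mul a b iha ihb =>
    obtain ⟨h1, h2, h3⟩ := h
    intro c hs hc
    unfold Ex.code at hc
    obtain ⟨c1, s1⟩ := iha ht h1 c hs hc.left
    have hc1 := hc.right' (q := c1.pc) (by rw [s1.1]; simp)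
    obtain ⟨c2, s2⟩ := ihb (t := t + 1) (by omega) h2 c1 (DynColoring.Rep.of_computes hs s1 ht) hc1.left
    have hc2 := hc1.right' (q := c2.pc) (by rw [s2.1]; simp)
    refine ⟨_, Computes.binop s1 s2 hc2.head fun e1 e2 _ _ => ?_⟩
    rw [Instr.exec, e1, e2, Nat.mod_eq_of_lt h3]; rfl
  | rd k a b d iha ihb ihd =>
    obtain ⟨hM, hk, ⟨a1, a2⟩, ⟨b1, b2⟩, ⟨d1, d2⟩⟩ := h
    intro c hs hc
    unfold Ex.code at hc
    obtain ⟨c1, s1⟩ := computes_addr hs ht hM hk (iha (by omega) a1) (ihb (by omega) b1)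
      (ihd (by omega) d1) a2 b2 d2 hc.left
    have hc1 := hc.right' (q := c1.pc) (by rw [s1.1]; simp [addrCode]; omega)
    have s2 := computes_put (K := K) (t := t) (x := (Ex.rd k a b d).eval s) hc1.head
      (by rw [Instr.exec, s1.2.2.1, s1.2.2.2.1, hs.2 _ _ _ _ a2 b2 d2]; rfl)
    exact ⟨_, s1.comp s2⟩

end Machine

namespace Machine

variable (K : Machine)

/-- The number of values of a word. -/
def W : ℕ := 2 ^ K.w

/-- The expected cost from program counter `p` on, in the worst case over all configurations that
represent `s`. -/
noncomputable def cost (p : ℕ) (s : St) : ℝ≥0∞ :=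
  ⨆ c, ⨆ (_ : Rep K.M s c ∧ c.pc = p), K.X c

/-- The weakest-precondition transformer for expected costs: if the expected cost from the end of
the command `c` on is bounded by `f`, then `wp c f` bounds the expected cost from its beginning on,
wherever in the program the command stands. -/
noncomputable def wp (c : Cmd) (f : St → ℝ≥0∞) (s : St) : ℝ≥0∞ :=
  ⨆ p, ⨆ (_ : CodeAt K.prog p (c.code p)), ⨆ (_ : ∀ s', K.cost (p + c.len) s' ≤ f s'), K.cost p s

variable {K}

lemma le_cost {s : St} {c : Config} (h : Rep K.M s c) : K.X c ≤ K.cost c.pc s :=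
  le_iSup₂_of_le (f := fun c (_ : Rep K.M s c ∧ c.pc = _) => K.X c) c ⟨h, rfl⟩ le_rfl

lemma cost_le_wp {c : Cmd} {f : St → ℝ≥0∞} {p : ℕ} (h : CodeAt K.prog p (c.code p))
    (hf : ∀ s', K.cost (p + c.len) s' ≤ f s') (s : St) : K.cost p s ≤ K.wp c f s := by
  unfold wp
  exact le_iSup_of_le p (le_iSup_of_le h (le_iSup_of_le hf le_rfl))

lemma wp_le {c : Cmd} {f : St → ℝ≥0∞} {s : St} {b : ℝ≥0∞}
    (h : ∀ c₀, Rep K.M s c₀ → CodeAt K.prog c₀.pc (c.code c₀.pc) →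
      (∀ s', K.cost (c₀.pc + c.len) s' ≤ f s') → K.X c₀ ≤ b) : K.wp c f s ≤ b := by
  unfold wp
  refine iSup_le fun p => iSup_le fun hp => iSup_le fun hf => ?_
  unfold cost
  refine iSup₂_le fun c₀ ⟨hr, hc⟩ => ?_
  subst hc
  exact h c₀ hr hp hf

lemma wp_skip (f : St → ℝ≥0∞) (s : St) : K.wp .skip f s ≤ f s :=
  wp_le fun _ hr _ hf => (le_cost hr).trans (hf s)

lemma wp_seq (c₁ c₂ : Cmd) (f : St → ℝ≥0∞) (s : St) :
    K.wp (c₁ ;; c₂) f s ≤ K.wp c₁ (K.wp c₂ f) s := by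
  refine wp_le fun c₀ hr hc hf => (le_cost hr).trans (cost_le_wp hc.left (fun s' => ?_) s)
  refine cost_le_wp (hc.right' (by simp)) (fun s'' => ?_) s'
  rw [add_assoc]
  exact hf s''

lemma _root_.DynColoring.Rep.put {s : St} {c : Config} (h : Rep K.M s c) (i x : ℕ) :
    Rep K.M (s.set i x) (c.put i x) := by
  refine ⟨fun j hj => ?_, h.2⟩
  by_cases hji : j = i
  · subst hji; simp [Config.put]
  · simp [Config.put, hji, h.1 j hj]

lemma wp_asg {x : ℕ} {e : Ex} (f : St → ℝ≥0∞) {s : St}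
    (h : e.Ok K.M K.W s) :
    K.wp (.asg x e) f s ≤ K.τ * (e.len + 2 : ℕ) + f (s.set x (e.eval s)) := by
  refine wp_le fun c₀ hr hc hf => ?_
  unfold Cmd.code at hc
  obtain ⟨c1, s1⟩ := evaluates e le_rfl h c₀ hr hc.left
  have hc1 := hc.right' (q := c1.pc) (by rw [s1.1]; simp)
  have s2 := computes_put (K := K) (t := 33) (x := 1) hc1.head
    (by rw [Instr.exec, Nat.mod_eq_of_lt K.one_lt])
  have h3 : K.X (c1.put 33 1) ≤ K.τ + K.X ((c1.put 33 1).put x (e.eval s)) := by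
    refine K.step_pure (ins := .div x 32 33) (by exact hc1.tail.head) ?_
    rw [Instr.exec]
    simp [Config.put, s1.2.2.1]
  have hr2 : Rep K.M s (c1.put 33 1) := (hr.of_computes s1 le_rfl).of_computes s2 (by omega)
  have h4 := (le_cost (hr2.put x (e.eval s)))
  have hpc : ((c1.put 33 1).put x (e.eval s)).pc = c₀.pc + (Cmd.asg x e).len := by
    simp [Config.put, s1.1, Cmd.len]; omega
  rw [hpc] at h4
  calc K.X c₀ ≤ K.τ * e.len + (K.τ * (1 : ℕ) + (K.τ + f (s.set x (e.eval s)))) :=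
        s1.2.2.2.2.trans (by gcongr; exact s2.2.2.2.2.trans (by
          gcongr; exact h3.trans (by gcongr; exact h4.trans (hf _))))
    _ = _ := by push_cast; ring

lemma wp_wr {k : ℕ} {a b d e : Ex} (f : St → ℝ≥0∞) {s : St}
    (h : (Ex.rd k a b d).Ok K.M K.W s) (he : e.Ok K.M K.W s) :
    K.wp (.wr k a b d e) f s ≤ K.τ * ((Cmd.wr k a b d e).len : ℕ) +
      f (s.upd k (a.eval s) (b.eval s) (d.eval s) (e.eval s)) := by
  obtain ⟨hM, hk, ⟨a1, a2⟩, ⟨b1, b2⟩, ⟨d1, d2⟩⟩ := h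
  refine wp_le fun c₀ hr hc hf => ?_
  unfold Cmd.code at hc
  obtain ⟨c1, s1⟩ := computes_addr hr le_rfl hM hk (evaluates a (by omega) a1)
    (evaluates b (by omega) b1) (evaluates d (by omega) d1) a2 b2 d2 hc.left
  have hc1 := hc.right' (q := c1.pc) (by rw [s1.1]; simp [addrCode]; omega)
  obtain ⟨c2, s2⟩ := evaluates e (t := 33) (by omega) he c1 (hr.of_computes s1 le_rfl) hc1.left
  have hc2 := hc1.right' (q := c2.pc) (by rw [s2.1]; simp)
  have hr2 := (hr.of_computes s1 le_rfl).of_computes s2 (by omega)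
  obtain ⟨e1, e2, e3, e4, e5, e6⟩ := s1.trans s2 (by omega)
  set c3 : Config := ⟨c2.pc + 1, c2.reg, Function.update c2.mem (c2.reg 32) (c2.reg 33)⟩ with hc3
  have h3 : K.X c2 ≤ K.τ + K.X c3 := K.step_pure (ins := .store 32 33) hc2.head rfl
  have hr3 : Rep K.M (s.upd k (a.eval s) (b.eval s) (d.eval s) (e.eval s)) c3 := by
    refine ⟨hr2.1, fun k' a' b' d' ha hb hd => ?_⟩
    change Function.update c2.mem (c2.reg 32) (c2.reg 33) _ = _
    rw [e3 (by omega), e4, St.upd_m]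
    split_ifs with hif
    · obtain ⟨rfl, rfl, rfl, rfl⟩ := hif
      simp
    · rw [Function.update_of_ne, hr2.2 k' a' b' d' ha hb hd]
      intro heq
      exact hif (addr_inj ha hb hd a2 b2 d2 heq)
  have h4 := le_cost hr3
  have hpc : c3.pc = c₀.pc + (Cmd.wr k a b d e).len := by
    simp [hc3, e1, Cmd.len]; omega
  rw [hpc] at h4
  calc K.X c₀ ≤ K.τ * (a.len + b.len + d.len + 7 + e.len : ℕ) + (K.τ +
        f (s.upd k (a.eval s) (b.eval s) (d.eval s) (e.eval s))) :=
        e6.trans (by gcongr; exact h3.trans (by gcongr; exact h4.trans (hf _)))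
    _ = _ := by simp only [Cmd.len]; push_cast; ring

lemma ev_rand (w x t : ℕ) (c : Config) (f : Config → ℝ≥0∞) :
    ev (Instr.exec w (.rand x t) c) f =
      (∑ y ∈ Finset.range (c.reg t + 1), f (c.put x y)) / (c.reg t + 1 : ℕ) := by
  rw [Instr.exec, ev_map]
  change ev (PMF.bind _ fun a => PMF.pure _) _ = _
  rw [ev_bind]
  simp only [ev_pure]
  rw [ev_uniform, Finset.sum_range]

lemma wp_rnd {x : ℕ} {e : Ex} (f : St → ℝ≥0∞) {s : St}
    (h : e.Ok K.M K.W s) :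
    K.wp (.rnd x e) f s ≤ K.τ * (e.len + 1 : ℕ) +
      (∑ y ∈ Finset.range (e.eval s + 1), f (s.set x y)) / (e.eval s + 1 : ℕ) := by
  refine wp_le fun c₀ hr hc hf => ?_
  unfold Cmd.code at hc
  obtain ⟨c1, s1⟩ := evaluates e le_rfl h c₀ hr hc.left
  have hc1 := hc.right' (q := c1.pc) (by rw [s1.1]; simp)
  have h2 := K.le_of_step c1 _ hc1.head
  rw [ev_rand, s1.2.2.1] at h2
  have hr2 : Rep K.M s c1 := hr.of_computes s1 le_rfl
  have h3 : ∀ y, K.X (c1.put x y) ≤ f (s.set x y) := by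
    intro y
    refine (le_cost (hr2.put x y)).trans ?_
    have hpc : (c1.put x y).pc = c₀.pc + (Cmd.rnd x e).len := by
      simp [Config.put, s1.1, Cmd.len]; omega
    rw [hpc]
    exact hf _
  calc K.X c₀ ≤ K.τ * e.len + (K.τ + (∑ y ∈ Finset.range (e.eval s + 1), f (s.set x y)) /
          (e.eval s + 1 : ℕ)) :=
        s1.2.2.2.2.trans (by gcongr; exact h2.trans (by gcongr; exact h3 _))
    _ = _ := by push_cast; ring

/-- Evaluation of the two sides of a comparison. -/
lemma computes_pair {a b : Ex} {s : St} {c₀ : Config} {rest : Program} (hr : Rep K.M s c₀)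
    (ha : a.Ok K.M K.W s) (hb : b.Ok K.M K.W s)
    (hc : CodeAt K.prog c₀.pc (a.code 32 ++ (b.code 33 ++ rest))) :
    ∃ c, Rep K.M s c ∧ c.pc = c₀.pc + a.len + b.len ∧ CodeAt K.prog c.pc rest ∧
      c.reg 32 = a.eval s ∧ c.reg 33 = b.eval s ∧
      K.X c₀ ≤ K.τ * (a.len + b.len : ℕ) + K.X c := by
  obtain ⟨c1, s1⟩ := evaluates a le_rfl ha c₀ hr hc.left
  have hc1 := hc.right' (q := c1.pc) (by rw [s1.1]; simp)
  obtain ⟨c2, s2⟩ := evaluates b (t := 33) (by omega) hb c1 (hr.of_computes s1 le_rfl) hc1.left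
  have hc2 := hc1.right' (q := c2.pc) (by rw [s2.1]; simp)
  obtain ⟨e1, e2, e3, e4, e5, e6⟩ := s1.trans s2 (by omega)
  exact ⟨c2, (hr.of_computes s1 le_rfl).of_computes s2 (by omega), by omega, hc2,
    e3 (by omega), e4, e6⟩

lemma _root_.DynColoring.Rep.with_pc {s : St} {c : Config} (h : Rep K.M s c) (p : ℕ) :
    Rep K.M s { c with pc := p } := h

lemma wp_ite {a b : Ex} {c₁ c₂ : Cmd} (f : St → ℝ≥0∞) {s : St}
    (ha : a.Ok K.M K.W s) (hb : b.Ok K.M K.W s) :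
    K.wp (.ite a b c₁ c₂) f s ≤ K.τ * (a.len + b.len + 1 : ℕ) +
      if a.eval s < b.eval s then K.wp c₁ f s else K.wp c₂ (fun s' => K.τ + f s') s := by
  refine wp_le fun c₀ hr hc hf => ?_
  unfold Cmd.code at hc
  obtain ⟨c, hr1, hpc, hc1, e1, e2, hX⟩ := computes_pair hr ha hb hc
  have h1 := K.step_pure hc1.head rfl
  rw [e1, e2] at h1
  have hl := hc1.right
  have hcode₂ := hl.left
  have hl2 := hl.right
  have hj := hl2.head
  have hcode₁ := hl2.right
  simp only [Cmd.len] at hf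
  simp only [List.length_cons, List.length_nil, Cmd.length_code, hpc, zero_add] at hcode₂ hj hcode₁
  refine hX.trans ?_
  split_ifs with hlt
  · rw [if_pos hlt] at h1
    have h2 : K.X { c with pc := c₀.pc + a.len + b.len + 1 + c₂.len + 1 } ≤ K.wp c₁ f s := by
      refine (le_cost (hr1.with_pc _)).trans (cost_le_wp hcode₁ (fun s' => ?_) s)
      refine le_trans (le_of_eq ?_) (hf s')
      congr 1; omega
    calc _ ≤ K.τ * (a.len + b.len : ℕ) + (K.τ + K.wp c₁ f s) := by
          gcongr; exact h1.trans (by gcongr)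
      _ = _ := by push_cast; ring
  · rw [if_neg hlt, hpc] at h1
    have h2 : K.X { c with pc := c₀.pc + a.len + b.len + 1 } ≤
        K.wp c₂ (fun s' => K.τ + f s') s := by
      refine (le_cost (hr1.with_pc _)).trans (cost_le_wp hcode₂ (fun s' => ?_) s)
      unfold cost
      refine iSup₂_le fun c' ⟨hr', hc'⟩ => ?_
      have h3 := K.step_pure (c := c') (by rw [hc']; exact hj) rfl
      rw [if_pos rfl] at h3
      refine h3.trans ?_
      gcongr
      refine (le_cost (hr'.with_pc _)).trans (le_trans (le_of_eq ?_) (hf s'))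
      congr 1; simp only; omega
    calc _ ≤ K.τ * (a.len + b.len : ℕ) + (K.τ + K.wp c₂ (fun s' => K.τ + f s') s) := by
          gcongr; exact h1.trans (by gcongr)
      _ = _ := by push_cast; ring

lemma wp_loop {a b : Ex} {c₁ : Cmd} (f : St → ℝ≥0∞) {s : St}
    (ha : a.Ok K.M K.W s) (hb : b.Ok K.M K.W s) :
    K.wp (.loop a b c₁) f s ≤ K.τ * (a.len + b.len + 2 : ℕ) +
      if a.eval s < b.eval s then
        K.wp c₁ (fun s' => K.τ + K.wp (.loop a b c₁) f s') s else f s := by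
  refine wp_le fun c₀ hr hc hf => ?_
  have hcode := hc
  unfold Cmd.code at hc
  obtain ⟨c, hr1, hpc, hc1, e1, e2, hX⟩ := computes_pair hr ha hb hc
  have h1 := K.step_pure hc1.head rfl
  rw [e1, e2] at h1
  have hj := hc1.tail.head
  have hl := hc1.right
  have hcode₁ := hl.left
  have hback := hl.right.head
  have hlen : (Cmd.loop a b c₁).len = a.len + (b.len + (2 + (c₁.len + 1))) := rfl
  simp only [List.length_cons, List.length_nil, Cmd.length_code, hpc, zero_add] at hcode₁ hj hback
  refine hX.trans ?_
  split_ifs with hlt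
  · rw [if_pos hlt] at h1
    have h2 : K.X { c with pc := c₀.pc + a.len + b.len + 2 } ≤
        K.wp c₁ (fun s' => K.τ + K.wp (.loop a b c₁) f s') s := by
      refine (le_cost (hr1.with_pc _)).trans (cost_le_wp hcode₁ (fun s' => ?_) s)
      unfold cost
      refine iSup₂_le fun c' ⟨hr', hc'⟩ => ?_
      have h3 := K.step_pure (c := c') (by rw [hc']; exact hback) rfl
      rw [if_pos rfl] at h3
      refine h3.trans ?_
      gcongr
      exact (le_cost (hr'.with_pc _)).trans (cost_le_wp hcode hf _)
    calc _ ≤ K.τ * (a.len + b.len : ℕ) + (K.τ +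
            K.wp c₁ (fun s' => K.τ + K.wp (.loop a b c₁) f s') s) := by
          gcongr; exact h1.trans (add_le_add le_rfl h2)
      _ ≤ K.τ * (a.len + b.len : ℕ) + (K.τ +
            K.wp c₁ (fun s' => K.τ + K.wp (.loop a b c₁) f s') s) + K.τ := le_self_add
      _ = _ := by push_cast; ring
  · rw [if_neg hlt] at h1
    have h2 := K.step_pure (c := { c with pc := c.pc + 1 }) (by simp only [hpc]; exact hj) rfl
    rw [if_pos rfl] at h2
    have h3 := (le_cost (hr1.with_pc (c₀.pc + a.len + b.len + 2 + c₁.len + 1)))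
    have hpc' : c₀.pc + a.len + b.len + 2 + c₁.len + 1 = c₀.pc + (Cmd.loop a b c₁).len := by omega
    calc _ ≤ K.τ * (a.len + b.len : ℕ) + (K.τ + (K.τ + f s)) := by
          gcongr
          refine h1.trans (add_le_add le_rfl (h2.trans (add_le_add le_rfl (h3.trans ?_))))
          rw [hpc']
          exact hf s
      _ = _ := by push_cast; ring

/-! ### Hoare triples for the deterministic parts -/

/-- Started in `s`, the command takes at most `k` instructions and ends in a state with property
`P`. -/
def Tri (K : Machine) (c : Cmd) (s : St) (k : ℕ) (P : St → Prop) : Prop :=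
  ∀ (f : St → ℝ≥0∞) (b : ℝ≥0∞), (∀ s', P s' → f s' ≤ b) → K.wp c f s ≤ K.τ * k + b

lemma Tri.mono {c : Cmd} {s : St} {k k' : ℕ} {P Q : St → Prop} (h : K.Tri c s k P) (hk : k ≤ k')
    (hPQ : ∀ s', P s' → Q s') : K.Tri c s k' Q := fun f _ hf =>
  (h f _ fun s' hs' => hf s' (hPQ s' hs')).trans (by gcongr)

lemma tri_skip {s : St} {P : St → Prop} (h : P s) : K.Tri .skip s Cmd.skip.len P := fun f B hf =>
  (wp_skip f s).trans (by simpa [Cmd.len] using hf s h)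

lemma Tri.seq {c₁ c₂ : Cmd} {s : St} {k k₁ k₂ : ℕ} {P Q : St → Prop} (h₁ : K.Tri c₁ s k₁ P)
    (h₂ : ∀ s', P s' → K.Tri c₂ s' k₂ Q) (hk : k₁ + k₂ ≤ k) : K.Tri (c₁ ;; c₂) s k Q := by
  intro f B hf
  refine (wp_seq _ _ _ _).trans ((h₁ _ (K.τ * k₂ + B) fun s' hs' => h₂ s' hs' f B hf).trans ?_)
  calc _ = K.τ * (k₁ + k₂ : ℕ) + B := by push_cast; ring
    _ ≤ _ := by gcongr

lemma tri_asg {x : ℕ} {e : Ex} {s : St} {P : St → Prop}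
    (h : e.Ok K.M K.W s) (hP : P (s.set x (e.eval s))) :
    K.Tri (.asg x e) s (Cmd.asg x e).len P := fun f _ hf =>
  (wp_asg f h).trans (add_le_add le_rfl (hf _ hP))

lemma tri_wr {k : ℕ} {a b d e : Ex} {s : St} {P : St → Prop}
    (h : (Ex.rd k a b d).Ok K.M K.W s) (he : e.Ok K.M K.W s)
    (hP : P (s.upd k (a.eval s) (b.eval s) (d.eval s) (e.eval s))) :
    K.Tri (.wr k a b d e) s ((Cmd.wr k a b d e).len) P := fun f _ hf =>
  (wp_wr f h he).trans (by gcongr; exact hf _ hP)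

lemma tri_ite {a b : Ex} {c₁ c₂ : Cmd} {s : St} {P : St → Prop}
    (ha : a.Ok K.M K.W s) (hb : b.Ok K.M K.W s)
    (h₁ : a.eval s < b.eval s → K.Tri c₁ s c₁.len P)
    (h₂ : b.eval s ≤ a.eval s → K.Tri c₂ s c₂.len P) :
    K.Tri (.ite a b c₁ c₂) s (Cmd.ite a b c₁ c₂).len P := by
  intro f B hf
  refine (wp_ite f ha hb).trans ?_
  split_ifs with hlt
  · calc _ ≤ K.τ * (a.len + b.len + 1 : ℕ) + (K.τ * c₁.len + B) := by
          gcongr; exact h₁ hlt f B hf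
      _ = K.τ * (a.len + b.len + 1 + c₁.len : ℕ) + B := by push_cast; ring
      _ ≤ _ := by gcongr; simp only [Cmd.len]; omega
  · calc _ ≤ K.τ * (a.len + b.len + 1 : ℕ) + (K.τ * c₂.len + (K.τ + B)) := by
          gcongr
          exact h₂ (by omega) _ _ fun s' hs' => by gcongr; exact hf s' hs'
      _ = K.τ * (a.len + b.len + 2 + c₂.len : ℕ) + B := by push_cast; ring
      _ ≤ _ := by gcongr; simp only [Cmd.len]; omega

lemma Tri.seq_len {c₁ c₂ : Cmd} {s : St} {P Q : St → Prop} (h₁ : K.Tri c₁ s c₁.len P)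
    (h₂ : ∀ s', P s' → K.Tri c₂ s' c₂.len Q) : K.Tri (c₁ ;; c₂) s (c₁ ;; c₂).len Q :=
  Tri.seq h₁ h₂ le_rfl

lemma tri_asg_seq {x : ℕ} {e : Ex} {c : Cmd} {s : St} {Q : St → Prop}
    (h : e.Ok K.M K.W s) (hc : K.Tri c (s.set x (e.eval s)) c.len Q) :
    K.Tri (.asg x e ;; c) s (.asg x e ;; c : Cmd).len Q :=
  Tri.seq_len (P := fun s' => s' = s.set x (e.eval s)) (tri_asg h rfl) (by rintro _ rfl; exact hc)

lemma tri_wr_seq {k : ℕ} {a b d e : Ex} {c : Cmd} {s : St} {Q : St → Prop}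
    (h : (Ex.rd k a b d).Ok K.M K.W s) (he : e.Ok K.M K.W s)
    (hc : K.Tri c (s.upd k (a.eval s) (b.eval s) (d.eval s) (e.eval s)) c.len Q) :
    K.Tri (.wr k a b d e ;; c) s (.wr k a b d e ;; c : Cmd).len Q :=
  Tri.seq_len (P := fun s' => s' = s.upd k (a.eval s) (b.eval s) (d.eval s) (e.eval s))
    (tri_wr h he rfl) (by rintro _ rfl; exact hc)

/-- A loop with invariant `I i`, where `i` is the number of remaining rounds. -/
lemma tri_loop {a b : Ex} {c : Cmd} {k i : ℕ} {s : St} (I : ℕ → St → Prop)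
    (hok : ∀ i s, I i s → a.Ok K.M K.W s ∧ b.Ok K.M K.W s)
    (hexit : ∀ s, I 0 s → b.eval s ≤ a.eval s)
    (hstep : ∀ i s, I (i + 1) s → a.eval s < b.eval s ∧ K.Tri c s k (I i)) (hI : I i s) :
    K.Tri (.loop a b c) s ((k + (a.len + b.len + 3)) * i + (a.len + b.len + 2)) (I 0) := by
  intro f B hf
  induction i generalizing s with
  | zero =>
    obtain ⟨h1, h2⟩ := hok _ _ hI
    refine (wp_loop f h1 h2).trans ?_
    rw [if_neg (by have := hexit s hI; omega)]
    simp only [mul_zero, zero_add]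
    gcongr
    exact hf s hI
  | succ i ih =>
    obtain ⟨h1, h2⟩ := hok _ _ hI
    obtain ⟨h3, h4⟩ := hstep i s hI
    refine (wp_loop f h1 h2).trans ?_
    rw [if_pos h3]
    calc _ ≤ K.τ * (a.len + b.len + 2 : ℕ) + (K.τ * k + (K.τ +
            (K.τ * ((k + (a.len + b.len + 3)) * i + (a.len + b.len + 2) : ℕ) + B))) := by
          gcongr
          refine h4 _ _ fun s' hs' => ?_
          gcongr
          exact ih hs'
      _ = _ := by push_cast; ring

end Machine

/-! ### The program -/

/-!
The arrays are indexed by triples, and unused indices are zero. Array `0` comes first and the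
colors are in its cells `(0, 0, v)`, so that they occupy the first `n` cells of memory. Arrays `1`
to `6` are described below; array `7` is the stack, whose height is in register `4`; arrays `8` and
`9` are used for drawing a color, for marks on the colors of the neighbors and for the list of the
remaining colors. The edge `vw` is in the lists of `v` and `w` whose number is the smaller of the
two levels. So the neighbors of `v` on its own level or above form a single list, and the time of a
move does not depend on the number of neighbors below.
-/

section Program
open Ex Cmd

/-- The literal zero as an index. -/
abbrev z : Ex := lit 0
/-- The color of a vertex, `0` if it has to be recolored. -/
abbrev colorE (v : Ex) : Ex := rd 0 z z v
/-- The level of a vertex. -/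
abbrev lvlE (v : Ex) : Ex := rd 1 z z v
/-- The degree scale of a level. -/
abbrev scaleE (l : Ex) : Ex := rd 2 z z l
/-- The least color of the palette of a level. -/
abbrev baseE (l : Ex) : Ex := rd 3 z z l
/-- The length of the `j`-th neighbor list of `v`. -/
abbrev cntE (v j : Ex) : Ex := rd 4 z v j
/-- The `i`-th entry of the `j`-th neighbor list of `v`. -/
abbrev nbE (v j i : Ex) : Ex := rd 5 v j i
/-- The position of `w` in the neighbor list of `v` that contains it. -/
abbrev posE (v w : Ex) : Ex := rd 6 z v w

/-- Append the vertex in register `b` to list `j` of the vertex in register `a`. -/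
def appendTo (a b j : ℕ) : Cmd :=
  .asg 11 (cntE (var a) (var j)) ;;
  .wr 5 (var a) (var j) (var 11) (var b) ;;
  .wr 6 z (var a) (var b) (var 11) ;;
  .wr 4 z (var a) (var j) (add (var 11) (lit 1))

/-- Remove the vertex in register `b` from list `j` of the vertex in register `a`: the last entry
takes its place. -/
def removeFrom (a b j : ℕ) : Cmd :=
  .asg 11 (sub (cntE (var a) (var j)) (lit 1)) ;;
  .asg 12 (posE (var a) (var b)) ;;
  .asg 13 (nbE (var a) (var j) (var 11)) ;;
  .wr 5 (var a) (var j) (var 12) (var 13) ;;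
  .wr 6 z (var a) (var 13) (var 12) ;;
  .wr 4 z (var a) (var j) (var 11)

/-- Put the edge between the vertices in registers `a` and `b` into list `j` of both. -/
def link (a b j : ℕ) : Cmd := appendTo a b j ;; appendTo b a j

/-- Remove the edge between the vertices in registers `a` and `b` from list `j` of both. -/
def unlink (a b j : ℕ) : Cmd := removeFrom a b j ;; removeFrom b a j

/-- Put the neighbors in the list `6` of the vertex in register `5` on the stack. -/
def pushNeighbors : Cmd :=
  .asg 8 (cntE (var 5) (var 6)) ;;
  .loop z (var 8)
    (.asg 8 (sub (var 8) (lit 1)) ;;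
      .wr 7 z z (var 4) (nbE (var 5) (var 6) (var 8)) ;;
      .asg 4 (add (var 4) (lit 1)))

/-- Put the edge to the vertex at position `20` of the stack into the list that is right for level
`7`. -/
def relink : Cmd :=
  .asg 8 (sub (var 8) (lit 1)) ;;
  .asg 20 (sub (var 20) (lit 1)) ;;
  .asg 9 (rd 7 z z (var 20)) ;;
  .ite (lvlE (var 9)) (var 7) (.asg 10 (lvlE (var 9))) (.asg 10 (var 7)) ;;
  unlink 5 9 6 ;;
  link 5 9 10

/-- Move the vertex in register `5` from its level, in register `6`, to the level in register `7`,
discard its color, and put the neighbors in the list of its old level on the stack. -/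
def move : Cmd :=
  .asg 20 (cntE (var 5) (var 6)) ;;
  pushNeighbors ;;
  .asg 8 (var 20) ;; .asg 20 (var 4) ;;
  .loop z (var 8) relink ;;
  .wr 1 z z (var 5) (var 7) ;;
  .wr 0 z z (var 5) z

/-- Unmark all colors of the palette of the level in register `6`. -/
def clearMarks : Cmd :=
  .asg 8 (var 14) ;;
  .loop (var 8) (var 15) (.wr 8 z z (var 8) z ;; .asg 8 (add (var 8) (lit 1)))

/-- Mark the colors of the neighbors of the vertex in register `5` in the list of its level. -/
def markColors : Cmd :=
  .asg 8 (cntE (var 5) (var 6)) ;;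
  .loop z (var 8) (.asg 8 (sub (var 8) (lit 1)) ;;
    .wr 8 z z (colorE (nbE (var 5) (var 6) (var 8))) (lit 1))

/-- List the unmarked colors of the palette. -/
def listFree : Cmd :=
  .asg 8 (var 14) ;; .asg 17 z ;;
  .loop (var 8) (var 15)
    (.ite (rd 8 z z (var 8)) (lit 1)
      (.wr 9 z z (var 17) (var 8) ;; .asg 17 (add (var 17) (lit 1))) .skip ;;
    .asg 8 (add (var 8) (lit 1)))

/-- List the colors of the palette of the level that no neighbor of the vertex in register `5`
has. -/
def prepareColors : Cmd :=
  .asg 14 (baseE (var 6)) ;;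
  .asg 15 (add (var 14) (mul (lit 16) (scaleE (var 6)))) ;;
  clearMarks ;; markColors ;; listFree

/-- Give the vertex in register `5` a random color of its palette that no neighbor has. -/
def recolor : Cmd :=
  prepareColors ;;
  .rnd 18 (sub (var 17) (lit 1)) ;;
  .wr 0 z z (var 5) (rd 9 z z (var 18))

/-- Decide what to do with the vertex on top of the stack: register `19` tells whether it has to
move, and register `7` to which level. -/
def inspect : Cmd :=
  .asg 5 (rd 7 z z (sub (var 4) (lit 1))) ;;
  .asg 6 (lvlE (var 5)) ;;
  .asg 19 z ;;
  .ite (mul (lit 12) (scaleE (var 6))) (cntE (var 5) (var 6))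
    (.asg 7 (add (var 6) (lit 1)) ;; .asg 19 (lit 1))
    (.ite z (var 6)
      (.asg 7 (sub (var 6) (lit 1)) ;;
        .ite (add (cntE (var 5) (var 6)) (cntE (var 5) (var 7)))
          (mul (lit 4) (scaleE (var 7))) (.asg 19 (lit 1)) .skip)
      .skip)

/-- Process the vertex on top of the stack. -/
def processTop : Cmd :=
  inspect ;;
  .ite z (var 19) move
    (.asg 4 (sub (var 4) (lit 1)) ;;
      .ite (colorE (var 5)) (lit 1) recolor .skip)

/-- Process the stack until it is empty. -/
def settleAll : Cmd := .loop z (var 4) processTop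

/-- Discard the color of the vertex in register `a` with probability `1 / d`, where `d` is the
degree scale of its level. -/
def coin (a : ℕ) : Cmd :=
  .rnd 11 (sub (scaleE (lvlE (var a))) (lit 1)) ;;
  .ite (var 11) (lit 1) (.wr 0 z z (var a) z) .skip

/-- Discard both colors if the endpoints of the new edge have the same color. -/
def resolveConflict : Cmd :=
  .ite (colorE (var 1)) (colorE (var 2)) .skip
    (.ite (colorE (var 2)) (colorE (var 1)) .skip
      (.wr 0 z z (var 1) z ;; .wr 0 z z (var 2) z))

/-- Put the list number of the edge of the update into register `10`. -/
def edgeLevel : Cmd :=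
  .asg 6 (lvlE (var 1)) ;;
  .asg 10 (lvlE (var 2)) ;;
  .ite (var 6) (var 10) (.asg 10 (var 6)) .skip

/-- Put the endpoints of the edge of the update on the empty stack. -/
def pushEnds : Cmd :=
  .wr 7 z z z (var 1) ;; .wr 7 z z (lit 1) (var 2) ;; .asg 4 (lit 2)

/-- Process an update. -/
def updateCmd : Cmd :=
  edgeLevel ;;
  .ite z (var 0)
    ((link 1 2 10 ;; resolveConflict) ;; coin 1 ;; coin 2)
    (unlink 1 2 10) ;;
  pushEnds ;;
  settleAll

/-- Initialization: register `6` receives `⌈log₂ n⌉`, register `3` the stride, the tables of the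
levels are filled, and all vertices get color `1`. -/
def initCmd : Cmd :=
  (.asg 5 (lit 1) ;;
    .loop (var 5) (var 0) (.asg 5 (add (var 5) (var 5)) ;; .asg 6 (add (var 6) (lit 1)))) ;;
  (.asg 3 (mul (var 5) (var 5)) ;; .asg 3 (mul (var 3) (var 3)) ;;
    .asg 3 (mul (var 3) (var 3)) ;; .asg 3 (mul (var 3) (var 3)) ;;
    .asg 7 (add (var 6) (lit 2)) ;;
    .asg 11 (mul (add (var 6) (lit 1)) (var 7)) ;;
    .asg 9 (lit 1) ;; .asg 10 (lit 1)) ;;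
  .loop (var 8) (var 11)
    (.wr 2 z z (var 8) (var 9) ;;
      .wr 3 z z (var 8) (var 10) ;;
      .asg 10 (add (var 10) (mul (lit 16) (var 9))) ;;
      .asg 8 (add (var 8) (lit 1)) ;;
      .asg 12 (add (var 12) (lit 1)) ;;
      .ite (var 12) (var 7) .skip (.asg 12 z ;; .asg 9 (add (var 9) (var 9)))) ;;
  .asg 8 z ;;
  .loop (var 8) (var 0) (.wr 0 z z (var 8) (lit 1) ;; .asg 8 (add (var 8) (lit 1)))

end Program

/-! ### The parameters -/

/-- `⌈log₂ n⌉` -/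
abbrev lg (n : ℕ) : ℕ := Nat.clog 2 n
/-- The least power of two that is at least `n`. -/
abbrev pw (n : ℕ) : ℕ := 2 ^ lg n
/-- The number of levels with the same degree scale. -/
abbrev grp (n : ℕ) : ℕ := lg n + 2
/-- The number of levels. -/
abbrev lvls (n : ℕ) : ℕ := (lg n + 1) * grp n
/-- The degree scale of a level. -/
def scale (n l : ℕ) : ℕ := 2 ^ (l / grp n)
/-- The least color of the palette of a level; a level of scale `d` has `16 * d` colors. -/
def base (n l : ℕ) : ℕ := 1 + 16 * ∑ j ∈ Finset.range l, scale n j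
/-- The stride of the arrays. -/
abbrev stride (n : ℕ) : ℕ := pw n ^ 16

lemma scale_pos (n l : ℕ) : 0 < scale n l := by unfold scale; positivity

lemma scale_mono (n : ℕ) : Monotone (scale n) := fun a b h =>
  Nat.pow_le_pow_right (by omega) (Nat.div_le_div_right h)

lemma scale_succ_le (n l : ℕ) : scale n (l + 1) ≤ 2 * scale n l := by
  unfold scale
  rw [← pow_succ']
  apply Nat.pow_le_pow_right (by omega)
  have hg : 0 < grp n := Nat.succ_pos _
  rw [← Nat.succ_eq_add_one, ← Nat.add_div_right l hg]
  exact Nat.div_le_div_right (Nat.add_le_add_left hg l)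

lemma base_succ (n l : ℕ) : base n (l + 1) = base n l + 16 * scale n l := by
  unfold base
  rw [Finset.sum_range_succ]
  ring

lemma base_mono (n : ℕ) : Monotone (base n) :=
  monotone_nat_of_le_succ fun l => by rw [base_succ]; omega

lemma base_pos (n l : ℕ) : 0 < base n l := by unfold base; omega

lemma le_pw (n : ℕ) : n ≤ pw n := Nat.le_pow_clog (by omega) n

lemma lg_lt_pw (n : ℕ) : lg n < pw n := Nat.lt_two_pow_self

lemma two_le_pw {n : ℕ} (hn : 2 ≤ n) : 2 ≤ pw n := hn.trans (le_pw n)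

lemma lvls_le {n : ℕ} (hn : 2 ≤ n) : lvls n ≤ 2 * pw n ^ 2 := by
  have h1 := lg_lt_pw n
  have h2 := two_le_pw hn
  calc lvls n ≤ pw n * (pw n + pw n) := Nat.mul_le_mul (by omega) (by unfold grp; omega)
    _ = _ := by ring

lemma scale_le {n l : ℕ} (hl : l < lvls n) : scale n l ≤ pw n := by
  apply Nat.pow_le_pow_right (by omega)
  have : l / grp n < lg n + 1 := Nat.div_lt_of_lt_mul (by rw [mul_comm]; exact hl)
  omega

lemma base_le {n l : ℕ} (hn : 2 ≤ n) (hl : l ≤ lvls n) : base n l ≤ 1 + 32 * pw n ^ 3 := by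
  unfold base
  have h1 : ∑ j ∈ Finset.range l, scale n j ≤ ∑ j ∈ Finset.range l, pw n :=
    Finset.sum_le_sum fun j hj => scale_le ((Finset.mem_range.1 hj).trans_le hl)
  rw [Finset.sum_const, Finset.card_range, smul_eq_mul] at h1
  have h2 : l * pw n ≤ 2 * pw n ^ 2 * pw n := Nat.mul_le_mul_right _ (hl.trans (lvls_le hn))
  nlinarith

lemma le_stride {n : ℕ} (hn : 2 ≤ n) (c k : ℕ) (hc : c + k ≤ 16) :
    2 ^ c * pw n ^ k ≤ stride n := by
  have h2 := two_le_pw hn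
  calc 2 ^ c * pw n ^ k ≤ pw n ^ c * pw n ^ k := by gcongr
    _ = pw n ^ (c + k) := by rw [pow_add]
    _ ≤ _ := Nat.pow_le_pow_right (by omega) hc

open Machine

/-! ### Neighbor lists -/

/-- The memory holds neighbor lists in which `w` occurs in list `j` of `v` if and only if
`β v w = some j`. -/
def Lists (n : ℕ) (β : ℕ → ℕ → Option ℕ) (m : ℕ → ℕ → ℕ → ℕ → ℕ) : Prop :=
  (∀ v < n, ∀ w < n, ∀ j, β v w = some j →
    m 6 0 v w < m 4 0 v j ∧ m 5 v j (m 6 0 v w) = w) ∧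
  ∀ v < n, ∀ j, ∀ i < m 4 0 v j,
    m 5 v j i < n ∧ β v (m 5 v j i) = some j ∧ m 6 0 v (m 5 v j i) = i

/-- The assignment `β` with the value at `(a, b)` replaced by `x`. -/
def assign (β : ℕ → ℕ → Option ℕ) (a b : ℕ) (x : Option ℕ) : ℕ → ℕ → Option ℕ :=
  fun v w => if v = a ∧ w = b then x else β v w

lemma Lists.card_eq {n : ℕ} {β : ℕ → ℕ → Option ℕ} {m : ℕ → ℕ → ℕ → ℕ → ℕ}
    (h : Lists n β m) {v : ℕ} (hv : v < n) (j : ℕ) :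
    m 4 0 v j = ((Finset.range n).filter fun w => β v w = some j).card := by
  rw [← Finset.card_range (m 4 0 v j)]
  refine Finset.card_nbij' (fun i => m 5 v j i) (fun w => m 6 0 v w) ?_ ?_ ?_ ?_
  · intro i hi
    have := h.2 v hv j i (by simpa using hi)
    simp [this.1, this.2.1]
  · intro w hw
    simp only [Finset.coe_filter, Finset.mem_range, Set.mem_ofPred_eq] at hw
    simpa using (h.1 v hv w hw.1 j hw.2).1
  · intro i hi
    exact (h.2 v hv j i (by simpa using hi)).2.2
  · intro w hw
    simp only [Finset.coe_filter, Finset.mem_range, Set.mem_ofPred_eq] at hw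
    exact (h.1 v hv w hw.1 j hw.2).2

lemma Lists.cnt_le {n : ℕ} {β : ℕ → ℕ → Option ℕ} {m : ℕ → ℕ → ℕ → ℕ → ℕ}
    (h : Lists n β m) {v : ℕ} (hv : v < n) (j : ℕ) : m 4 0 v j ≤ n := by
  rw [h.card_eq hv]
  exact (Finset.card_filter_le _ _).trans (by simp)

/-- Only the registers in `R` and the arrays in `A` have changed. -/
def Frame (R A : Finset ℕ) (s s' : St) : Prop :=
  (∀ i, i ∉ R → s'.r i = s.r i) ∧ ∀ k, k ∉ A → s'.m k = s.m k

lemma Frame.trans {R A R' A' : Finset ℕ} {s s' s'' : St} (h : Frame R A s s')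
    (h' : Frame R' A' s' s'') : Frame (R ∪ R') (A ∪ A') s s'' :=
  ⟨fun i hi => by rw [Finset.mem_union, not_or] at hi; rw [h'.1 i hi.2, h.1 i hi.1],
    fun i hi => by rw [Finset.mem_union, not_or] at hi; rw [h'.2 i hi.2, h.2 i hi.1]⟩

lemma append_lists {n : ℕ} {β : ℕ → ℕ → Option ℕ} {m m' : ℕ → ℕ → ℕ → ℕ → ℕ} (h : Lists n β m)
    {a b j : ℕ} (ha : a < n) (hb : b < n) (hβ : β a b = none)
    (h4 : m' 4 = fun x v i => if x = 0 ∧ v = a ∧ i = j then m 4 0 a j + 1 else m 4 x v i)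
    (h5 : m' 5 = fun v l i => if v = a ∧ l = j ∧ i = m 4 0 a j then b else m 5 v l i)
    (h6 : m' 6 = fun x v w => if x = 0 ∧ v = a ∧ w = b then m 4 0 a j else m 6 x v w) :
    Lists n (assign β a b (some j)) m' := by
  obtain ⟨h1, h2⟩ := h
  refine ⟨fun v hv w hw l hl => ?_, fun v hv l i hi => ?_⟩
  · simp only [h4, h5, h6, assign, true_and] at hl ⊢
    split_ifs at hl with hc
    · obtain ⟨rfl, rfl⟩ := hc
      obtain rfl := Option.some_injective _ hl
      simp
    · have := h1 v hv w hw l hl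
      rw [if_neg hc]
      constructor
      · split_ifs <;> grind
      · rw [if_neg (by rintro ⟨rfl, rfl, h⟩; omega)]
        exact this.2
  · simp only [h4, h5, h6, assign, true_and] at hi ⊢
    by_cases hc : v = a ∧ l = j
    · obtain ⟨rfl, rfl⟩ := hc
      by_cases hi' : i = m 4 0 v l
      · subst hi'; simp [hb]
      · simp only [and_self, if_true, true_and, hi', if_false] at hi ⊢
        have := h2 v hv l i (by omega)
        have hne : m 5 v l i ≠ b := by
          intro h; rw [h, hβ] at this; simp at this
        simp [hne, this]
    · rw [if_neg hc] at hi
      rw [if_neg (by tauto)]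
      have := h2 v hv l i hi
      have hne : ¬ (v = a ∧ m 5 v l i = b) := by
        rintro ⟨rfl, h⟩; rw [h, hβ] at this; simp at this
      simp [hne, this]

lemma remove_lists {n : ℕ} {β : ℕ → ℕ → Option ℕ} {m m' : ℕ → ℕ → ℕ → ℕ → ℕ} (h : Lists n β m)
    {a b j x : ℕ} (ha : a < n) (hb : b < n) (hβ : β a b = some j)
    (hx : x = m 5 a j (m 4 0 a j - 1))
    (h4 : m' 4 = fun y v i => if y = 0 ∧ v = a ∧ i = j then m 4 0 a j - 1 else m 4 y v i)
    (h5 : m' 5 = fun v l i => if v = a ∧ l = j ∧ i = m 6 0 a b then x else m 5 v l i)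
    (h6 : m' 6 = fun y v w => if y = 0 ∧ v = a ∧ w = x then m 6 0 a b else m 6 y v w) :
    Lists n (assign β a b none) m' := by
  obtain ⟨h1, h2⟩ := h
  obtain ⟨p1, p2⟩ := h1 a ha b hb j hβ
  obtain ⟨x1, x2, x3⟩ := h2 a ha j (m 4 0 a j - 1) (by omega)
  rw [← hx] at x1 x2 x3
  refine ⟨fun v hv w hw l hl => ?_, fun v hv l i hi => ?_⟩
  · simp only [h4, h5, h6, assign, true_and] at hl ⊢
    split_ifs at hl with hc
    have := h1 v hv w hw l hl
    by_cases hv' : v = a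
    · subst hv'
      have hwb : w ≠ b := fun h => hc ⟨rfl, h⟩
      by_cases hwx : w = x
      · subst hwx
        obtain rfl : j = l := by rw [x2] at hl; exact Option.some_injective _ hl
        have : m 6 0 v w ≠ m 6 0 v b := by
          intro h; apply hwb; rw [← p2, ← h, (h1 v hv w hw j hl).2]
        simp only [and_self, if_true, and_true]
        omega
      · by_cases hlj : l = j
        · subst hlj
          have e1 : m 6 0 v w ≠ m 6 0 v b := by
            intro h; apply hwb; rw [← p2, ← h, this.2]
          have e2 : m 6 0 v w ≠ m 4 0 v l - 1 := by
            intro h; apply hwx; rw [hx, ← h, this.2]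
          simp only [hwx, and_false, if_false, and_self, if_true, e1]
          exact ⟨by omega, this.2⟩
        · simp [hwx, hlj, this]
    · simp [hv', this]
  · simp only [h4, h5, h6, assign, true_and] at hi ⊢
    by_cases hv' : v = a
    · subst hv'
      by_cases hlj : l = j
      · subst hlj
        simp only [and_self, if_true, true_and] at hi ⊢
        by_cases hib : i = m 6 0 v b
        · subst hib
          have hxb : x ≠ b := by
            intro h; rw [h] at x3; omega
          simp [hxb, x1, x2]
        · have := h2 v hv l i (by omega)
          have e1 : m 5 v l i ≠ b := by
            intro h; rw [h] at this; omega
          have e2 : m 5 v l i ≠ x := by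
            intro h; rw [h] at this; omega
          simp [hib, e1, e2, this]
      · simp only [hlj, and_false, false_and, if_false, true_and] at hi ⊢
        have := h2 v hv l i hi
        have e1 : m 5 v l i ≠ b := by
          intro h; rw [h, hβ] at this; simp at this; omega
        have e2 : m 5 v l i ≠ x := by
          intro h; rw [h, x2] at this; simp at this; omega
        simp [e1, e2, this]
    · simp only [hv', false_and, if_false] at hi ⊢
      exact h2 v hv l i hi

/-- The expressions of the program involve only sizes below `M`, far from overflow. -/
structure Fits (K : Machine) (n : ℕ) : Prop where
  two_le : 2 ≤ n
  stride : K.M = stride n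

lemma Fits.le {K : Machine} {n : ℕ} (h : Fits K n) (c k : ℕ) (hc : c + k ≤ 16) :
    2 ^ c * pw n ^ k ≤ K.M := h.stride ▸ le_stride h.two_le c k hc

lemma Fits.pw_lt {K : Machine} {n : ℕ} (h : Fits K n) : 16 * pw n < K.M := by
  have := pow_one (pw n) ▸ h.le 5 1 (by omega)
  have := two_le_pw h.two_le
  omega

lemma Fits.lt {K : Machine} {n : ℕ} (h : Fits K n) : n < K.M := by
  have := h.pw_lt
  have := le_pw n
  omega

lemma Fits.base_lt {K : Machine} {n l : ℕ} (h : Fits K n) (hl : l ≤ lvls n) :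
    base n l < K.M := by
  have h1 := h.le 6 3 (by omega)
  have h2 := base_le h.two_le hl
  have h3 : 0 < pw n ^ 3 := by positivity
  omega

lemma Fits.lvls_lt {K : Machine} {n : ℕ} (h : Fits K n) : lvls n < K.M := by
  have h1 := h.le 2 2 (by omega)
  have h2 := lvls_le h.two_le
  have h3 : 0 < pw n ^ 2 := by positivity
  omega

lemma Fits.scale_lt {K : Machine} {n l : ℕ} (h : Fits K n) (hl : l < lvls n) :
    16 * scale n l < K.M := by
  have := scale_le hl
  have := h.pw_lt
  omega

lemma Fits.word {K : Machine} {n : ℕ} (h : Fits K n) : 16 * K.M ≤ K.W := by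
  unfold Machine.W
  have h1 := K.stride_le
  have h2 : 1 ≤ K.M := by have := h.lt; omega
  have h3 : K.M ≤ K.M ^ 3 := Nat.le_self_pow (by omega) _
  omega

lemma Fits.large {K : Machine} {n : ℕ} (h : Fits K n) : 32 < K.M := by
  have h1 := pow_one (pw n) ▸ h.le 5 1 (by omega)
  have := two_le_pw h.two_le
  omega

lemma tri_appendTo {K : Machine} {n a b j : ℕ} (hK : Fits K n) {s : St}
    {β : ℕ → ℕ → Option ℕ} (hM : s.r 3 = K.M) (h : Lists n β s.m) (ha : s.r a < n)
    (hb : s.r b < n) (hj : s.r j < K.M) (hr : a < 11 ∧ b < 11 ∧ j < 11)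
    (hβ : β (s.r a) (s.r b) = none) :
    K.Tri (appendTo a b j) s (appendTo a b j).len fun s' =>
      Frame {11, 12, 13} {4, 5, 6} s s' ∧
        Lists n (assign β (s.r a) (s.r b) (some (s.r j))) s'.m := by
  have hc := h.cnt_le ha (s.r j)
  have hn := hK.lt
  have hW := hK.word
  have hl := hK.large
  obtain ⟨r1, r2, r3⟩ := hr
  have e1 : a ≠ 11 := by omega
  have e2 : b ≠ 11 := by omega
  have e3 : j ≠ 11 := by omega
  unfold appendTo
  refine tri_asg_seq ?_ (tri_wr_seq ?_ ?_ (tri_wr_seq ?_ ?_ (tri_wr ?_ ?_ ?_)))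
  case _ => simp [Ex.Ok, Ex.eval, hM]; omega
  case _ => simp [Ex.Ok, Ex.eval, hM, e1, e3]; omega
  case _ => simp [Ex.Ok]; omega
  case _ => simp [Ex.Ok, Ex.eval, hM, e1, e2, e3]; omega
  case _ => simp [Ex.Ok]
  case _ => simp [Ex.Ok, Ex.eval, hM, e1, e2, e3]; omega
  case _ => simp [Ex.Ok, Ex.eval, e1, e2, e3]; omega
  simp only [Ex.eval, St.set_r, St.upd_r, e1, e2, e3, if_true, if_false]
  refine ⟨⟨fun i hi => ?_, fun k hk => ?_⟩, ?_⟩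
  · simp only [Finset.mem_insert, Finset.mem_singleton, not_or] at hi
    simp [hi]
  · simp only [Finset.mem_insert, Finset.mem_singleton, not_or] at hk
    funext x y w
    simp [hk]
  · refine append_lists h ha hb hβ ?_ ?_ ?_ <;> (funext x y w; simp)

lemma tri_removeFrom {K : Machine} {n a b j : ℕ} (hK : Fits K n) {s : St}
    {β : ℕ → ℕ → Option ℕ} (hM : s.r 3 = K.M) (h : Lists n β s.m) (ha : s.r a < n)
    (hb : s.r b < n) (hj : s.r j < K.M) (hr : a < 11 ∧ b < 11 ∧ j < 11)
    (hβ : β (s.r a) (s.r b) = some (s.r j)) :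
    K.Tri (removeFrom a b j) s (removeFrom a b j).len fun s' =>
      Frame {11, 12, 13} {4, 5, 6} s s' ∧ Lists n (assign β (s.r a) (s.r b) none) s'.m := by
  have hc := h.cnt_le ha (s.r j)
  have hn := hK.lt
  have hW := hK.word
  have hl := hK.large
  obtain ⟨p1, p2⟩ := h.1 _ ha _ hb _ hβ
  obtain ⟨x1, x2, x3⟩ := h.2 _ ha (s.r j) (s.m 4 0 (s.r a) (s.r j) - 1) (by omega)
  obtain ⟨r1, r2, r3⟩ := hr
  have e1 : a ≠ 11 ∧ a ≠ 12 ∧ a ≠ 13 := by omega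
  have e2 : b ≠ 11 ∧ b ≠ 12 ∧ b ≠ 13 := by omega
  have e3 : j ≠ 11 ∧ j ≠ 12 ∧ j ≠ 13 := by omega
  unfold removeFrom
  refine tri_asg_seq ?_ (tri_asg_seq ?_ (tri_asg_seq ?_ (tri_wr_seq ?_ ?_
    (tri_wr_seq ?_ ?_ (tri_wr ?_ ?_ ?_)))))
  case _ => simp [Ex.Ok, Ex.eval, hM]; omega
  case _ => simp [Ex.Ok, Ex.eval, hM, e1, e2]; omega
  case _ => simp [Ex.Ok, Ex.eval, hM, e1, e2, e3]; omega
  case _ => simp [Ex.Ok, Ex.eval, hM, e1, e2, e3]; omega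
  case _ => simp [Ex.Ok]
  case _ => simp [Ex.Ok, Ex.eval, hM, e1, e2, e3]; omega
  case _ => simp [Ex.Ok]
  case _ => simp [Ex.Ok, Ex.eval, hM, e1, e2, e3]; omega
  case _ => simp [Ex.Ok]
  simp only [Ex.eval, St.set_r, St.set_m, St.upd_r, e1, e2, e3, if_true, if_false]
  refine ⟨⟨fun i hi => ?_, fun k hk => ?_⟩, ?_⟩
  · simp only [Finset.mem_insert, Finset.mem_singleton, not_or] at hi
    simp [hi]
  · simp only [Finset.mem_insert, Finset.mem_singleton, not_or] at hk
    funext x y w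
    simp [hk]
  · refine remove_lists h ha hb hβ rfl ?_ ?_ ?_ <;> (funext x y w; simp)

lemma tri_link {K : Machine} {n a b j : ℕ} (hK : Fits K n) {s : St}
    {β : ℕ → ℕ → Option ℕ} (hM : s.r 3 = K.M) (h : Lists n β s.m) (ha : s.r a < n)
    (hb : s.r b < n) (hj : s.r j < K.M) (hr : a < 11 ∧ b < 11 ∧ j < 11) (hab : s.r a ≠ s.r b)
    (hβ : β (s.r a) (s.r b) = none) (hβ' : β (s.r b) (s.r a) = none) :
    K.Tri (link a b j) s (link a b j).len fun s' =>
      Frame {11, 12, 13} {4, 5, 6} s s' ∧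
        Lists n (assign (assign β (s.r a) (s.r b) (some (s.r j))) (s.r b) (s.r a)
          (some (s.r j))) s'.m := by
  refine Tri.seq_len (tri_appendTo hK hM h ha hb hj hr hβ) fun s' ⟨hf, hl⟩ => ?_
  have hreg : ∀ i < 11, s'.r i = s.r i := fun i hi => hf.1 i (by simp; omega)
  have := tri_appendTo (a := b) (b := a) (j := j) hK (s := s') (by rw [hreg 3 (by omega), hM]) hl
    (by rwa [hreg b hr.2.1]) (by rwa [hreg a hr.1]) (by rwa [hreg j hr.2.2]) (by omega)
    (by rw [hreg a hr.1, hreg b hr.2.1]; simp [assign, hab, hβ'])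
  refine this.mono le_rfl fun s'' ⟨hf', hl'⟩ => ⟨by simpa using hf.trans hf', ?_⟩
  rwa [hreg a hr.1, hreg b hr.2.1, hreg j hr.2.2] at hl'

lemma tri_unlink {K : Machine} {n a b j : ℕ} (hK : Fits K n) {s : St}
    {β : ℕ → ℕ → Option ℕ} (hM : s.r 3 = K.M) (h : Lists n β s.m) (ha : s.r a < n)
    (hb : s.r b < n) (hj : s.r j < K.M) (hr : a < 11 ∧ b < 11 ∧ j < 11) (hab : s.r a ≠ s.r b)
    (hβ : β (s.r a) (s.r b) = some (s.r j)) (hβ' : β (s.r b) (s.r a) = some (s.r j)) :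
    K.Tri (unlink a b j) s (unlink a b j).len fun s' =>
      Frame {11, 12, 13} {4, 5, 6} s s' ∧
        Lists n (assign (assign β (s.r a) (s.r b) none) (s.r b) (s.r a) none) s'.m := by
  refine Tri.seq_len (tri_removeFrom hK hM h ha hb hj hr hβ) fun s' ⟨hf, hl⟩ => ?_
  have hreg : ∀ i < 11, s'.r i = s.r i := fun i hi => hf.1 i (by simp; omega)
  have := tri_removeFrom (a := b) (b := a) (j := j) hK (s := s') (by rw [hreg 3 (by omega), hM]) hl
    (by rwa [hreg b hr.2.1]) (by rwa [hreg a hr.1]) (by rwa [hreg j hr.2.2]) (by omega)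
    (by rw [hreg a hr.1, hreg b hr.2.1, hreg j hr.2.2]; simp [assign, hab, hβ'])
  refine this.mono le_rfl fun s'' ⟨hf', hl'⟩ => ⟨by simpa using hf.trans hf', ?_⟩
  rwa [hreg a hr.1, hreg b hr.2.1] at hl'

/-! ### Moving a vertex to another level -/

/-- The level of a vertex, as stored in memory. -/
abbrev St.lvl (s : St) : ℕ → ℕ := s.m 1 0 0
/-- The color of a vertex, as stored in memory; `0` means that it has to be recolored. -/
abbrev St.col (s : St) : ℕ → ℕ := s.m 0 0 0
/-- The stack, as stored in memory. -/
abbrev St.stk (s : St) : ℕ → ℕ := s.m 7 0 0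

/-- `E` is the adjacency relation of a graph on the vertices below `n`. -/
structure IsGraph (n : ℕ) (E : ℕ → ℕ → Bool) : Prop where
  symm : ∀ u v, E u v = E v u
  irrefl : ∀ u, E u u = false
  lt : ∀ u v, E u v = true → u < n ∧ v < n

/-- The number of the neighbor list that contains an edge: the minimum of the levels of its
endpoints. -/
def bucket (E : ℕ → ℕ → Bool) (lvl : ℕ → ℕ) : ℕ → ℕ → Option ℕ :=
  fun v w => if E v w then some (min (lvl v) (lvl w)) else none

/-- `f` with the value at `x` replaced by `y`. -/
abbrev upd (f : ℕ → ℕ) (x y : ℕ) : ℕ → ℕ := fun v => if v = x then y else f v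

/-- The assignment of edges to lists while `x` moves to level `l'` and the edges to the vertices in
`P` have been treated. -/
def midBucket (E : ℕ → ℕ → Bool) (lvl : ℕ → ℕ) (x l' : ℕ) (P : Finset ℕ) : ℕ → ℕ → Option ℕ :=
  fun v w => if E v w then
    if v = x ∧ w ∈ P then some (min l' (lvl w))
    else if w = x ∧ v ∈ P then some (min l' (lvl v))
    else some (min (lvl v) (lvl w)) else none

lemma midBucket_empty (E : ℕ → ℕ → Bool) (lvl : ℕ → ℕ) (x l' : ℕ) :
    midBucket E lvl x l' ∅ = bucket E lvl := by
  funext v w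
  simp [midBucket, bucket]

lemma midBucket_insert {n : ℕ} {E : ℕ → ℕ → Bool} (hE : IsGraph n E) {lvl : ℕ → ℕ} {x w l' : ℕ}
    (hw : E x w = true) (P : Finset ℕ) :
    assign (assign (assign (assign (midBucket E lvl x l' P) x w none) w x none)
      x w (some (min l' (lvl w)))) w x (some (min l' (lvl w))) =
      midBucket E lvl x l' (insert w P) := by
  have hw' : E w x = true := hE.symm x w ▸ hw
  have hne : w ≠ x := by rintro rfl; simp [hE.irrefl] at hw
  funext a b
  simp only [assign, midBucket, Finset.mem_insert]
  by_cases h1 : a = x ∧ b = w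
  · obtain ⟨rfl, rfl⟩ := h1
    simp [hw, hne]
  · by_cases h2 : a = w ∧ b = x
    · obtain ⟨rfl, rfl⟩ := h2
      simp [hw', hne]
    · simp only [h1, h2, if_false]
      by_cases hE' : E a b = true
      · simp only [hE', if_true]
        grind
      · simp [hE']

lemma midBucket_full {E : ℕ → ℕ → Bool} {n : ℕ} (hE : IsGraph n E) {lvl : ℕ → ℕ} {x l' : ℕ}
    {P : Finset ℕ} (hl : lvl x ≤ l' + 1) (hP : ∀ w, w ∈ P ↔ E x w = true ∧ lvl x ≤ lvl w) :
    midBucket E lvl x l' P = bucket E (upd lvl x l') := by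
  funext a b
  simp only [midBucket, bucket, upd]
  by_cases hab : E a b = true
  · have hba : E b a = true := hE.symm a b ▸ hab
    have hne : a ≠ b := by rintro rfl; simp [hE.irrefl] at hab
    simp only [hab, if_true]
    by_cases ha : a = x
    · subst ha
      have hb : b ≠ a := hne.symm
      simp only [true_and, hP, hab, hb, if_true, if_false, false_and]
      split_ifs with h
      · rfl
      · congr 1; omega
    · by_cases hb : b = x
      · subst hb
        simp only [ha, true_and, hP, hba, if_true, if_false, false_and]
        split_ifs with h
        · rw [min_comm]
        · congr 1; omega
      · simp [ha, hb]
  · simp [hab]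

/-- The state of the data structure for the graph `E`: the tables are filled, the neighbor lists
belong to the levels, every color belongs to the palette of the level, and the coloring of the
vertices that have a color is proper. -/
structure Good (K : Machine) (n : ℕ) (E : ℕ → ℕ → Bool) (s : St) : Prop where
  r3 : s.r 3 = K.M
  scale : ∀ l < lvls n, s.m 2 0 0 l = scale n l
  base : ∀ l < lvls n, s.m 3 0 0 l = base n l
  lvl_le : ∀ v < n, s.lvl v ≤ lg n * grp n
  lists : Lists n (bucket E s.lvl) s.m
  palette : ∀ v < n, s.col v ≠ 0 → DynColoring.base n (s.lvl v) ≤ s.col v ∧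
    s.col v < DynColoring.base n (s.lvl v + 1)
  proper : ∀ u < n, ∀ v < n, E u v = true → s.col u ≠ 0 → s.col u ≠ s.col v

lemma top_lt (n : ℕ) : lg n * grp n + 1 < lvls n := by
  unfold lvls
  rw [add_mul]
  have : 2 ≤ grp n := Nat.le_add_left _ _
  omega

/-- The neighbors whose levels are at least `j`. -/
def upNbrs (n : ℕ) (E : ℕ → ℕ → Bool) (lvl : ℕ → ℕ) (v j : ℕ) : Finset ℕ :=
  (Finset.range n).filter fun w => E v w = true ∧ j ≤ lvl w

lemma tri_pushNeighbors {K : Machine} {n : ℕ} (hK : Fits K n) {s : St} {β : ℕ → ℕ → Option ℕ}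
    (hM : s.r 3 = K.M) (hL : Lists n β s.m) (h5 : s.r 5 < n) (h6 : s.r 6 < K.M)
    (h4 : s.r 4 + s.m 4 0 (s.r 5) (s.r 6) < K.M) :
    K.Tri pushNeighbors s (80 * s.m 4 0 (s.r 5) (s.r 6) + 80) fun s' =>
      Frame {4, 8} {7} s s' ∧ s'.r 4 = s.r 4 + s.m 4 0 (s.r 5) (s.r 6) ∧
      (∀ i < s.r 4, s'.stk i = s.stk i) ∧
      ∀ i < s.m 4 0 (s.r 5) (s.r 6),
        s'.stk (s.r 4 + i) = s.m 5 (s.r 5) (s.r 6) (s.m 4 0 (s.r 5) (s.r 6) - 1 - i) := by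
  set D := s.m 4 0 (s.r 5) (s.r 6) with hD
  have hDn : D ≤ n := hL.cnt_le h5 _
  have hn := hK.lt
  have hW := hK.word
  have hl := hK.large
  unfold pushNeighbors
  refine Tri.seq (P := fun s' => s' = s.set 8 D) (tri_asg ?_ rfl) ?_ (k₂ := 80 * D + 60) ?_
  · simp [Ex.Ok, Ex.eval, hM]; omega
  swap
  · simp [Cmd.len, Ex.len]; omega
  rintro _ rfl
  refine (tri_loop (i := D) (k := 60) (fun i s' => Frame {4, 8} {7} s s' ∧ i ≤ D ∧ s'.r 8 = i ∧
      s'.r 4 = s.r 4 + (D - i) ∧ (∀ t < s.r 4, s'.stk t = s.stk t) ∧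
      ∀ t < D - i, s'.stk (s.r 4 + t) = s.m 5 (s.r 5) (s.r 6) (D - 1 - t)) ?_ ?_ ?_ ?_).mono ?_ ?_
  · intro i s' _
    simp [Ex.Ok]; omega
  · intro s' ⟨_, _, h, _⟩
    simp [Ex.eval, h]
  · intro i s' ⟨hf, hi, h8, h4', hlow, hhigh⟩
    refine ⟨by simp [Ex.eval, h8], ?_⟩
    have g3 : s'.r 3 = K.M := by rw [hf.1 3 (by simp), hM]
    have g5 : s'.r 5 = s.r 5 := hf.1 5 (by simp)
    have g6 : s'.r 6 = s.r 6 := hf.1 6 (by simp)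
    have gm : s'.m 5 = s.m 5 := hf.2 5 (by simp)
    refine (tri_asg_seq ?_ (tri_wr_seq ?_ ?_ (tri_asg ?_ ?_))).mono (by simp [Cmd.len, Ex.len])
      fun _ h => h
    · simp [Ex.Ok, Ex.eval, h8]; omega
    · simp [Ex.Ok, Ex.eval, g3, h4']; omega
    · simp [Ex.Ok, Ex.eval, g3, g5, g6, h8]; omega
    · simp [Ex.Ok, Ex.eval, h4']; omega
    · refine ⟨⟨fun j hj => ?_, fun k hk => ?_⟩, by omega, ?_, ?_, fun t ht => ?_, fun t ht => ?_⟩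
      · simp only [Finset.mem_insert, Finset.mem_singleton, not_or] at hj
        simp [hj, hf.1 j (by simp [hj])]
      · simp only [Finset.mem_singleton] at hk
        funext x y w
        simp [hk, hf.2 k (by simp [hk])]
      · simp [Ex.eval, h8]
      · simp [Ex.eval, h4']; omega
      · have : t ≠ s'.r 4 := by omega
        simpa [Ex.eval, this, St.stk] using hlow t ht
      · simp only [Ex.eval, St.set_m, St.upd_m, St.set_r, h4', g5, g6, gm, h8, St.stk]
        simp only [show (4 : ℕ) ≠ 8 from by decide,
          show (5 : ℕ) ≠ 8 from by decide, show (6 : ℕ) ≠ 8 from by decide, if_true, if_false,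
          true_and]
        split_ifs with h
        · congr 1; omega
        · exact hhigh t (by omega)
  · refine ⟨⟨fun j hj => ?_, fun k hk => rfl⟩, le_rfl, by simp, by simp, fun t _ => rfl,
      fun t ht => by omega⟩
    simp only [Finset.mem_insert, Finset.mem_singleton, not_or] at hj
    simp [hj]
  · simp [Ex.len]; omega
  · rintro s' ⟨hf, _, _, h4', hlow, hhigh⟩
    exact ⟨hf, by simpa using h4', hlow, by simpa using hhigh⟩

lemma tri_relinkLoop {K : Machine} {n : ℕ} (hK : Fits K n) {s : St} {E : ℕ → ℕ → Bool}
    (hE : IsGraph n E) {D sp l l' x : ℕ} (hM : s.r 3 = K.M) (hx : s.r 5 = x) (hl : s.r 6 = l)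
    (hl' : s.r 7 = l') (h8 : s.r 8 = D) (h20 : s.r 20 = sp + D) (hsp : sp + D < K.M)
    (hlx : s.lvl x = l) (hlM : l < K.M) (hlM' : l' < K.M) (hL : Lists n (bucket E s.lvl) s.m)
    (hq : ∀ t < D, E x (s.stk (sp + t)) = true ∧ l ≤ s.lvl (s.stk (sp + t)))
    (hinj : ∀ t < D, ∀ t' < D, s.stk (sp + t) = s.stk (sp + t') → t = t') :
    K.Tri (.loop z (.var 8) relink) s (500 * D + 20) fun s' =>
      Frame {8, 9, 10, 11, 12, 13, 20} {4, 5, 6} s s' ∧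
        Lists n (midBucket E s.lvl x l'
          ((Finset.Ico 0 D).image fun t => s.stk (sp + t))) s'.m := by
  have hn := hK.lt
  have hW := hK.word
  have hlarge := hK.large
  refine (tri_loop (i := D) (k := 490) (fun i s' => Frame {8, 9, 10, 11, 12, 13, 20} {4, 5, 6} s s' ∧
      i ≤ D ∧ s'.r 8 = i ∧ s'.r 20 = sp + i ∧
      Lists n (midBucket E s.lvl x l'
          ((Finset.Ico i D).image fun t => s.stk (sp + t))) s'.m) ?_ ?_ ?_ ?_).mono ?_ ?_
  · intro i s' _
    simp [Ex.Ok]; omega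
  · intro s' ⟨_, _, h, _⟩
    simp [Ex.eval, h]
  · intro i s' ⟨hf, hi, h8, h20, hL'⟩
    refine ⟨by simp [Ex.eval, h8], ?_⟩
    have g3 : s'.r 3 = K.M := by rw [hf.1 3 (by simp), hM]
    have g5 : s'.r 5 = x := by rw [hf.1 5 (by simp), hx]
    have g6 : s'.r 6 = l := by rw [hf.1 6 (by simp), hl]
    have g7 : s'.r 7 = l' := by rw [hf.1 7 (by simp), hl']
    have m7 : s'.m 7 = s.m 7 := hf.2 7 (by simp)
    have m1 : s'.m 1 = s.m 1 := hf.2 1 (by simp)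
    set y := s.stk (sp + i) with hy
    obtain ⟨hxy, hly⟩ := hq i (by omega)
    rw [← hy] at hxy hly
    obtain ⟨hxn, hyn⟩ := hE.lt _ _ hxy
    have hyM : y < K.M := by omega
    have hW0 : 0 < K.W := by omega
    have hM0 : 0 < K.M := by omega
    have hyx : E y x = true := hE.symm x y ▸ hxy
    have hne : x ≠ y := by intro h; rw [← h, hE.irrefl] at hxy; simp at hxy
    have hnot : y ∉ (Finset.Ico (i + 1) D).image fun t => s.stk (sp + t) := by
      simp only [Finset.mem_image, Finset.mem_Ico, not_exists, not_and, and_imp]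
      intro t h1 h2 h3
      have := hinj t h2 i (by omega) h3
      omega
    have hset : insert y ((Finset.Ico (i + 1) D).image fun t => s.stk (sp + t)) =
        (Finset.Ico i D).image fun t => s.stk (sp + t) := by
      rw [← Finset.insert_Ico_add_one_left_eq_Ico (by omega : i < D), Finset.image_insert]
    have hb1 : midBucket E s.lvl x l' ((Finset.Ico (i + 1) D).image fun t => s.stk (sp + t)) x y
        = some l := by
      simp only [midBucket, hxy, if_true, hnot, hne.symm, and_false, false_and, if_false, hlx]
      congr 1; omega
    have hb2 : midBucket E s.lvl x l' ((Finset.Ico (i + 1) D).image fun t => s.stk (sp + t)) y x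
        = some l := by
      simp only [midBucket, hyx, if_true, hnot, hne.symm, and_false, false_and, if_false, hlx]
      congr 1; omega
    set s₁ := ((s'.set 8 i).set 20 (sp + i)).set 9 y with hs₁
    have hTri : K.Tri (.ite (lvlE (.var 9)) (.var 7) (.asg 10 (lvlE (.var 9)))
        (.asg 10 (.var 7)) ;; unlink 5 9 6 ;; link 5 9 10) s₁
        (.ite (lvlE (.var 9)) (.var 7) (.asg 10 (lvlE (.var 9)))
        (.asg 10 (.var 7)) ;; unlink 5 9 6 ;; link 5 9 10 : Cmd).len fun s'' =>
          Frame {8, 9, 10, 11, 12, 13, 20} {4, 5, 6} s s'' ∧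
          i ≤ D ∧ s''.r 8 = i ∧ s''.r 20 = sp + i ∧
          Lists n (midBucket E s.lvl x l'
          ((Finset.Ico i D).image fun t => s.stk (sp + t))) s''.m := by
      refine Tri.seq_len (P := fun s'' => s'' = s₁.set 10 (min l' (s.lvl y))) (tri_ite ?_ ?_ ?_ ?_) ?_
      · simp [Ex.Ok, Ex.eval, hs₁, g3, hyM, hW0, hM0]
      · simp [Ex.Ok]
      · intro hlt
        simp [Ex.eval, hs₁, g7, m1] at hlt
        refine tri_asg ?_ ?_
        · simp [Ex.Ok, Ex.eval, hs₁, g3, hyM, hW0, hM0]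
        · simp [Ex.eval, hs₁, m1, min_eq_right hlt.le]
      · intro hlt
        simp [Ex.eval, hs₁, g7, m1] at hlt
        refine tri_asg ?_ ?_
        · simp [Ex.Ok]
        · simp [Ex.eval, hs₁, g7, min_eq_left hlt]
      rintro _ rfl
      refine Tri.seq_len (tri_unlink hK (β := midBucket E s.lvl x l'
        ((Finset.Ico (i + 1) D).image fun t => s.stk (sp + t))) ?_ ?_ ?_ ?_ ?_ ?_ ?_ ?_ ?_) ?_
      · simp [hs₁, g3]
      · simpa [hs₁] using hL'
      · simpa [hs₁, g5] using hxn
      · simpa [hs₁] using hyn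
      · simpa [hs₁, g6] using hlM
      · simp
      · simpa [hs₁, g5] using hne
      · simpa [hs₁, g5, g6] using hb1
      · simpa [hs₁, g5, g6] using hb2
      rintro s₂ ⟨hf₂, hL₂⟩
      have e3 : s₂.r 3 = K.M := by rw [hf₂.1 3 (by simp)]; simp [hs₁, g3]
      have e5 : s₂.r 5 = x := by rw [hf₂.1 5 (by simp)]; simp [hs₁, g5]
      have e8 : s₂.r 8 = i := by rw [hf₂.1 8 (by simp)]; simp [hs₁]
      have e9 : s₂.r 9 = y := by rw [hf₂.1 9 (by simp)]; simp [hs₁]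
      have e10 : s₂.r 10 = min l' (s.lvl y) := by rw [hf₂.1 10 (by simp)]; simp [hs₁]
      have e20 : s₂.r 20 = sp + i := by rw [hf₂.1 20 (by simp)]; simp [hs₁]
      simp only [St.set_r, hs₁, g5] at hL₂
      simp only [show (5 : ℕ) ≠ 10 from by decide, show (9 : ℕ) ≠ 10 from by decide,
        show (5 : ℕ) ≠ 9 from by decide, show (5 : ℕ) ≠ 20 from by decide,
        show (5 : ℕ) ≠ 8 from by decide, if_true, if_false] at hL₂
      refine (tri_link hK e3 hL₂ (by rwa [e5]) (by rwa [e9]) ?_ (by simp) (by rwa [e5, e9])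
        ?_ ?_).mono le_rfl ?_
      · rw [e10]; omega
      · simp [e5, e9, assign]
      · simp [e5, e9, assign]
      rintro s₃ ⟨hf₃, hL₃⟩
      refine ⟨⟨fun j hj => ?_, fun k hk => ?_⟩, by omega, ?_, ?_, ?_⟩
      · simp only [Finset.mem_insert, Finset.mem_singleton, not_or] at hj
        rw [hf₃.1 j (by simp [hj]), hf₂.1 j (by simp [hj])]
        simp [hs₁, hj, hf.1 j (by simp [hj])]
      · rw [hf₃.2 k hk, hf₂.2 k hk]
        simp [hs₁, hf.2 k hk]
      · rw [hf₃.1 8 (by simp), e8]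
      · rw [hf₃.1 20 (by simp), e20]
      · rw [e5, e9, e10, midBucket_insert hE hxy, hset] at hL₃
        exact hL₃
    refine (tri_asg_seq ?_ (tri_asg_seq ?_ (tri_asg_seq ?_ ?_))).mono (by decide) fun _ h => h
    · simp [Ex.Ok, Ex.eval, h8]; omega
    · simp [Ex.Ok, Ex.eval, h20]; omega
    · simp [Ex.Ok, Ex.eval, g3, h20]; omega
    · convert hTri using 1
      simp [Ex.eval, h8, h20, hs₁, hy, m7]
  · exact ⟨⟨fun _ _ => rfl, fun _ _ => rfl⟩, le_rfl, h8, h20, by simpa [midBucket_empty] using hL⟩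
  · simp [Ex.len]; omega
  · rintro s' ⟨hf, _, _, _, h⟩
    exact ⟨hf, h⟩

lemma mem_upNbrs {n : ℕ} {E : ℕ → ℕ → Bool} (hE : IsGraph n E) {lvl : ℕ → ℕ} {v j w : ℕ} :
    w ∈ upNbrs n E lvl v j ↔ E v w = true ∧ j ≤ lvl w := by
  simp only [upNbrs, Finset.mem_filter, Finset.mem_range, and_iff_right_iff_imp]
  exact fun h => (hE.lt _ _ h.1).2

/-- The list of a vertex for its own level contains the neighbors that are not below it. -/
lemma Lists.cnt_self {n : ℕ} {E : ℕ → ℕ → Bool} {s : St} (h : Lists n (bucket E s.lvl) s.m) {v : ℕ}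
    (hv : v < n) : s.m 4 0 v (s.lvl v) = (upNbrs n E s.lvl v (s.lvl v)).card := by
  rw [h.card_eq hv]
  congr 1
  apply Finset.filter_congr
  intro w _
  simp only [bucket]
  by_cases hE : E v w = true <;> simp [hE]

lemma Lists.cnt_add {n : ℕ} {E : ℕ → ℕ → Bool} {s : St} (h : Lists n (bucket E s.lvl) s.m) {v : ℕ}
    (hv : v < n) {l : ℕ} (hl : s.lvl v = l + 1) :
    s.m 4 0 v (l + 1) + s.m 4 0 v l = (upNbrs n E s.lvl v l).card := by
  rw [← hl, h.cnt_self hv, h.card_eq hv, ← Finset.card_union_of_disjoint]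
  · congr 1
    ext w
    simp only [upNbrs, bucket, Finset.mem_union, Finset.mem_filter, Finset.mem_range]
    by_cases hE : E v w = true
    · simp [hE]; omega
    · simp [hE]
  · rw [Finset.disjoint_left]
    intro w hw hw'
    simp only [upNbrs, Finset.mem_filter, Finset.mem_range] at hw hw'
    have h2 := hw'.2
    rw [bucket, if_pos hw.2.1] at h2
    have := Option.some_injective _ h2
    omega

/-- The effect of `move` on the data structure. -/
structure Moved (K : Machine) (n : ℕ) (E : ℕ → ℕ → Bool) (x l' : ℕ) (s s' : St) : Prop where
  good : Good K n E s'
  lvl : s'.lvl = upd s.lvl x l'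
  col : s'.col = upd s.col x 0
  sp : s'.r 4 = s.r 4 + (upNbrs n E s.lvl x (s.lvl x)).card
  low : ∀ i < s.r 4, s'.stk i = s.stk i
  high : ∀ i < s'.r 4, s.r 4 ≤ i → s'.stk i < n
  pushed : ∀ w, E x w = true → s.lvl x ≤ s.lvl w → ∃ i < s'.r 4, s'.stk i = w

lemma tri_move {K : Machine} {n : ℕ} (hK : Fits K n) {s : St} {E : ℕ → ℕ → Bool}
    (hE : IsGraph n E) (hG : Good K n E s) {x l' : ℕ} (h5 : s.r 5 = x) (hx : x < n)
    (h6 : s.r 6 = s.lvl x) (h7 : s.r 7 = l') (hl : s.lvl x ≤ l' + 1) (hl' : l' ≤ lg n * grp n)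
    (h4 : s.r 4 + (upNbrs n E s.lvl x (s.lvl x)).card < K.M) :
    K.Tri move s (1000 * (upNbrs n E s.lvl x (s.lvl x)).card + 1000) (Moved K n E x l' s) := by
  rw [← hG.lists.cnt_self hx] at h4 ⊢
  have hDcard := hG.lists.cnt_self hx
  set l := s.lvl x with hlx
  set D := s.m 4 0 x l with hD
  set sp := s.r 4 with hspd
  have hDn : D ≤ n := hG.lists.cnt_le hx _
  have hn := hK.lt
  have hW := hK.word
  have hlarge := hK.large
  have hT := top_lt n
  have hTM := hK.lvls_lt
  have hlM : l < K.M := by have := hG.lvl_le x hx; omega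
  unfold move
  -- the list is copied to the stack
  refine Tri.seq (P := fun s' => s' = s.set 20 D) (k₂ := 600 * D + 900) (tri_asg ?_ ?_) ?_ ?_
  · simp [Ex.Ok, Ex.eval, hG.r3, h5, h6]; omega
  · simp [Ex.eval, h5, h6, hD, hlx]
  swap
  · simp [Cmd.len, Ex.len]; omega
  rintro _ rfl
  have hpush := tri_pushNeighbors hK (s := s.set 20 D) (by simpa using hG.r3) hG.lists
    (by simpa [h5] using hx) (by simp only [St.set_r]; simpa [h6] using hlM)
    (by simpa [h5, h6] using h4)
  simp only [St.set_r, St.set_m, show (5 : ℕ) ≠ 20 from by decide, show (6 : ℕ) ≠ 20 from by decide,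
    show (4 : ℕ) ≠ 20 from by decide, if_false, h5, h6, ← hD, ← hspd] at hpush
  refine Tri.seq (k₂ := 500 * D + 800) hpush ?_ (by omega)
  rintro s₁ ⟨hf₁, r4₁, low₁, high₁⟩
  have e3 : s₁.r 3 = K.M := by rw [hf₁.1 3 (by simp)]; simp [hG.r3]
  have e5 : s₁.r 5 = x := by rw [hf₁.1 5 (by simp)]; simp [h5]
  have e6 : s₁.r 6 = l := by rw [hf₁.1 6 (by simp)]; simp [h6]
  have e7 : s₁.r 7 = l' := by rw [hf₁.1 7 (by simp)]; simp [h7]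
  have e20 : s₁.r 20 = D := by rw [hf₁.1 20 (by simp)]; simp
  have m1 : s₁.m 1 = s.m 1 := hf₁.2 1 (by simp)
  -- the entries are the neighbors in the list
  have hent : ∀ t < D, s₁.stk (sp + t) < n ∧ E x (s₁.stk (sp + t)) = true ∧
      l ≤ s.lvl (s₁.stk (sp + t)) := by
    intro t ht
    rw [high₁ t ht]
    obtain ⟨a1, a2, _⟩ := hG.lists.2 x hx l (D - 1 - t) (by omega)
    refine ⟨a1, ?_⟩
    simp only [bucket] at a2
    split_ifs at a2 with h
    · exact ⟨h, by have := Option.some_injective _ a2; omega⟩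
  have hinj : ∀ t < D, ∀ t' < D, s₁.stk (sp + t) = s₁.stk (sp + t') → t = t' := by
    intro t ht t' ht' h
    rw [high₁ t ht, high₁ t' ht'] at h
    have a := (hG.lists.2 x hx l (D - 1 - t) (by omega)).2.2
    have b := (hG.lists.2 x hx l (D - 1 - t') (by omega)).2.2
    rw [h, b] at a
    omega
  have hsurj : ∀ w, E x w = true → l ≤ s.lvl w → ∃ t < D, s₁.stk (sp + t) = w := by
    intro w hw hlw
    obtain ⟨a1, a2⟩ := hG.lists.1 x hx w (hE.lt _ _ hw).2 l
      (by simp only [bucket, hw, if_true]; congr 1; omega)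
    refine ⟨D - 1 - s.m 6 0 x w, by omega, ?_⟩
    rw [high₁ _ (by omega)]
    refine Eq.trans ?_ a2
    congr 1
    omega
  refine Tri.seq (P := fun s' => s' = s₁.set 8 D) (k₂ := 500 * D + 700) (tri_asg ?_ ?_) ?_ ?_
  · simp [Ex.Ok]
  · simp [Ex.eval, e20]
  swap
  · simp [Cmd.len, Ex.len]; omega
  rintro _ rfl
  refine Tri.seq (P := fun s' => s' = (s₁.set 8 D).set 20 (sp + D)) (k₂ := 500 * D + 600)
    (tri_asg ?_ ?_) ?_ ?_
  · simp [Ex.Ok]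
  · simp [Ex.eval, r4₁]
  swap
  · simp [Cmd.len, Ex.len]; omega
  rintro _ rfl
  set s₂ := (s₁.set 8 D).set 20 (sp + D) with hs₂
  have hlist₁ : Lists n (bucket E s₂.lvl) s₂.m := by
    have : ∀ k, k ≠ 7 → s₁.m k = s.m k := fun k hk => by
      rw [hf₁.2 k (by simpa using hk)]; rfl
    simpa [Lists, hs₂, this, m1, St.lvl] using hG.lists
  have hloop := tri_relinkLoop hK (s := s₂) hE (D := D) (sp := sp) (l := l) (l' := l') (x := x)
    (by simp [hs₂, e3]) (by simp [hs₂, e5]) (by simp [hs₂, e6]) (by simp [hs₂, e7])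
    (by simp [hs₂]) (by simp [hs₂]) h4 (by simp [hs₂, St.lvl, m1, hlx]) hlM (by omega)
    hlist₁ (fun t ht => by simpa [hs₂, St.lvl, St.stk, m1] using (hent t ht).2)
    (fun t ht t' ht' => by simpa [hs₂, St.stk] using hinj t ht t' ht')
  refine Tri.seq (k₂ := 500) hloop ?_ (by omega)
  rintro s₃ ⟨hf₃, hL₃⟩
  have hlvl₂ : s₂.lvl = s.lvl := by simp [hs₂, St.lvl, m1]
  have g3 : s₃.r 3 = K.M := by rw [hf₃.1 3 (by simp)]; simp [hs₂, e3]
  have g4 : s₃.r 4 = sp + D := by rw [hf₃.1 4 (by simp)]; simp [hs₂, r4₁]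
  have g5 : s₃.r 5 = x := by rw [hf₃.1 5 (by simp)]; simp [hs₂, e5]
  have g7 : s₃.r 7 = l' := by rw [hf₃.1 7 (by simp)]; simp [hs₂, e7]
  have mem₃ : ∀ k, k ∉ ({4, 5, 6, 7} : Finset ℕ) → s₃.m k = s.m k := by
    intro k hk
    simp only [Finset.mem_insert, Finset.mem_singleton, not_or] at hk
    rw [hf₃.2 k (by simp [hk])]
    simp only [hs₂, St.set_m]
    rw [hf₁.2 k (by simp [hk])]
    rfl
  have stk₃ : s₃.stk = s₁.stk := by
    have := hf₃.2 7 (by simp)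
    simp [St.stk, this, hs₂]
  rw [hlvl₂, midBucket_full hE (by omega)] at hL₃
  swap
  · intro w
    simp only [Finset.mem_image, Finset.mem_Ico, zero_le, true_and, hs₂]
    constructor
    · rintro ⟨t, ht, rfl⟩
      exact (hent t ht).2
    · rintro ⟨h1, h2⟩
      exact hsurj w h1 h2
  refine (tri_wr_seq ?_ ?_ (tri_wr ?_ ?_ ?_)).mono (by decide) fun _ h => h
  case _ => simp [Ex.Ok, Ex.eval, g3, g5]; omega
  case _ => simp [Ex.Ok]
  case _ => simp [Ex.Ok, Ex.eval, g3, g5]; omega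
  case _ => simp [Ex.Ok]; omega
  simp only [Ex.eval, St.upd_r, g5, g7]
  set s₄ := (s₃.upd 1 0 0 x l').upd 0 0 0 x 0 with hs₄
  have mem₄ : ∀ k, k ∉ ({0, 1, 4, 5, 6, 7} : Finset ℕ) → s₄.m k = s.m k := by
    intro k hk
    simp only [Finset.mem_insert, Finset.mem_singleton, not_or] at hk
    funext a b c
    simp [hs₄, hk, mem₃ k (by simp [hk])]
  have lvl₄ : s₄.lvl = upd s.lvl x l' := by
    funext v
    simp [hs₄, St.lvl, mem₃ 1 (by simp)]
  have col₄ : s₄.col = upd s.col x 0 := by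
    funext v
    simp [hs₄, St.col, mem₃ 0 (by simp)]
  have r4₄ : s₄.r 4 = sp + D := by simp [hs₄, g4]
  have stk₄ : s₄.stk = s₁.stk := by
    rw [← stk₃]; funext i; simp [hs₄, St.stk]
  refine ⟨⟨?_, fun j hj => ?_, fun j hj => ?_, fun v hv => ?_, ?_, fun v hv hc => ?_,
    fun u hu v hv huv hc => ?_⟩, lvl₄, col₄, ?_, fun i hi => ?_, fun i hi hi' => ?_,
    fun w hw hlw => ?_⟩
  · simp [hs₄, g3]
  · rw [mem₄ 2 (by simp)]; exact hG.scale j hj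
  · rw [mem₄ 3 (by simp)]; exact hG.base j hj
  · rw [lvl₄]; simp only [upd]; split_ifs
    · exact hl'
    · exact hG.lvl_le v hv
  · rw [lvl₄]
    simpa [Lists, hs₄] using hL₃
  · rw [col₄] at hc ⊢
    rw [lvl₄]
    simp only [upd] at hc ⊢
    split_ifs at hc ⊢
    · exact absurd rfl hc
    · exact hG.palette v hv hc
  · rw [col₄] at hc ⊢
    simp only [upd] at hc ⊢
    split_ifs at hc ⊢
    · exact absurd rfl hc
    · exact absurd rfl hc
    · exact hc
    · exact hG.proper u hu v hv huv hc
  · rw [r4₄, ← hDcard]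
  · rw [stk₄]; exact low₁ i hi
  · rw [r4₄] at hi
    rw [stk₄]
    have := (hent (i - sp) (by omega)).1
    rwa [Nat.add_sub_cancel' hi'] at this
  · obtain ⟨t, ht, h⟩ := hsurj w hw hlw
    exact ⟨sp + t, by rw [r4₄]; omega, by rw [stk₄, h]⟩

/-! ### Inspecting and recoloring a vertex -/

/-- The degree conditions on a vertex: not too many neighbors on its level or above, and
sufficiently many neighbors on the level below or above. -/
def Settled (n : ℕ) (E : ℕ → ℕ → Bool) (lvl : ℕ → ℕ) (v : ℕ) : Prop :=
  (upNbrs n E lvl v (lvl v)).card ≤ 12 * scale n (lvl v) ∧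
    (0 < lvl v → 4 * scale n (lvl v - 1) ≤ (upNbrs n E lvl v (lvl v - 1)).card)

/-- The result of `inspect`. -/
structure Inspected (n : ℕ) (E : ℕ → ℕ → Bool) (x : ℕ) (s s' : St) : Prop where
  frame : Frame {5, 6, 7, 19} ∅ s s'
  r5 : s'.r 5 = x
  r6 : s'.r 6 = s.lvl x
  cases : (s'.r 19 = 1 ∧ s'.r 7 = s.lvl x + 1 ∧
      12 * scale n (s.lvl x) < (upNbrs n E s.lvl x (s.lvl x)).card) ∨
    (s'.r 19 = 1 ∧ s'.r 7 + 1 = s.lvl x ∧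
      (upNbrs n E s.lvl x (s'.r 7)).card < 4 * scale n (s'.r 7)) ∨
    (s'.r 19 = 0 ∧ Settled n E s.lvl x)

lemma tri_inspect {K : Machine} {n : ℕ} (hK : Fits K n) {s : St} {E : ℕ → ℕ → Bool}
    (hG : Good K n E s) {x : ℕ} (h4 : 0 < s.r 4) (h4' : s.r 4 < K.M)
    (hx : s.stk (s.r 4 - 1) = x) (hxn : x < n) :
    K.Tri inspect s inspect.len (Inspected n E x s) := by
  have hn := hK.lt
  have hW := hK.word
  have hlarge := hK.large
  have hT := top_lt n
  have hTM := hK.lvls_lt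
  have hl := hG.lvl_le x hxn
  have hsc := hG.scale _ (by omega : s.lvl x < lvls n)
  have hslt := hK.scale_lt (l := s.lvl x) (by omega)
  have hcnt := hG.lists.cnt_self hxn
  have hcn := hG.lists.cnt_le hxn (s.lvl x)
  have hcn' := hG.lists.cnt_le hxn (s.lvl x - 1)
  have hM := hG.r3
  have hW0 : 0 < K.W := by omega
  have hM0 : 0 < K.M := by omega
  have hxM : x < K.M := by omega
  have hlM : s.lvl x < K.M := by omega
  have hlM' : s.lvl x - 1 < K.M := by omega
  generalize hlx : s.lvl x = l at *
  simp only [St.stk, St.lvl] at hx hlx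
  set s₁ := ((s.set 5 x).set 6 l).set 19 0 with hs₁
  have hframe : Frame {5, 6, 7, 19} ∅ s s₁ := ⟨fun j hj => by
    simp only [Finset.mem_insert, Finset.mem_singleton, not_or] at hj
    simp [hs₁, hj], fun k _ => rfl⟩
  unfold inspect
  refine tri_asg_seq ?_ (tri_asg_seq ?_ (tri_asg_seq ?_ ?_))
  · simp [Ex.Ok, Ex.eval, hM]; omega
  · simp [Ex.Ok, Ex.eval, hM, hx]; omega
  · simp [Ex.Ok]; omega
  have hs : ((s.set 5 (Ex.eval s (.rd 7 z z (.sub (.var 4) (.lit 1))))).set 6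
      (Ex.eval (s.set 5 (Ex.eval s (.rd 7 z z (.sub (.var 4) (.lit 1))))) (lvlE (.var 5)))).set 19
      (Ex.eval ((s.set 5 (Ex.eval s (.rd 7 z z (.sub (.var 4) (.lit 1))))).set 6
      (Ex.eval (s.set 5 (Ex.eval s (.rd 7 z z (.sub (.var 4) (.lit 1))))) (lvlE (.var 5)))) z) =
      s₁ := by
    simp [Ex.eval, hx, hlx, hs₁]
  rw [hs]
  refine tri_ite ?_ ?_ (fun hlt => ?_) (fun hge => ?_)
  · simp [Ex.Ok, Ex.eval, hs₁, hM, hsc]; omega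
  · simp [Ex.Ok, Ex.eval, hs₁, hM]; omega
  · simp [Ex.eval, hs₁, hsc] at hlt
    refine tri_asg_seq ?_ (tri_asg ?_ ?_)
    · simp [Ex.Ok, Ex.eval, hs₁]; omega
    · simp [Ex.Ok]; omega
    · refine ⟨⟨fun j hj => ?_, fun k _ => rfl⟩, ?_, ?_, Or.inl ⟨?_, ?_, ?_⟩⟩
      · rw [← hframe.1 j hj]
        simp only [Finset.mem_insert, Finset.mem_singleton, not_or] at hj
        simp [hj]
      · simp [Ex.eval, hs₁]
      · simp [Ex.eval, hs₁, hlx]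
      · simp [Ex.eval]
      · simp [Ex.eval, hs₁, hlx]
      · rw [show s.lvl x = l from hlx]; omega
  · simp [Ex.eval, hs₁, hsc] at hge
    have h12 : (upNbrs n E s.lvl x (s.lvl x)).card ≤ 12 * scale n (s.lvl x) := by
      rw [show s.lvl x = l from hlx]; omega
    refine tri_ite ?_ ?_ (fun hlt => ?_) (fun hge' => ?_)
    · simp [Ex.Ok]; omega
    · simp [Ex.Ok]
    · simp [Ex.eval, hs₁] at hlt
      have hsc' := hG.scale (l - 1) (by omega)
      have hslt' := hK.scale_lt (l := l - 1) (by omega)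
      have hadd := hG.lists.cnt_add hxn (l := l - 1) (by change s.m 1 0 0 x = _; omega)
      rw [Nat.sub_add_cancel hlt] at hadd
      refine tri_asg_seq ?_ (tri_ite ?_ ?_ (fun h => ?_) (fun h => ?_))
      · simp [Ex.Ok, Ex.eval, hs₁]; omega
      · simp [Ex.Ok, Ex.eval, hs₁, hM]; omega
      · simp [Ex.Ok, Ex.eval, hs₁, hM, hsc']; omega
      · simp [Ex.eval, hs₁, hsc'] at h
        refine tri_asg ?_ ?_
        · simp [Ex.Ok]; omega
        · refine ⟨⟨fun j hj => ?_, fun k _ => rfl⟩, ?_, ?_, Or.inr (Or.inl ⟨?_, ?_, ?_⟩)⟩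
          · rw [← hframe.1 j hj]
            simp only [Finset.mem_insert, Finset.mem_singleton, not_or] at hj
            simp [hj]
          · simp [Ex.eval, hs₁]
          · simp [Ex.eval, hs₁, hlx]
          · simp [Ex.eval]
          · simp [Ex.eval, hs₁, hlx]; omega
          · simp [Ex.eval, hs₁]; omega
      · simp [Ex.eval, hs₁, hsc'] at h
        refine tri_skip ?_
        refine ⟨⟨fun j hj => ?_, fun k _ => rfl⟩, ?_, ?_, Or.inr (Or.inr ⟨?_, h12, fun _ => ?_⟩)⟩
        · rw [← hframe.1 j hj]
          simp only [Finset.mem_insert, Finset.mem_singleton, not_or] at hj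
          simp [hj]
        · simp [Ex.eval, hs₁]
        · simp [Ex.eval, hs₁, hlx]
        · simp [Ex.eval, hs₁]
        · rw [show s.lvl x = l from hlx]; omega
    · simp [Ex.eval, hs₁] at hge'
      refine tri_skip ⟨hframe, ?_, ?_, Or.inr (Or.inr ⟨?_, h12, fun h => ?_⟩)⟩
      · simp [hs₁]
      · simp [hs₁, hlx]
      · simp [hs₁]
      · rw [show s.lvl x = l from hlx] at h; omega

/-- The colors of the palette of the level of `x` that no neighbor in the list of the level has. -/
def freeColors (n : ℕ) (E : ℕ → ℕ → Bool) (s : St) (x : ℕ) : Finset ℕ :=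
  (Finset.Ico (base n (s.lvl x)) (base n (s.lvl x + 1))).filter fun c =>
    ∀ w ∈ upNbrs n E s.lvl x (s.lvl x), s.col w ≠ c

lemma card_freeColors {n : ℕ} {E : ℕ → ℕ → Bool} {s : St} {x : ℕ}
    (h : (upNbrs n E s.lvl x (s.lvl x)).card ≤ 12 * scale n (s.lvl x)) :
    4 * scale n (s.lvl x) ≤ (freeColors n E s x).card := by
  have h1 : freeColors n E s x = (Finset.Ico (base n (s.lvl x)) (base n (s.lvl x + 1))) \
      (upNbrs n E s.lvl x (s.lvl x)).image s.col := by
    ext c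
    simp only [freeColors, Finset.mem_filter, Finset.mem_sdiff, Finset.mem_image, not_exists,
      not_and]
  have h2 := Finset.le_card_sdiff ((upNbrs n E s.lvl x (s.lvl x)).image s.col)
    (Finset.Ico (base n (s.lvl x)) (base n (s.lvl x + 1)))
  rw [← h1, Nat.card_Ico, base_succ] at h2
  have h3 := Finset.card_image_le (s := upNbrs n E s.lvl x (s.lvl x)) (f := s.col)
  omega

lemma tri_clearMarks {K : Machine} {n : ℕ} (hK : Fits K n) {s : St} {lo k : ℕ}
    (hM : s.r 3 = K.M) (h14 : s.r 14 = lo) (h15 : s.r 15 = lo + k) (hlt : lo + k < K.M) :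
    K.Tri clearMarks s (60 * k + 60) fun s' => Frame {8} {8} s s' ∧
      ∀ y, lo ≤ y → y < lo + k → s'.m 8 0 0 y = 0 := by
  have hW := hK.word
  have hlarge := hK.large
  unfold clearMarks
  refine Tri.seq (P := fun s' => s' = s.set 8 lo) (k₂ := 60 * k + 50) (tri_asg ?_ ?_) ?_ ?_
  · simp [Ex.Ok]
  · simp [Ex.eval, h14]
  swap
  · simp [Cmd.len, Ex.len]; omega
  rintro _ rfl
  refine (tri_loop (i := k) (k := 45) (fun i s' => Frame {8} {8} s s' ∧ i ≤ k ∧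
    s'.r 8 = lo + (k - i) ∧ ∀ y, lo ≤ y → y < lo + (k - i) → s'.m 8 0 0 y = 0) ?_ ?_ ?_ ?_).mono
      ?_ ?_
  · intro i s' _
    simp [Ex.Ok]
  · intro s' ⟨hf, _, h, _⟩
    simp [Ex.eval, h, hf.1 15 (by simp), h15]
  · intro i s' ⟨hf, hi, h8, hm⟩
    have g3 : s'.r 3 = K.M := by rw [hf.1 3 (by simp), hM]
    refine ⟨by simp [Ex.eval, h8, hf.1 15 (by simp), h15]; omega, ?_⟩
    refine (tri_wr_seq ?_ ?_ (tri_asg ?_ ?_)).mono (by decide) fun _ h => h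
    · simp [Ex.Ok, Ex.eval, h8, g3]; omega
    · simp [Ex.Ok]; omega
    · simp [Ex.Ok, Ex.eval, h8]; omega
    · refine ⟨⟨fun j hj => ?_, fun k hk => ?_⟩, by omega, ?_, fun y h1 h2 => ?_⟩
      · simp only [Finset.mem_singleton] at hj
        simp [hj, hf.1 j (by simp [hj])]
      · simp only [Finset.mem_singleton] at hk
        funext x y w
        simp [hk, hf.2 k (by simp [hk])]
      · simp [Ex.eval, h8]; omega
      · simp only [Ex.eval, St.set_m, St.upd_m, h8, true_and]
        split_ifs with h
        · rfl
        · exact hm y h1 (by omega)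
  · refine ⟨⟨fun j hj => ?_, fun k hk => rfl⟩, le_rfl, by simp, fun y h1 h2 => by omega⟩
    simp only [Finset.mem_singleton] at hj
    simp [hj]
  · simp [Ex.len]; omega
  · rintro s' ⟨hf, _, _, h⟩
    exact ⟨hf, by simpa using h⟩

lemma tri_markColors {K : Machine} {n : ℕ} (hK : Fits K n) {s : St} {E : ℕ → ℕ → Bool}
    (hE : IsGraph n E) (hM : s.r 3 = K.M) (hL : Lists n (bucket E s.lvl) s.m) {x l lo hi : ℕ}
    (hx : x < n) (h5 : s.r 5 = x) (h6 : s.r 6 = l) (hl : s.lvl x = l) (hlM : l < K.M)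
    (hcol : ∀ v < n, s.col v < K.M) (h0 : ∀ y, lo ≤ y → y < hi → s.m 8 0 0 y = 0) :
    K.Tri markColors s (100 * (upNbrs n E s.lvl x l).card + 60) fun s' => Frame {8} {8} s s' ∧
      ∀ y, lo ≤ y → y < hi → (s'.m 8 0 0 y = 0 ↔ ∀ w ∈ upNbrs n E s.lvl x l, s.col w ≠ y) := by
  have hW := hK.word
  have hlarge := hK.large
  have hn := hK.lt
  have hD := hL.cnt_self hx
  rw [hl] at hD
  rw [← hD]
  set D := s.m 4 0 x l with hDdef
  have hDn : D ≤ n := hL.cnt_le hx l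
  have hent := hL.2 x hx l
  have hiff : ∀ y, (∀ w ∈ upNbrs n E s.lvl x l, s.col w ≠ y) ↔ ∀ t < D, s.col (s.m 5 x l t) ≠ y := by
    intro y
    constructor
    · intro h t ht
      obtain ⟨a1, a2, _⟩ := hent t ht
      apply h
      rw [mem_upNbrs hE]
      rw [bucket] at a2
      split_ifs at a2 with hh
      exact ⟨hh, by have := Option.some_injective _ a2; omega⟩
    · intro h w hw
      rw [mem_upNbrs hE] at hw
      obtain ⟨a1, a2⟩ := hL.1 x hx w (hE.lt _ _ hw.1).2 l
        (by rw [bucket, if_pos hw.1]; congr 1; omega)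
      rw [← a2]
      exact h _ a1
  unfold markColors
  refine Tri.seq (P := fun s' => s' = s.set 8 D) (k₂ := 100 * D + 40) (tri_asg ?_ ?_) ?_ ?_
  · simp [Ex.Ok, Ex.eval, hM, h5, h6]; omega
  · simp [Ex.eval, h5, h6, hDdef]
  swap
  · simp [Cmd.len, Ex.len]; omega
  rintro _ rfl
  refine (tri_loop (i := D) (k := 90) (fun i s' => Frame {8} {8} s s' ∧ i ≤ D ∧
    s'.r 8 = i ∧ ∀ y, lo ≤ y → y < hi → (s'.m 8 0 0 y = 0 ↔
      ∀ t, i ≤ t → t < D → s.col (s.m 5 x l t) ≠ y)) ?_ ?_ ?_ ?_).mono ?_ ?_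
  · intro i s' _
    simp [Ex.Ok]; omega
  · intro s' ⟨hf, _, h, _⟩
    simp [Ex.eval, h]
  · intro i s' ⟨hf, hi, h8, hm⟩
    have g3 : s'.r 3 = K.M := by rw [hf.1 3 (by simp), hM]
    have g5 : s'.r 5 = x := by rw [hf.1 5 (by simp), h5]
    have g6 : s'.r 6 = l := by rw [hf.1 6 (by simp), h6]
    have m5 : s'.m 5 = s.m 5 := hf.2 5 (by simp)
    have m0 : s'.m 0 = s.m 0 := hf.2 0 (by simp)
    have hw := (hent i (by omega)).1
    have hcw := hcol _ hw
    simp only [St.col] at hcw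
    have hM0 : 0 < K.M := by omega
    have hW0 : 0 < K.W := by omega
    have hiM : i < K.M := by omega
    have hxM : x < K.M := by omega
    have hwM : s.m 5 x l i < K.M := by omega
    refine ⟨by simp [Ex.eval, h8], ?_⟩
    refine (tri_asg_seq ?_ (tri_wr ?_ ?_ ?_)).mono (by decide) fun _ h => h
    · simp [Ex.Ok, Ex.eval, h8]; omega
    · simp [Ex.Ok, Ex.eval, h8, g3, g5, g6, m5, m0]; omega
    · simp [Ex.Ok]; omega
    · refine ⟨⟨fun j hj => ?_, fun k hk => ?_⟩, by omega, ?_, fun y h1 h2 => ?_⟩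
      · simp only [Finset.mem_singleton] at hj
        simp [hj, hf.1 j (by simp [hj])]
      · simp only [Finset.mem_singleton] at hk
        funext x y w
        simp [hk, hf.2 k (by simp [hk])]
      · simp [Ex.eval, h8]
      · simp only [Ex.eval, St.set_m, St.upd_m, St.set_r, h8, true_and, if_true, m5, m0,
          show (5 : ℕ) ≠ 8 from by decide, show (6 : ℕ) ≠ 8 from by decide, if_false, g5, g6,
          Nat.add_sub_cancel]
        split_ifs with h
        · refine ⟨fun h1 => h1.elim, fun hh => absurd h.symm (hh i le_rfl (by omega))⟩
        · rw [hm y h1 h2]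
          refine ⟨fun hh t h3 h4 => ?_, fun hh t h3 h4 => hh t (by omega) h4⟩
          rcases Nat.lt_or_ge i t with h5 | h5
          · exact hh t h5 h4
          · obtain rfl : t = i := by omega
            exact fun h6 => h h6.symm
  · refine ⟨⟨fun j hj => ?_, fun k hk => rfl⟩, le_rfl, by simp, fun y h1 h2 => ?_⟩
    · simp only [Finset.mem_singleton] at hj
      simp [hj]
    · simp only [St.set_m, h0 y h1 h2, true_iff]
      intro t h3 h4; omega
  · simp [Ex.len]; omega
  · rintro s' ⟨hf, _, _, h⟩
    refine ⟨hf, fun y h1 h2 => ?_⟩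
    rw [h y h1 h2, hiff]
    simp

lemma tri_listFree {K : Machine} {n : ℕ} (hK : Fits K n) {s : St} {lo k : ℕ}
    (hM : s.r 3 = K.M) (h14 : s.r 14 = lo) (h15 : s.r 15 = lo + k) (hlt : lo + k < K.M) :
    K.Tri listFree s (100 * k + 60) fun s' => Frame {8, 17} {9} s s' ∧
      s'.r 17 = ((Finset.Ico lo (lo + k)).filter fun y => s.m 8 0 0 y = 0).card ∧
      (Finset.range (s'.r 17)).image (s'.m 9 0 0) =
        (Finset.Ico lo (lo + k)).filter fun y => s.m 8 0 0 y = 0 := by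
  have hW := hK.word
  have hlarge := hK.large
  unfold listFree
  refine Tri.seq (P := fun s' => s' = s.set 8 lo) (k₂ := 100 * k + 55) (tri_asg ?_ ?_) ?_ ?_
  · simp [Ex.Ok]
  · simp [Ex.eval, h14]
  swap
  · simp [Cmd.len, Ex.len]; omega
  rintro _ rfl
  refine Tri.seq (P := fun s' => s' = (s.set 8 lo).set 17 0) (k₂ := 100 * k + 50)
    (tri_asg ?_ ?_) ?_ ?_
  · simp [Ex.Ok]; omega
  · simp [Ex.eval]
  swap
  · simp [Cmd.len, Ex.len]; omega
  rintro _ rfl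
  refine (tri_loop (i := k) (k := 90) (fun i s' => Frame {8, 17} {9} s s' ∧ i ≤ k ∧
    s'.r 8 = lo + (k - i) ∧
    s'.r 17 = ((Finset.Ico lo (lo + (k - i))).filter fun y => s.m 8 0 0 y = 0).card ∧
    (Finset.range (s'.r 17)).image (s'.m 9 0 0) =
      (Finset.Ico lo (lo + (k - i))).filter fun y => s.m 8 0 0 y = 0) ?_ ?_ ?_ ?_).mono ?_ ?_
  · intro i s' _
    simp [Ex.Ok]
  · intro s' ⟨hf, _, h, _⟩
    simp [Ex.eval, h, hf.1 15 (by simp), h15]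
  · intro i s' ⟨hf, hi, h8, h17, himg⟩
    have g3 : s'.r 3 = K.M := by rw [hf.1 3 (by simp), hM]
    have m8 : s'.m 8 = s.m 8 := hf.2 8 (by simp)
    have hcard : s'.r 17 ≤ k - (i + 1) := by
      rw [h17]
      refine (Finset.card_filter_le _ _).trans ?_
      simp
    have hset : Finset.Ico lo (lo + (k - i)) =
        insert (lo + (k - (i + 1))) (Finset.Ico lo (lo + (k - (i + 1)))) := by
      rw [show lo + (k - i) = lo + (k - (i + 1)) + 1 by omega,
        ← Finset.insert_Ico_right_eq_Ico_add_one (by omega)]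
    have hframe : ∀ (t : St), (∀ j, j ≠ 8 → j ≠ 17 → t.r j = s'.r j) →
        (∀ k, k ≠ 9 → t.m k = s'.m k) → Frame {8, 17} {9} s t := by
      intro t h1 h2
      refine ⟨fun j hj => ?_, fun k hk => ?_⟩
      · rw [← hf.1 j hj]
        simp only [Finset.mem_insert, Finset.mem_singleton, not_or] at hj
        exact h1 j hj.1 hj.2
      · rw [← hf.2 k hk]
        simp only [Finset.mem_singleton] at hk
        exact h2 k hk
    refine ⟨by simp [Ex.eval, h8, hf.1 15 (by simp), h15]; omega, ?_⟩
    refine (Tri.seq_len (P := fun s'' => s'' = if s.m 8 0 0 (lo + (k - (i + 1))) = 0 then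
      (s'.upd 9 0 0 (s'.r 17) (lo + (k - (i + 1)))).set 17 (s'.r 17 + 1) else s')
      (tri_ite ?_ ?_ (fun h => ?_) (fun h => ?_)) ?_).mono (by decide) fun _ h => h
    · simp [Ex.Ok, Ex.eval, h8, g3]; omega
    · simp [Ex.Ok]; omega
    · simp [Ex.eval, h8, m8] at h
      refine tri_wr_seq ?_ ?_ (tri_asg ?_ ?_)
      · simp [Ex.Ok, Ex.eval, g3]; omega
      · simp [Ex.Ok]
      · simp [Ex.Ok, Ex.eval]; omega
      · simp [Ex.eval, h8, h]
    · simp [Ex.eval, h8, m8] at h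
      exact tri_skip (by rw [if_neg (by omega)])
    rintro _ rfl
    split_ifs with h
    · refine tri_asg ?_ ⟨hframe _ ?_ ?_, by omega, ?_, ?_, ?_⟩
      · simp [Ex.Ok, Ex.eval, h8]; omega
      · intro j h1 h2; simp [h1, h2]
      · intro j h1; funext a b c; simp [h1]
      · simp [Ex.eval, h8]; omega
      · simp only [St.set_r, St.upd_r, show (17 : ℕ) ≠ 8 from by decide, if_true, if_false]
        rw [hset, Finset.filter_insert, if_pos h, Finset.card_insert_of_notMem (by simp), h17]
      · simp only [St.set_r, St.upd_r, St.set_m, show (17 : ℕ) ≠ 8 from by decide, if_true,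
          if_false]
        rw [hset, Finset.filter_insert, if_pos h, Finset.range_add_one, Finset.image_insert, ← himg]
        congr 1
        · simp
        · apply Finset.image_congr
          intro t ht
          simp only [Finset.coe_range, Set.mem_Iio] at ht
          have : t ≠ s'.r 17 := by omega
          simp [this]
    · refine tri_asg ?_ ⟨hframe _ ?_ ?_, by omega, ?_, ?_, ?_⟩
      · simp [Ex.Ok, Ex.eval, h8]; omega
      · intro j h1 h2; simp [h1]
      · intro j h1; simp
      · simp [Ex.eval, h8]; omega
      · simp only [St.set_r, show (17 : ℕ) ≠ 8 from by decide, if_false]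
        rw [hset, Finset.filter_insert, if_neg h, h17]
      · simp only [St.set_r, St.set_m, show (17 : ℕ) ≠ 8 from by decide, if_false]
        rw [hset, Finset.filter_insert, if_neg h, himg]
  · refine ⟨⟨fun j hj => ?_, fun k hk => rfl⟩, le_rfl, by simp, by simp, by simp⟩
    simp only [Finset.mem_insert, Finset.mem_singleton, not_or] at hj
    simp [hj]
  · simp [Ex.len]; omega
  · rintro s' ⟨hf, _, _, h, h'⟩
    exact ⟨hf, by simpa using h, by simpa using h'⟩

lemma Good.col_lt {K : Machine} {n : ℕ} (hK : Fits K n) {E : ℕ → ℕ → Bool} {s : St}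
    (hG : Good K n E s) {v : ℕ} (hv : v < n) : s.col v < K.M := by
  by_cases h : s.col v = 0
  · rw [h]; have := hK.large; omega
  · have h1 := (hG.palette v hv h).2
    have h2 := hG.lvl_le v hv
    have h3 := top_lt n
    have h4 := hK.base_lt (l := s.lvl v + 1) (by omega)
    omega

lemma tri_prepareColors {K : Machine} {n : ℕ} (hK : Fits K n) {s : St} {E : ℕ → ℕ → Bool}
    (hE : IsGraph n E) (hG : Good K n E s) {x : ℕ} (hx : x < n) (h5 : s.r 5 = x)
    (h6 : s.r 6 = s.lvl x) (hD : (upNbrs n E s.lvl x (s.lvl x)).card ≤ 12 * scale n (s.lvl x)) :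
    K.Tri prepareColors s (4000 * scale n (s.lvl x) + 400) fun s' =>
      Frame {8, 14, 15, 17} {8, 9} s s' ∧ s'.r 17 = (freeColors n E s x).card ∧
      (Finset.range (s'.r 17)).image (s'.m 9 0 0) = freeColors n E s x := by
  have hW := hK.word
  have hlarge := hK.large
  have hn := hK.lt
  have hT := top_lt n
  have hTM := hK.lvls_lt
  have hl := hG.lvl_le x hx
  have hsc := hG.scale _ (by omega : s.lvl x < lvls n)
  have hbs := hG.base _ (by omega : s.lvl x < lvls n)
  have hslt := hK.scale_lt (l := s.lvl x) (by omega)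
  have hblt := hK.base_lt (l := s.lvl x) (by omega)
  have hblt' := hK.base_lt (l := s.lvl x + 1) (by omega)
  have hM := hG.r3
  rw [base_succ] at hblt'
  have hfree : freeColors n E s x = (Finset.Ico (base n (s.lvl x))
      (base n (s.lvl x) + 16 * scale n (s.lvl x))).filter fun c =>
        ∀ w ∈ upNbrs n E s.lvl x (s.lvl x), s.col w ≠ c := by
    rw [freeColors, base_succ]
  rw [hfree]
  generalize hlx : s.lvl x = l at *
  set lo := base n l with hlo
  set k := 16 * scale n l with hk
  have hsk : 4000 * scale n l = 250 * k := by omega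
  have h12 : 12 * scale n l ≤ k := by omega
  unfold prepareColors
  refine Tri.seq (P := fun s' => s' = s.set 14 lo) (k₂ := 250 * k + 350) (tri_asg ?_ ?_) ?_ ?_
  · simp [Ex.Ok, Ex.eval, hM, h6]; omega
  · simp [Ex.eval, h6, hbs]
  swap
  · simp [Cmd.len, Ex.len]; omega
  rintro _ rfl
  refine Tri.seq (P := fun s' => s' = (s.set 14 lo).set 15 (lo + k)) (k₂ := 250 * k + 300)
    (tri_asg ?_ ?_) ?_ ?_
  · simp [Ex.Ok, Ex.eval, hM, h6, hsc]; omega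
  · simp [Ex.eval, h6, hsc, hk]
  swap
  · simp [Cmd.len, Ex.len]; omega
  rintro _ rfl
  set s₁ := (s.set 14 lo).set 15 (lo + k) with hs₁
  refine Tri.seq (k₂ := 190 * k + 200) (tri_clearMarks hK (s := s₁) (lo := lo) (k := k)
    (by simp [hs₁, hM]) (by simp [hs₁]) (by simp [hs₁]) hblt') ?_ (by omega)
  rintro s₂ ⟨hf₂, hz₂⟩
  have m₂ : ∀ j, j ≠ 8 → s₂.m j = s.m j := fun j hj => by
    rw [hf₂.2 j (by simpa using hj)]; rfl
  have r₂ : ∀ j, j ∉ ({8, 14, 15} : Finset ℕ) → s₂.r j = s.r j := fun j hj => by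
    simp only [Finset.mem_insert, Finset.mem_singleton, not_or] at hj
    rw [hf₂.1 j (by simp [hj])]
    simp [hs₁, hj]
  have e14 : s₂.r 14 = lo := by rw [hf₂.1 14 (by simp)]; simp [hs₁]
  have e15 : s₂.r 15 = lo + k := by rw [hf₂.1 15 (by simp)]; simp [hs₁]
  have lvl₂ : s₂.lvl = s.lvl := by simp [St.lvl, m₂]
  have col₂ : s₂.col = s.col := by simp [St.col, m₂]
  have hmark := tri_markColors hK (s := s₂) hE (x := x) (l := l) (lo := lo) (hi := lo + k)
    (by rw [r₂ 3 (by simp), hM]) (by rw [lvl₂]; simpa [Lists, m₂] using hG.lists) hx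
    (by rw [r₂ 5 (by simp), h5]) (by rw [r₂ 6 (by simp), h6]) (by rw [lvl₂, hlx]) (by omega)
    (fun v hv => by rw [col₂]; exact hG.col_lt hK hv) hz₂
  rw [lvl₂, col₂] at hmark
  refine Tri.seq (k₂ := 100 * k + 100) (hmark.mono (k' := 90 * k + 100) ?_ fun _ h => h) ?_
    (by omega)
  · omega
  rintro s₃ ⟨hf₃, hm₃⟩
  have hset : ((Finset.Ico lo (lo + k)).filter fun y => s₃.m 8 0 0 y = 0) =
      (Finset.Ico lo (lo + k)).filter fun c => ∀ w ∈ upNbrs n E s.lvl x l, s.col w ≠ c := by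
    apply Finset.filter_congr
    intro y hy
    rw [Finset.mem_Ico] at hy
    exact hm₃ y hy.1 hy.2
  refine (tri_listFree hK (s := s₃) (lo := lo) (k := k) ?_ ?_ ?_ hblt').mono (by omega) ?_
  · rw [hf₃.1 3 (by simp), r₂ 3 (by simp), hM]
  · rw [hf₃.1 14 (by simp), e14]
  · rw [hf₃.1 15 (by simp), e15]
  rintro s₄ ⟨hf₄, h17, himg⟩
  rw [hset] at h17 himg
  refine ⟨⟨fun j hj => ?_, fun j hj => ?_⟩, h17, himg⟩
  · simp only [Finset.mem_insert, Finset.mem_singleton, not_or] at hj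
    rw [hf₄.1 j (by simp [hj]), hf₃.1 j (by simp [hj]), r₂ j (by simp [hj])]
  · simp only [Finset.mem_insert, Finset.mem_singleton, not_or] at hj
    rw [hf₄.2 j (by simp [hj]), hf₃.2 j (by simp [hj]), m₂ j hj.1]

/-- The new color is uniformly distributed among the free colors. -/
lemma wp_recolor {K : Machine} {n : ℕ} (hK : Fits K n) {s : St} {E : ℕ → ℕ → Bool}
    (hE : IsGraph n E) (hG : Good K n E s) {x : ℕ} (hx : x < n) (h5 : s.r 5 = x)
    (h6 : s.r 6 = s.lvl x) (hD : (upNbrs n E s.lvl x (s.lvl x)).card ≤ 12 * scale n (s.lvl x))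
    (f : St → ℝ≥0∞) (B : ℕ → ℝ≥0∞)
    (hf : ∀ c ∈ freeColors n E s x, ∀ s', Frame {8, 14, 15, 17, 18} {0, 8, 9} s s' →
      s'.col = upd s.col x c → f s' ≤ B c) :
    K.wp recolor f s ≤ K.τ * (4000 * scale n (s.lvl x) + 500 : ℕ) +
      (∑ c ∈ freeColors n E s x, B c) / (freeColors n E s x).card := by
  have hW := hK.word
  have hlarge := hK.large
  have hn := hK.lt
  have hcard := card_freeColors hD
  have hpos := scale_pos n (s.lvl x)
  have hT := top_lt n
  have hl := hG.lvl_le x hx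
  have hcM : (freeColors n E s x).card < K.M := by
    refine lt_of_le_of_lt (Finset.card_filter_le _ _) ?_
    have := hK.base_lt (l := s.lvl x + 1) (by omega)
    rw [Nat.card_Ico]
    omega
  have hcolM : ∀ c ∈ freeColors n E s x, c < K.M := fun c hc => by
    rw [freeColors, Finset.mem_filter, Finset.mem_Ico] at hc
    have := hK.base_lt (l := s.lvl x + 1) (by omega)
    omega
  set C := freeColors n E s x with hC
  unfold recolor
  refine (wp_seq _ _ _ _).trans ?_
  refine (tri_prepareColors hK hE hG hx h5 h6 hD _ (K.τ * 100 + (∑ c ∈ C, B c) / C.card)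
    ?_).trans ?_
  swap
  · calc _ ≤ K.τ * (4000 * scale n (s.lvl x) + 400 + 100 : ℕ) + (∑ c ∈ C, B c) / C.card := by
          push_cast; ring_nf; rfl
      _ = _ := rfl
  rintro s₁ ⟨hf₁, h17, himg⟩
  rw [← hC] at h17 himg
  have e3 : s₁.r 3 = K.M := by rw [hf₁.1 3 (by simp), hG.r3]
  have e5 : s₁.r 5 = x := by rw [hf₁.1 5 (by simp), h5]
  refine (wp_seq _ _ _ _).trans ?_
  refine (wp_rnd _ ?_).trans ?_
  · simp [Ex.Ok, Ex.eval]; omega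
  have hev : (Ex.sub (.var 17) (.lit 1)).eval s₁ + 1 = C.card := by
    simp [Ex.eval]; omega
  rw [hev]
  have hinj : Set.InjOn (s₁.m 9 0 0) (Finset.range (s₁.r 17)) := by
    rw [← Finset.card_image_iff, himg, Finset.card_range, h17]
  have hround : ∀ t ∈ Finset.range C.card, K.wp (.wr 0 z z (.var 5) (.rd 9 z z (.var 18))) f
      (s₁.set 18 t) ≤ K.τ * 50 + B (s₁.m 9 0 0 t) := by
    intro t ht
    have hmem : s₁.m 9 0 0 t ∈ C := by
      rw [← himg, h17]; exact Finset.mem_image_of_mem _ ht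
    rw [Finset.mem_range] at ht
    refine (wp_wr _ ?_ ?_).trans ?_
    · simp [Ex.Ok, Ex.eval, e3, e5]; omega
    · simp [Ex.Ok, Ex.eval, e3]; omega
    · refine add_le_add ?_ (hf _ hmem _ ⟨fun j hj => ?_, fun j hj => ?_⟩ ?_)
      · gcongr
        simp only [Cmd.len, Ex.len]; norm_num
      · simp only [Finset.mem_insert, Finset.mem_singleton, not_or] at hj
        simp [hj, hf₁.1 j (by simp [hj])]
      · simp only [Finset.mem_insert, Finset.mem_singleton, not_or] at hj
        funext a b c
        simp [hj, hf₁.2 j (by simp [hj])]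
      · funext v
        simp [Ex.eval, e5, St.col, hf₁.2 0 (by simp)]
  have hC0 : (C.card : ℝ≥0∞) ≠ 0 := by
    have : C.card ≠ 0 := by omega
    exact_mod_cast this
  calc _ ≤ K.τ * 50 + (∑ t ∈ Finset.range C.card, (K.τ * 50 + B (s₁.m 9 0 0 t))) / C.card := by
        gcongr
        · simp only [Ex.len]; norm_num
        · exact hround _ ‹_›
    _ = K.τ * 50 + (C.card * (K.τ * 50) + ∑ c ∈ C, B c) / C.card := by
        rw [Finset.sum_add_distrib, Finset.sum_const, Finset.card_range, nsmul_eq_mul]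
        congr 3
        rw [← h17, ← Finset.sum_image (f := B) hinj, himg]
    _ = K.τ * 50 + (K.τ * 50 + (∑ c ∈ C, B c) / C.card) := by
        rw [ENNReal.add_div, ENNReal.mul_div_right_comm, ENNReal.div_self hC0 (by simp), one_mul]
    _ = _ := by ring

/-! ### The potential of the levels -/

/-- The potential of a pair of vertices. The first summand drops when the lower vertex moves up; the
second one, when one of two vertices on the same level moves up. -/
def pairPot (n : ℕ) (E : ℕ → ℕ → Bool) (lvl : ℕ → ℕ) (u v : ℕ) : ℕ :=
  if E u v then 3 * (lvls n - min (lvl u) (lvl v)) + (if lvl u = lvl v then 1 else 0) else 0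

/-- The potential of a vertex: for every level below its own, the number of neighbors on this level
or above that it lacks. -/
def vertexPot (n : ℕ) (E : ℕ → ℕ → Bool) (lvl : ℕ → ℕ) (v : ℕ) : ℕ :=
  ∑ j ∈ Finset.range (lvl v), (12 * scale n j - (upNbrs n E lvl v j).card)

/-- The potential that pays for the changes of levels. -/
def levelPot (n : ℕ) (E : ℕ → ℕ → Bool) (lvl : ℕ → ℕ) : ℕ :=
  ∑ u ∈ Finset.range n, ∑ v ∈ Finset.range n, pairPot n E lvl u v +
    12 * ∑ v ∈ Finset.range n, vertexPot n E lvl v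

/-- A double sum of a symmetric function that vanishes at `(x, x)`: the row and the column of `x`
are split off. -/
lemma sum_sum_eq_of_symm {M : Type*} [CommSemiring M] {s : Finset ℕ} {x : ℕ} (hx : x ∈ s)
    (g : ℕ → ℕ → M) (hg : ∀ u v, g u v = g v u) (hxx : g x x = 0) :
    ∑ u ∈ s, ∑ v ∈ s, g u v =
      ∑ u ∈ s.erase x, ∑ v ∈ s.erase x, g u v + 2 * ∑ v ∈ s, g x v := by
  have h1 : ∀ f : ℕ → M, ∑ v ∈ s, f v = ∑ v ∈ s.erase x, f v + f x := fun f =>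
    (Finset.sum_erase_add s f hx).symm
  rw [h1 (fun u => ∑ v ∈ s, g u v)]
  simp only [h1 (g _), Finset.sum_add_distrib, hxx, add_zero]
  rw [Finset.sum_congr rfl fun u (_ : u ∈ s.erase x) => hg u x]
  ring

lemma upNbrs_anti (n : ℕ) (E : ℕ → ℕ → Bool) (lvl : ℕ → ℕ) (v : ℕ) {i j : ℕ} (h : i ≤ j) :
    upNbrs n E lvl v j ⊆ upNbrs n E lvl v i := by
  intro w hw
  simp only [upNbrs, Finset.mem_filter] at hw ⊢
  exact ⟨hw.1, hw.2.1, h.trans hw.2.2⟩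

lemma upd_self_eq (f : ℕ → ℕ) (x y : ℕ) : upd f x y x = y := if_pos rfl

/-- The upward neighbors of `x` do not depend on its own level. -/
lemma upNbrs_upd_self {n : ℕ} {E : ℕ → ℕ → Bool} (hE : IsGraph n E) (lvl : ℕ → ℕ) (x l' j : ℕ) :
    upNbrs n E (upd lvl x l') x j = upNbrs n E lvl x j := by
  ext w
  simp only [mem_upNbrs hE, upd]
  by_cases hw : w = x
  · subst hw; simp [hE.irrefl]
  · simp [hw]

lemma upNbrs_upd_subset {n : ℕ} {E : ℕ → ℕ → Bool} (hE : IsGraph n E) {lvl : ℕ → ℕ} {x l' : ℕ}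
    (v : ℕ) {j : ℕ} (h : j ≤ lvl x → j ≤ l') :
    upNbrs n E lvl v j ⊆ upNbrs n E (upd lvl x l') v j := by
  intro w
  simp only [mem_upNbrs hE, upd]
  rintro ⟨h1, h2⟩
  refine ⟨h1, ?_⟩
  split_ifs with hw
  · subst hw; exact h h2
  · exact h2

lemma upNbrs_upd_eq {n : ℕ} {E : ℕ → ℕ → Bool} (hE : IsGraph n E) {lvl : ℕ → ℕ} {x l' : ℕ}
    (v : ℕ) {j : ℕ} (h : E v x = true → (j ≤ lvl x ↔ j ≤ l')) :
    upNbrs n E (upd lvl x l') v j = upNbrs n E lvl v j := by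
  ext w
  simp only [mem_upNbrs hE, upd]
  by_cases hw : w = x
  · subst hw
    simp only [if_true]
    exact and_congr_right fun hh => (h hh).symm
  · simp [hw]

lemma pairPot_symm {n : ℕ} {E : ℕ → ℕ → Bool} (hE : IsGraph n E) (lvl : ℕ → ℕ) (u v : ℕ) :
    pairPot n E lvl u v = pairPot n E lvl v u := by
  simp only [pairPot, hE.symm u v, min_comm (lvl u), eq_comm (a := lvl u)]

lemma sum_pairPot_upd {n : ℕ} {E : ℕ → ℕ → Bool} (hE : IsGraph n E) {lvl : ℕ → ℕ} {x l' : ℕ}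
    (hx : x < n) {a b : ℕ} (h : ∑ w ∈ Finset.range n, pairPot n E (upd lvl x l') x w + a ≤
      ∑ w ∈ Finset.range n, pairPot n E lvl x w + b) :
    ∑ u ∈ Finset.range n, ∑ v ∈ Finset.range n, pairPot n E (upd lvl x l') u v + 2 * a ≤
      ∑ u ∈ Finset.range n, ∑ v ∈ Finset.range n, pairPot n E lvl u v + 2 * b := by
  have hmem : x ∈ Finset.range n := Finset.mem_range.2 hx
  rw [sum_sum_eq_of_symm hmem _ (pairPot_symm hE _) (by simp [pairPot, hE.irrefl]),
    sum_sum_eq_of_symm hmem _ (pairPot_symm hE lvl) (by simp [pairPot, hE.irrefl])]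
  have : ∑ u ∈ (Finset.range n).erase x, ∑ v ∈ (Finset.range n).erase x,
      pairPot n E (upd lvl x l') u v = ∑ u ∈ (Finset.range n).erase x,
        ∑ v ∈ (Finset.range n).erase x, pairPot n E lvl u v := by
    refine Finset.sum_congr rfl fun u hu => Finset.sum_congr rfl fun v hv => ?_
    simp only [pairPot, upd, Finset.ne_of_mem_erase hu, Finset.ne_of_mem_erase hv, if_false]
  omega

lemma card_upNbrs_eq_sum (n : ℕ) (E : ℕ → ℕ → Bool) (lvl : ℕ → ℕ) (v j : ℕ) :
    (upNbrs n E lvl v j).card =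
      ∑ w ∈ Finset.range n, if E v w = true ∧ j ≤ lvl w then 1 else 0 := by
  rw [upNbrs, Finset.card_filter]

/-- A move up frees potential of the pairs; the new level adds nothing to the potential of `x`, as
`x` does not lack neighbors on its old level or above. -/
lemma levelPot_promote {n : ℕ} {E : ℕ → ℕ → Bool} (hE : IsGraph n E) {lvl : ℕ → ℕ} {x : ℕ}
    (hx : x < n) (hl : lvl x < lvls n)
    (hD : 12 * scale n (lvl x) < (upNbrs n E lvl x (lvl x)).card) :
    levelPot n E (upd lvl x (lvl x + 1)) + 2 * (upNbrs n E lvl x (lvl x)).card ≤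
      levelPot n E lvl := by
  have h1 := sum_pairPot_upd hE (lvl := lvl) (l' := lvl x + 1) hx
    (a := (upNbrs n E lvl x (lvl x)).card) (b := 0) (by
      rw [card_upNbrs_eq_sum, ← Finset.sum_add_distrib, add_zero]
      refine Finset.sum_le_sum fun w _ => ?_
      by_cases hE' : E x w = true
      · have hne : w ≠ x := by rintro rfl; simp [hE.irrefl] at hE'
        simp only [pairPot, hE', if_true, upd, hne, if_false, true_and]
        split_ifs <;> omega
      · simp [pairPot, hE'])
  have h2 : ∑ v ∈ Finset.range n, vertexPot n E (upd lvl x (lvl x + 1)) v ≤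
      ∑ v ∈ Finset.range n, vertexPot n E lvl v := by
    refine Finset.sum_le_sum fun v _ => ?_
    unfold vertexPot
    by_cases hv : v = x
    · subst hv
      simp only [upd_self_eq, Finset.sum_range_succ, upNbrs_upd_self hE]
      omega
    · simp only [upd, hv, if_false]
      refine Finset.sum_le_sum fun j _ => Nat.sub_le_sub_left (Finset.card_le_card ?_) _
      exact upNbrs_upd_subset hE v fun h => by omega
  unfold levelPot
  omega

/-- A move down raises the potential of the pairs and of the neighbors. The potential of `x` pays for
this, as `x` lacks at least `8 * scale n l` neighbors on level `l` or above. -/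
lemma levelPot_demote {n : ℕ} {E : ℕ → ℕ → Bool} (hE : IsGraph n E) {lvl : ℕ → ℕ} {x l : ℕ}
    (hx : x < n) (hl : lvl x = l + 1) (hT : lvl x < lvls n)
    (hD : (upNbrs n E lvl x l).card < 4 * scale n l) :
    levelPot n E (upd lvl x l) + 24 * scale n l ≤ levelPot n E lvl := by
  have h1 := sum_pairPot_upd hE (lvl := lvl) (l' := l) hx
    (a := 0) (b := 3 * (upNbrs n E lvl x l).card) (by
      rw [card_upNbrs_eq_sum, Finset.mul_sum, ← Finset.sum_add_distrib, add_zero]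
      refine Finset.sum_le_sum fun w _ => ?_
      by_cases hE' : E x w = true
      · have hne : w ≠ x := by rintro rfl; simp [hE.irrefl] at hE'
        simp only [pairPot, hE', if_true, upd, hne, if_false, true_and, hl]
        split_ifs <;> omega
      · simp [pairPot, hE'])
  have h2 : ∑ v ∈ Finset.range n, vertexPot n E (upd lvl x l) v + 12 * scale n l ≤
      ∑ v ∈ Finset.range n, vertexPot n E lvl v + 2 * (upNbrs n E lvl x l).card := by
    have hmem : x ∈ Finset.range n := Finset.mem_range.2 hx
    rw [← Finset.sum_erase_add _ _ hmem, ← Finset.sum_erase_add (Finset.range n)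
      (vertexPot n E lvl) hmem]
    have h3 : vertexPot n E (upd lvl x l) x + (12 * scale n l - (upNbrs n E lvl x l).card) =
        vertexPot n E lvl x := by
      unfold vertexPot
      simp only [upd_self_eq, hl, Finset.sum_range_succ, upNbrs_upd_self hE]
    have h4 : ∑ v ∈ (Finset.range n).erase x, vertexPot n E (upd lvl x l) v ≤
        ∑ v ∈ (Finset.range n).erase x, vertexPot n E lvl v + (upNbrs n E lvl x l).card := by
      have h5 : ∑ v ∈ (Finset.range n).erase x, (if E x v = true ∧ l ≤ lvl v then 1 else 0) ≤
          (upNbrs n E lvl x l).card := by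
        rw [card_upNbrs_eq_sum]
        exact Finset.sum_le_sum_of_subset (Finset.erase_subset _ _)
      refine le_trans ?_ (add_le_add le_rfl h5)
      rw [← Finset.sum_add_distrib]
      refine Finset.sum_le_sum fun v hv => ?_
      have hvx := Finset.ne_of_mem_erase hv
      unfold vertexPot
      simp only [upd, hvx, if_false]
      -- only the number of neighbors on level `l + 1` or above can decrease, by one
      have hterm : ∀ j ∈ Finset.range (lvl v), 12 * scale n j -
          (upNbrs n E (upd lvl x l) v j).card ≤ (12 * scale n j - (upNbrs n E lvl v j).card) +
            if j = l + 1 then (if E x v = true ∧ l ≤ lvl v then 1 else 0) else 0 := by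
        intro j hj
        rw [Finset.mem_range] at hj
        by_cases hEv : E x v = true
        · by_cases hjl : j = l + 1
          · have hsub : upNbrs n E lvl v j ⊆ insert x (upNbrs n E (upd lvl x l) v j) := by
              intro w
              simp only [Finset.mem_insert, mem_upNbrs hE, upd]
              rintro ⟨a, b⟩
              by_cases hw : w = x
              · exact Or.inl hw
              · exact Or.inr ⟨a, by simpa [hw] using b⟩
            have hc := (Finset.card_le_card hsub).trans (Finset.card_insert_le _ _)
            rw [if_pos hjl, if_pos ⟨hEv, by omega⟩]
            omega
          · rw [upNbrs_upd_eq hE v fun _ => by omega]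
            omega
        · rw [upNbrs_upd_eq hE v fun h => absurd (hE.symm x v ▸ h) hEv]
          omega
      refine (Finset.sum_le_sum hterm).trans ?_
      rw [Finset.sum_add_distrib, Finset.sum_ite_eq']
      split_ifs <;> omega
    omega
  unfold levelPot
  omega

/-- A legitimate change of the level of a vertex frees potential for the neighbors that have to be
treated and for a recoloring on the new level. -/
lemma levelPot_move {n : ℕ} {E : ℕ → ℕ → Bool} (hE : IsGraph n E) {lvl : ℕ → ℕ} {x l' : ℕ}
    (hx : x < n) (hT : lvl x < lvls n)
    (h : (l' = lvl x + 1 ∧ 12 * scale n (lvl x) < (upNbrs n E lvl x (lvl x)).card) ∨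
      (l' + 1 = lvl x ∧ (upNbrs n E lvl x l').card < 4 * scale n l')) :
    levelPot n E (upd lvl x l') + (upNbrs n E lvl x (lvl x)).card + 6 * scale n l' ≤
      levelPot n E lvl := by
  rcases h with ⟨rfl, h⟩ | ⟨h1, h⟩
  · have := levelPot_promote hE hx hT h
    have := scale_succ_le n (lvl x)
    omega
  · have := levelPot_demote hE hx h1.symm hT h
    have := Finset.card_le_card (upNbrs_anti n E lvl x (by omega : l' ≤ lvl x))
    omega

/-- The graph with the edge `ab` inserted (`ins = true`) or deleted. -/
def change (ins : Bool) (a b : ℕ) (E : ℕ → ℕ → Bool) : ℕ → ℕ → Bool :=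
  fun u v => if (u = a ∧ v = b) ∨ (u = b ∧ v = a) then ins else E u v

lemma IsGraph.change {n : ℕ} {E : ℕ → ℕ → Bool} (hE : IsGraph n E) (ins : Bool) {a b : ℕ}
    (ha : a < n) (hb : b < n) (hab : a ≠ b) : IsGraph n (change ins a b E) where
  symm u v := by
    simp only [DynColoring.change, hE.symm u v]
    congr 1
    apply propext
    tauto
  irrefl u := by
    simp only [DynColoring.change, hE.irrefl]
    rw [if_neg (by omega)]
  lt u v h := by
    simp only [DynColoring.change] at h
    split_ifs at h with hc
    · omega
    · exact hE.lt u v h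

/-- An update increases the potential by at most a constant times the number of levels. -/
lemma levelPot_change {n : ℕ} {E : ℕ → ℕ → Bool} (hE : IsGraph n E) {lvl : ℕ → ℕ}
    (hT : ∀ v < n, lvl v < lvls n) (ins : Bool) {a b : ℕ} (ha : a < n) (hb : b < n) (hab : a ≠ b) :
    levelPot n (change ins a b E) lvl ≤ levelPot n E lvl + 30 * lvls n := by
  have hE' := hE.change ins ha hb hab
  have hlv : 0 < lvls n := by have := hT a ha; omega
  cases ins with
  | true =>
    have h1 : ∑ u ∈ Finset.range n, ∑ v ∈ Finset.range n, pairPot n (change true a b E) lvl u v ≤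
        ∑ u ∈ Finset.range n, ∑ v ∈ Finset.range n, pairPot n E lvl u v +
          2 * (3 * lvls n + 1) := by
      have h2 : ∑ u ∈ Finset.range n, ∑ v ∈ Finset.range n,
          ((if u = a then (if v = b then 3 * lvls n + 1 else 0) else 0) +
            (if u = b then (if v = a then 3 * lvls n + 1 else 0) else 0)) =
              2 * (3 * lvls n + 1) := by
        simp only [Finset.sum_add_distrib]
        have : ∀ p q : ℕ, p < n → q < n → ∑ u ∈ Finset.range n, ∑ v ∈ Finset.range n,
            (if u = p then (if v = q then 3 * lvls n + 1 else 0) else 0) = 3 * lvls n + 1 := by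
          intro p q hp hq
          rw [Finset.sum_eq_single_of_mem p (Finset.mem_range.2 hp) (by intro c _ hc; simp [hc])]
          simp [hq]
        rw [this a b ha hb, this b a hb ha]
        ring
      rw [← h2, ← Finset.sum_add_distrib]
      refine Finset.sum_le_sum fun u _ => ?_
      rw [← Finset.sum_add_distrib]
      refine Finset.sum_le_sum fun v _ => ?_
      simp only [pairPot, change]
      split_ifs <;> omega
    have h3 : ∑ v ∈ Finset.range n, vertexPot n (change true a b E) lvl v ≤
        ∑ v ∈ Finset.range n, vertexPot n E lvl v := by
      refine Finset.sum_le_sum fun v _ => Finset.sum_le_sum fun j _ =>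
        Nat.sub_le_sub_left (Finset.card_le_card fun w => ?_) _
      rw [mem_upNbrs hE, mem_upNbrs hE']
      rintro ⟨h, h'⟩
      exact ⟨by simp [change, h], h'⟩
    unfold levelPot
    omega
  | false =>
    have h1 : ∑ u ∈ Finset.range n, ∑ v ∈ Finset.range n, pairPot n (change false a b E) lvl u v ≤
        ∑ u ∈ Finset.range n, ∑ v ∈ Finset.range n, pairPot n E lvl u v := by
      refine Finset.sum_le_sum fun u _ => Finset.sum_le_sum fun v _ => ?_
      simp only [pairPot, change]
      split_ifs <;> first | omega | simp_all
    have h3 : ∑ v ∈ Finset.range n, vertexPot n (change false a b E) lvl v ≤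
        ∑ v ∈ Finset.range n, vertexPot n E lvl v + 2 * lvls n := by
      have h2 : ∑ v ∈ Finset.range n, ((if v = a then lvls n else 0) +
          (if v = b then lvls n else 0)) = 2 * lvls n := by
        rw [Finset.sum_add_distrib]
        simp [ha, hb]
        ring
      rw [← h2, ← Finset.sum_add_distrib]
      refine Finset.sum_le_sum fun v hv => ?_
      rw [Finset.mem_range] at hv
      by_cases hvab : v = a ∨ v = b
      · have h4 : vertexPot n (change false a b E) lvl v ≤ vertexPot n E lvl v + lvl v := by
          rw [vertexPot, vertexPot]
          refine le_trans (Finset.sum_le_sum (g := fun j =>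
            (12 * scale n j - (upNbrs n E lvl v j).card) + 1) fun j _ => ?_)
              (by rw [Finset.sum_add_distrib]; simp)
          have hsub : upNbrs n E lvl v j ⊆
              insert (if v = a then b else a) (upNbrs n (change false a b E) lvl v j) := by
            intro w
            rw [Finset.mem_insert, mem_upNbrs hE, mem_upNbrs hE']
            rintro ⟨h, h'⟩
            by_cases hw : w = if v = a then b else a
            · exact Or.inl hw
            · refine Or.inr ⟨?_, h'⟩
              rw [change, if_neg, h]
              split_ifs at hw <;> omega
          have hc := (Finset.card_le_card hsub).trans (Finset.card_insert_le _ _)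
          omega
        have := hT v hv
        split_ifs <;> omega
      · have h4 : ∀ w, change false a b E v w = E v w := fun w => by
          rw [change, if_neg (by omega)]
        have h5 : vertexPot n (change false a b E) lvl v = vertexPot n E lvl v := by
          simp only [vertexPot, upNbrs, h4]
        omega
    unfold levelPot
    omega

lemma levelPot_le {n : ℕ} (hn : 2 ≤ n) (E : ℕ → ℕ → Bool) {lvl : ℕ → ℕ}
    (hT : ∀ v < n, lvl v < lvls n) : levelPot n E lvl ≤ 300 * pw n ^ 4 := by
  have hp := le_pw n
  have hT2 := lvls_le hn
  have h2 := two_le_pw hn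
  have h1 : ∑ u ∈ Finset.range n, ∑ v ∈ Finset.range n, pairPot n E lvl u v ≤
      n * (n * (3 * lvls n + 1)) := by
    refine (Finset.sum_le_card_nsmul _ _ _ fun u _ => Finset.sum_le_card_nsmul _ _
      (3 * lvls n + 1) fun v _ => ?_).trans (by simp)
    unfold pairPot
    split_ifs <;> omega
  have h3 : ∑ v ∈ Finset.range n, vertexPot n E lvl v ≤ n * (lvls n * (12 * pw n)) := by
    refine (Finset.sum_le_card_nsmul _ _ (lvls n * (12 * pw n)) fun v hv => ?_).trans (by simp)
    have hv' := hT v (Finset.mem_range.1 hv)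
    refine (Finset.sum_le_card_nsmul _ _ (12 * pw n) fun j hj => ?_).trans ?_
    · rw [Finset.mem_range] at hj
      have := scale_le (n := n) (l := j) (by omega)
      omega
    · rw [Finset.card_range, smul_eq_mul]
      exact Nat.mul_le_mul_right _ hv'.le
  unfold levelPot
  have h4 : n * (n * (3 * lvls n + 1)) ≤ pw n * (pw n * (3 * (2 * pw n ^ 2) + 1)) := by gcongr
  have h5 : n * (lvls n * (12 * pw n)) ≤ pw n * (2 * pw n ^ 2 * (12 * pw n)) := by gcongr
  have h6 : pw n * pw n ≤ pw n ^ 4 := by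
    rw [← sq]; exact Nat.pow_le_pow_right (by omega) (by omega)
  nlinarith

/-! ### The potential of the coloring -/

/-- The probability `1 - 1/d` that the coin of a vertex of degree scale `d` leaves its color
alone. -/
noncomputable def decay (d : ℕ) : ℝ≥0∞ := ((d - 1 : ℕ) : ℝ≥0∞) / d

lemma decay_le_one (d : ℕ) : decay d ≤ 1 := by
  refine ENNReal.div_le_of_le_mul ?_
  rw [one_mul]
  exact_mod_cast Nat.sub_le d 1

lemma one_add_decay_mul {d : ℕ} (hd : 0 < d) : 1 + decay d * d = d := by
  have h0 : (d : ℝ≥0∞) ≠ 0 := by exact_mod_cast hd.ne'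
  rw [decay, ENNReal.div_mul_cancel h0 (by simp)]
  exact_mod_cast (by omega : 1 + (d - 1) = d)

/-- The number of coins of `v` that are tossed at an update. -/
def touch {n : ℕ} (e : EdgeUpdate n) (v : ℕ) : ℕ :=
  if e.isInsert = true ∧ ((e.u : ℕ) = v ∨ (e.v : ℕ) = v) then 1 else 0

/-- Whether an update inserts the edge `uv`. -/
def hits {n : ℕ} (e : EdgeUpdate n) (u v : ℕ) : ℕ :=
  if e.isInsert = true ∧ (((e.u : ℕ) = u ∧ (e.v : ℕ) = v) ∨ ((e.u : ℕ) = v ∧ (e.v : ℕ) = u))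
  then 1 else 0

/-- The number of future insertions of the edge `uv`, each weighted with the probability that no
coin of `u` or `v` discards a color before, if the degree scale of both is `d`. -/
noncomputable def weight {n : ℕ} (d : ℕ) : List (EdgeUpdate n) → ℕ → ℕ → ℝ≥0∞
  | [], _, _ => 0
  | e :: r, u, v => hits e u v + decay d ^ (touch e u + touch e v) * weight d r u v

lemma weight_symm {n : ℕ} (d : ℕ) (r : List (EdgeUpdate n)) (u v : ℕ) :
    weight d r u v = weight d r v u := by
  induction r with
  | nil => rfl
  | cons e r ih =>
    simp only [weight, ih, add_comm (touch e u)]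
    congr 2
    simp only [hits, or_comm]

lemma sum_hits_le {n : ℕ} (e : EdgeUpdate n) (v : ℕ) :
    ∑ u ∈ Finset.range n, hits e u v ≤ touch e v := by
  by_cases h : e.isInsert = true ∧ ((e.u : ℕ) = v ∨ (e.v : ℕ) = v)
  · rw [touch, if_pos h]
    refine (Finset.sum_le_sum (g := fun u => if (if (e.u : ℕ) = v then (e.v : ℕ) else e.u) = u
      then 1 else 0) fun u _ => ?_).trans ?_
    · unfold hits
      split_ifs <;> omega
    · rw [Finset.sum_ite_eq]
      split_ifs <;> omega
  · rw [touch, if_neg h]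
    refine (Finset.sum_eq_zero fun u _ => ?_).le
    rw [hits, if_neg]
    tauto

lemma sum_touch_le {n : ℕ} (e : EdgeUpdate n) : ∑ v ∈ Finset.range n, touch e v ≤ 2 := by
  refine (Finset.sum_le_sum (g := fun v => (if (e.u : ℕ) = v then 1 else 0) +
    if (e.v : ℕ) = v then 1 else 0) fun v _ => ?_).trans ?_
  · unfold touch
    split_ifs <;> omega
  · rw [Finset.sum_add_distrib, Finset.sum_ite_eq, Finset.sum_ite_eq]
    split_ifs <;> omega

/-- A vertex of degree scale `d` takes part in at most `d` insertions, in expectation, until its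
coin discards its color. -/
lemma sum_weight_le {n d : ℕ} (hd : 0 < d) (r : List (EdgeUpdate n)) (v : ℕ) :
    ∑ u ∈ Finset.range n, weight d r u v ≤ d := by
  induction r with
  | nil => simp [weight]
  | cons e r ih =>
    simp only [weight]
    rw [Finset.sum_add_distrib]
    have h1 : ∑ u ∈ Finset.range n, decay d ^ (touch e u + touch e v) * weight d r u v ≤
        decay d ^ touch e v * d := by
      refine le_trans (Finset.sum_le_sum fun u _ => ?_)
        ((Finset.mul_sum _ _ _).symm.le.trans (mul_le_mul_right ih _))
      refine mul_le_mul_left ?_ _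
      rw [pow_add]
      exact (mul_le_mul_left (pow_le_one' (decay_le_one d) _) _).trans_eq (one_mul _)
    have h2 : ∑ u ∈ Finset.range n, (hits e u v : ℝ≥0∞) ≤ touch e v := by
      exact_mod_cast sum_hits_le e v
    refine (add_le_add h2 h1).trans ?_
    unfold touch
    split_ifs
    · rw [pow_one, Nat.cast_one, one_add_decay_mul hd]
    · simp

lemma sum_sum_weight_le {n : ℕ} (d : ℕ) (r : List (EdgeUpdate n)) :
    ∑ u ∈ Finset.range n, ∑ v ∈ Finset.range n, weight d r u v ≤ (2 * r.length : ℕ) := by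
  induction r with
  | nil => simp [weight]
  | cons e r ih =>
    simp only [weight, Finset.sum_add_distrib]
    have h1 : ∑ u ∈ Finset.range n, ∑ v ∈ Finset.range n, (hits e u v : ℝ≥0∞) ≤ 2 := by
      rw [Finset.sum_comm]
      exact_mod_cast (Finset.sum_le_sum fun v _ => sum_hits_le e v).trans (sum_touch_le e)
    have h2 : ∑ u ∈ Finset.range n, ∑ v ∈ Finset.range n,
        decay d ^ (touch e u + touch e v) * weight d r u v ≤ (2 * r.length : ℕ) := by
      refine le_trans (Finset.sum_le_sum fun u _ => Finset.sum_le_sum fun v _ => ?_) ih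
      exact (mul_le_mul_left (pow_le_one' (decay_le_one d) _) _).trans_eq (one_mul _)
    refine (add_le_add h1 h2).trans ?_
    rw [List.length_cons]
    push_cast
    ring_nf
    rfl

/-- The sum of the weights `ω d u v` of the pairs of vertices that are on the same level, of degree
scale `d`, and have the same color. -/
noncomputable def matchPot (n : ℕ) (lvl col : ℕ → ℕ) (ω : ℕ → ℕ → ℕ → ℝ≥0∞) : ℝ≥0∞ :=
  ∑ u ∈ Finset.range n, ∑ v ∈ Finset.range n,
    if u ≠ v ∧ col u = col v ∧ col v ≠ 0 ∧ lvl u = lvl v then ω (scale n (lvl v)) u v else 0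

lemma matchPot_add (n : ℕ) (lvl col : ℕ → ℕ) (ω ω' : ℕ → ℕ → ℕ → ℝ≥0∞) :
    matchPot n lvl col (fun d u v => ω d u v + ω' d u v) =
      matchPot n lvl col ω + matchPot n lvl col ω' := by
  simp only [matchPot, ← Finset.sum_add_distrib]
  refine Finset.sum_congr rfl fun u _ => Finset.sum_congr rfl fun v _ => ?_
  split_ifs <;> simp

/-- Discarding a color, possibly together with a change of the level, does not increase the
potential. -/
lemma matchPot_discard (n : ℕ) (lvl col : ℕ → ℕ) (ω : ℕ → ℕ → ℕ → ℝ≥0∞) (x l : ℕ) :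
    matchPot n (upd lvl x l) (upd col x 0) ω ≤ matchPot n lvl col ω := by
  refine Finset.sum_le_sum fun u _ => Finset.sum_le_sum fun v _ => ?_
  by_cases hu : u = x
  · rw [if_neg]
    · exact zero_le
    · rintro ⟨-, h1, h2, -⟩
      rw [hu, upd_self_eq] at h1
      exact h2 h1.symm
  · by_cases hv : v = x
    · simp [upd, hv]
    · simp [upd, hu, hv]

lemma upd_same (f : ℕ → ℕ) (x : ℕ) : upd f x (f x) = f := by
  funext v
  simp only [upd]
  split_ifs with h
  · rw [h]
  · rfl

lemma matchPot_discard' (n : ℕ) (lvl col : ℕ → ℕ) (ω : ℕ → ℕ → ℕ → ℝ≥0∞) (x : ℕ) :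
    matchPot n lvl (upd col x 0) ω ≤ matchPot n lvl col ω := by
  have := matchPot_discard n lvl col ω x (lvl x)
  rwa [upd_same] at this

/-- The part of the potential that belongs to `x`. -/
lemma matchPot_eq {n : ℕ} (lvl col : ℕ → ℕ) {ω : ℕ → ℕ → ℕ → ℝ≥0∞}
    (hω : ∀ d u v, ω d u v = ω d v u) {x : ℕ} (hx : x < n) :
    matchPot n lvl col ω = matchPot n lvl (upd col x 0) ω + 2 * ∑ v ∈ Finset.range n,
      if x ≠ v ∧ col x = col v ∧ col v ≠ 0 ∧ lvl x = lvl v then ω (scale n (lvl x)) x v else 0 := by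
  have hmem : x ∈ Finset.range n := Finset.mem_range.2 hx
  have hs : ∀ c : ℕ → ℕ, ∀ u v, (if u ≠ v ∧ c u = c v ∧ c v ≠ 0 ∧ lvl u = lvl v then
      ω (scale n (lvl v)) u v else 0) = (if v ≠ u ∧ c v = c u ∧ c u ≠ 0 ∧ lvl v = lvl u then
      ω (scale n (lvl u)) v u else 0) := by
    intro c u v
    by_cases h : u ≠ v ∧ c u = c v ∧ c v ≠ 0 ∧ lvl u = lvl v
    · rw [if_pos h, if_pos ⟨h.1.symm, h.2.1.symm, h.2.1 ▸ h.2.2.1, h.2.2.2.symm⟩, hω, h.2.2.2]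
    · rw [if_neg h, if_neg]
      rintro ⟨h1, h2, h3, h4⟩
      exact h ⟨h1.symm, h2.symm, h2 ▸ h3, h4.symm⟩
  unfold matchPot
  rw [sum_sum_eq_of_symm hmem _ (hs col) (by simp), sum_sum_eq_of_symm hmem _ (hs (upd col x 0))
    (by simp)]
  have h0 : ∑ v ∈ Finset.range n, (if x ≠ v ∧ upd col x 0 x = upd col x 0 v ∧ upd col x 0 v ≠ 0 ∧
      lvl x = lvl v then ω (scale n (lvl v)) x v else 0) = 0 := by
    refine Finset.sum_eq_zero fun v _ => ?_
    rw [if_neg]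
    rintro ⟨-, h1, h2, -⟩
    rw [upd_self_eq] at h1
    exact h2 h1.symm
  rw [h0, mul_zero, add_zero]
  congr 1
  · refine Finset.sum_congr rfl fun u hu => Finset.sum_congr rfl fun v hv => ?_
    simp only [upd, Finset.ne_of_mem_erase hu, Finset.ne_of_mem_erase hv, if_false]
  · congr 1
    refine Finset.sum_congr rfl fun v _ => ?_
    split_ifs with h
    · rw [h.2.2.2]
    · rfl

/-- The coin of `x`: on average the potential decreases to the one in which the coin of `x` is no
longer outstanding. -/
lemma matchPot_coin {n : ℕ} (lvl col : ℕ → ℕ) {ω ω' : ℕ → ℕ → ℕ → ℝ≥0∞}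
    (hω : ∀ d u v, ω d u v = ω d v u) (hω' : ∀ d u v, ω' d u v = ω' d v u) {x : ℕ} (hx : x < n)
    (h1 : ∀ d v, v ≠ x → ω d x v = decay d * ω' d x v)
    (h2 : ∀ d u v, u ≠ x → v ≠ x → ω' d u v = ω d u v) :
    (matchPot n lvl (upd col x 0) ω' +
      ((scale n (lvl x) - 1 : ℕ) : ℝ≥0∞) * matchPot n lvl col ω') / scale n (lvl x) ≤
      matchPot n lvl col ω := by
  set d := scale n (lvl x) with hd
  have hdpos : 0 < d := scale_pos _ _
  have hd0 : (d : ℝ≥0∞) ≠ 0 := by exact_mod_cast hdpos.ne'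
  have heq : matchPot n lvl (upd col x 0) ω' = matchPot n lvl (upd col x 0) ω := by
    refine Finset.sum_congr rfl fun u _ => Finset.sum_congr rfl fun v _ => ?_
    split_ifs with h
    · refine h2 _ _ _ ?_ ?_
      · rintro rfl
        rw [upd_self_eq] at h
        exact h.2.2.1 h.2.1.symm
      · rintro rfl
        rw [upd_self_eq] at h
        exact h.2.2.1 rfl
    · rfl
  rw [matchPot_eq lvl col hω hx, matchPot_eq lvl col hω' hx, heq]
  set P := matchPot n lvl (upd col x 0) ω
  rw [← hd]
  have hrow : ∑ v ∈ Finset.range n, (if x ≠ v ∧ col x = col v ∧ col v ≠ 0 ∧ lvl x = lvl v then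
      ω d x v else 0) = decay d * ∑ v ∈ Finset.range n,
        if x ≠ v ∧ col x = col v ∧ col v ≠ 0 ∧ lvl x = lvl v then ω' d x v else 0 := by
    rw [Finset.mul_sum]
    refine Finset.sum_congr rfl fun v _ => ?_
    split_ifs with h
    · exact h1 _ _ h.1.symm
    · simp
  rw [hrow]
  set S := ∑ v ∈ Finset.range n,
    if x ≠ v ∧ col x = col v ∧ col v ≠ 0 ∧ lvl x = lvl v then ω' d x v else 0
  have e : P + ((d - 1 : ℕ) : ℝ≥0∞) * (P + 2 * S) = d * P + ((d - 1 : ℕ) : ℝ≥0∞) * (2 * S) := by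
    have : (d : ℝ≥0∞) = 1 + ((d - 1 : ℕ) : ℝ≥0∞) := by
      exact_mod_cast (by omega : d = 1 + (d - 1))
    rw [this]
    ring
  rw [e, ENNReal.add_div, mul_comm (d : ℝ≥0∞), ENNReal.mul_div_cancel_right hd0 (by simp), decay,
    ENNReal.mul_div_right_comm]
  refine add_le_add le_rfl (le_of_eq ?_)
  rw [mul_left_comm]

/-- A random color among the colors in `C`: each color of another vertex is hit with probability
`1 / |C|`. -/
lemma matchPot_recolor {n : ℕ} (lvl col : ℕ → ℕ) {ω : ℕ → ℕ → ℕ → ℝ≥0∞}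
    (hω : ∀ d u v, ω d u v = ω d v u) {x : ℕ} (hx : x < n) (C : Finset ℕ)
    (hcol : col x = 0) (hC : 4 * scale n (lvl x) ≤ C.card)
    (hsum : ∑ v ∈ Finset.range n, ω (scale n (lvl x)) x v ≤ (scale n (lvl x) : ℝ≥0∞) ^ 2) :
    2 * ((∑ c ∈ C, matchPot n lvl (upd col x c) ω) / C.card) ≤
      2 * matchPot n lvl col ω + scale n (lvl x) := by
  set d := scale n (lvl x) with hd
  have hdpos : 0 < d := scale_pos _ _
  have hC0 : (C.card : ℝ≥0∞) ≠ 0 := by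
    have : C.card ≠ 0 := by omega
    exact_mod_cast this
  have hupd : ∀ c, upd (upd col x c) x 0 = col := by
    intro c
    funext v
    by_cases hv : v = x <;> simp [upd, hv, hcol]
  have hbound : ∑ c ∈ C, matchPot n lvl (upd col x c) ω ≤
      C.card * matchPot n lvl col ω + 2 * (d : ℝ≥0∞) ^ 2 := by
    simp only [matchPot_eq lvl (upd col x _) hω hx, hupd, Finset.sum_add_distrib, Finset.sum_const,
      nsmul_eq_mul]
    rw [← Finset.mul_sum, Finset.sum_comm]
    gcongr
    refine le_trans (Finset.sum_le_sum fun v _ => ?_) hsum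
    by_cases hv : x = v
    · simp [hv]
    · refine (Finset.sum_le_sum (g := fun c => if c = col v then ω d x v else 0)
        fun c _ => ?_).trans ?_
      · simp only [upd, if_true, Ne.symm hv, if_false]
        split_ifs with h h' <;> first | exact le_rfl | simp
        exact absurd h.2.1 h'
      · rw [Finset.sum_ite_eq']
        split_ifs <;> simp
  have hC4 : 4 * (d : ℝ≥0∞) ≤ C.card := by exact_mod_cast hC
  calc 2 * ((∑ c ∈ C, matchPot n lvl (upd col x c) ω) / C.card)
      ≤ 2 * ((C.card * matchPot n lvl col ω + 2 * (d : ℝ≥0∞) ^ 2) / C.card) := by gcongr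
    _ = 2 * matchPot n lvl col ω + d * (4 * d) / C.card := by
        rw [ENNReal.add_div, mul_comm (C.card : ℝ≥0∞), ENNReal.mul_div_cancel_right hC0 (by simp),
          mul_add, ← mul_div_assoc]
        congr 2
        ring
    _ ≤ _ := by
        gcongr
        rw [mul_div_assoc]
        exact (mul_le_mul_right (ENNReal.div_le_of_le_mul (by rwa [one_mul])) _).trans_eq (mul_one _)

/-- The weight of a pair of vertices of degree scale `d`, if `t v` coins of `v` are outstanding. -/
noncomputable def pairWeight {n : ℕ} (t : ℕ → ℕ) (r : List (EdgeUpdate n)) (d u v : ℕ) : ℝ≥0∞ :=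
  d * (decay d ^ (t u + t v) * weight d r u v)

lemma pairWeight_symm {n : ℕ} (t : ℕ → ℕ) (r : List (EdgeUpdate n)) (d u v : ℕ) :
    pairWeight t r d u v = pairWeight t r d v u := by
  rw [pairWeight, weight_symm, add_comm (t u), pairWeight]

lemma sum_pairWeight_le {n : ℕ} (t : ℕ → ℕ) (r : List (EdgeUpdate n)) {d : ℕ} (hd : 0 < d)
    (x : ℕ) : ∑ v ∈ Finset.range n, pairWeight t r d x v ≤ (d : ℝ≥0∞) ^ 2 := by
  unfold pairWeight
  rw [← Finset.mul_sum, sq]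
  gcongr
  refine le_trans (Finset.sum_le_sum fun v _ => ?_) (sum_weight_le hd r x)
  rw [weight_symm d r v x]
  exact (mul_le_mul_left (pow_le_one' (decay_le_one d) _) _).trans_eq (one_mul _)

lemma pairWeight_cons {n : ℕ} (e : EdgeUpdate n) (r : List (EdgeUpdate n)) (d u v : ℕ) :
    pairWeight 0 (e :: r) d u v = d * (hits e u v : ℝ≥0∞) + pairWeight (touch e) r d u v := by
  simp only [pairWeight, weight, Pi.zero_apply, add_zero, pow_zero, one_mul]
  ring

/-- The arrival of an update. -/
lemma matchPot_cons_ge {n : ℕ} (lvl col : ℕ → ℕ) (e : EdgeUpdate n) (r : List (EdgeUpdate n)) :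
    matchPot n lvl col (pairWeight (touch e) r) ≤ matchPot n lvl col (pairWeight 0 (e :: r)) := by
  rw [funext fun d => funext fun u => funext fun v => pairWeight_cons e r d u v, matchPot_add]
  exact le_add_self

/-- The insertion of an edge whose endpoints have the same color frees potential. -/
lemma matchPot_cons_conflict {n : ℕ} (lvl col : ℕ → ℕ) (e : EdgeUpdate n)
    (r : List (EdgeUpdate n)) (he : e.isInsert = true) (huv : e.u ≠ e.v)
    (hc : col e.u = col e.v) (hc0 : col e.v ≠ 0) (hl : lvl e.u = lvl e.v) :
    (scale n (lvl e.u) + scale n (lvl e.v) : ℕ) + matchPot n lvl col (pairWeight (touch e) r) ≤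
      matchPot n lvl col (pairWeight 0 (e :: r)) := by
  rw [funext fun d => funext fun u => funext fun v => pairWeight_cons e r d u v, matchPot_add]
  gcongr
  unfold matchPot
  have huv' : (e.u : ℕ) ≠ e.v := fun h => huv (Fin.ext h)
  have hmem : ({((e.u : ℕ), (e.v : ℕ)), ((e.v : ℕ), (e.u : ℕ))} : Finset (ℕ × ℕ)) ⊆
      Finset.range n ×ˢ Finset.range n := by
    intro p hp
    simp only [Finset.mem_insert, Finset.mem_singleton] at hp
    rcases hp with rfl | rfl <;> simp
  rw [← Finset.sum_product']
  refine le_trans (le_of_eq ?_) (Finset.sum_le_sum_of_subset hmem)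
  rw [Finset.sum_pair (by simp [huv'])]
  simp only [hits, he, hc, hc0, hl, huv', huv'.symm, ne_eq, not_false_iff, and_self,
    if_true, true_or, or_true, Nat.cast_one, mul_one]
  push_cast
  rfl

/-- The coin of a vertex, in terms of the weights of the pairs. -/
lemma matchPot_pairWeight_coin {n : ℕ} (lvl col t : ℕ → ℕ) (r : List (EdgeUpdate n)) {x : ℕ}
    (hx : x < n) (ht : t x = 1) :
    (matchPot n lvl (upd col x 0) (pairWeight (upd t x 0) r) +
      ((scale n (lvl x) - 1 : ℕ) : ℝ≥0∞) * matchPot n lvl col (pairWeight (upd t x 0) r)) /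
        scale n (lvl x) ≤ matchPot n lvl col (pairWeight t r) := by
  refine matchPot_coin lvl col (pairWeight_symm t r) (pairWeight_symm _ r) hx (fun d v hv => ?_)
    fun d u v hu hv => ?_
  · simp only [pairWeight, upd, if_true, hv, if_false, ht, zero_add, add_comm 1, pow_succ]
    ring
  · simp only [pairWeight, upd, hu, hv, if_false]

lemma matchPot_start_le {n : ℕ} {lvl : ℕ → ℕ} (hlvl : ∀ v < n, lvl v = 0) (col : ℕ → ℕ)
    (r : List (EdgeUpdate n)) : matchPot n lvl col (pairWeight 0 r) ≤ (2 * r.length : ℕ) := by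
  refine le_trans (Finset.sum_le_sum fun u _ => Finset.sum_le_sum fun v hv => ?_)
    (sum_sum_weight_le 1 r)
  rw [hlvl v (Finset.mem_range.1 hv)]
  split_ifs
  · simp [pairWeight, scale]
  · exact zero_le

/-! ### Levels and arboricity -/

lemma isAcyclic_edge {V : Type*} (u v : V) : (SimpleGraph.edge u v).IsAcyclic := by
  have h := (SimpleGraph.isAcyclic_sup_fromEdgeSet_iff (G := ⊥) (u := u) (v := v)).2
    ⟨SimpleGraph.isAcyclic_bot, fun h => Or.inl (by simpa using h)⟩
  rwa [bot_sup_eq] at h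

/-- The edges of a finite graph can be partitioned into as many forests as its arboricity. -/
lemma exists_forests {V : Type*} [Finite V] (G : SimpleGraph V) :
    ∃ F : Fin G.arboricity → SimpleGraph V, (∀ j, (F j).IsAcyclic) ∧
      (∀ i j, i ≠ j → Disjoint (F i) (F j)) ∧ (⨆ j, F j) = G := by
  refine Nat.sInf_mem (s := {k : ℕ | ∃ F : Fin k → SimpleGraph V, (∀ j, (F j).IsAcyclic) ∧
    (∀ i j, i ≠ j → Disjoint (F i) (F j)) ∧ (⨆ j, F j) = G}) ?_
  obtain ⟨k, ⟨e⟩⟩ := Finite.exists_equiv_fin G.edgeSet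
  refine ⟨k, fun j => SimpleGraph.fromEdgeSet {(e.symm j : Sym2 V)}, fun j => ?_, fun i j hij => ?_,
    ?_⟩
  · dsimp only
    generalize (e.symm j : Sym2 V) = x
    induction x with
    | _ a b => exact isAcyclic_edge a b
  · rw [SimpleGraph.disjoint_left]
    intro a b h1 h2
    simp only [SimpleGraph.fromEdgeSet_adj, Set.mem_singleton_iff] at h1 h2
    exact hij (e.symm.injective (Subtype.ext (h1.1.symm.trans h2.1)))
  · ext a b
    simp only [SimpleGraph.iSup_adj, SimpleGraph.fromEdgeSet_adj, Set.mem_singleton_iff]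
    constructor
    · rintro ⟨j, h, -⟩
      have := (e.symm j).2
      rwa [← h] at this
    · intro h
      exact ⟨e ⟨s(a, b), h⟩, by simp, h.ne⟩

lemma sum_degrees_le_of_isAcyclic {V : Type*} [Fintype V] (F : SimpleGraph V)
    [DecidableRel F.Adj] (hF : F.IsAcyclic) : ∑ v, F.degree v ≤ 2 * Fintype.card V := by
  classical
  rcases isEmpty_or_nonempty V with h | h
  · simp
  obtain ⟨T, hFT, -, hT⟩ :=
    SimpleGraph.connected_top.exists_isTree_le_of_le_of_isAcyclic (le_top : F ≤ ⊤) hF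
  rw [F.sum_degrees_eq_twice_card_edges]
  have h1 := hT.card_edgeFinset
  have h2 : F.edgeFinset.card ≤ T.edgeFinset.card :=
    Finset.card_le_card (SimpleGraph.edgeFinset_mono hFT)
  omega

open scoped Classical in
/-- A set `Z` of vertices spans at most `α |Z|` edges in a graph of arboricity `α`. -/
lemma sum_card_adj_le {V : Type*} [Fintype V] (G : SimpleGraph V) (Z : Finset V) :
    ∑ v ∈ Z, (Z.filter (G.Adj v)).card ≤ 2 * G.arboricity * Z.card := by
  obtain ⟨F, hF, -, hG⟩ := exists_forests G
  have h1 : ∀ j, ∑ v ∈ Z, (Z.filter ((F j).Adj v)).card ≤ 2 * Z.card := by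
    intro j
    have h2 := sum_degrees_le_of_isAcyclic ((F j).induce (Z : Set V)) ((hF j).induce _)
    rw [show Fintype.card ((Z : Set V) : Type _) = Z.card by simp] at h2
    refine le_trans (le_of_eq ?_) h2
    rw [← Finset.sum_coe_sort]
    refine Finset.sum_congr rfl fun v _ => ?_
    rw [← SimpleGraph.card_neighborFinset_eq_degree]
    refine Finset.card_bij' (fun w hw => ⟨w, (Finset.mem_filter.1 hw).1⟩) (fun w _ => (w : V))
      ?_ ?_ ?_ ?_
    · intro w hw
      simpa using (Finset.mem_filter.1 hw).2
    · intro w hw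
      simp only [SimpleGraph.mem_neighborFinset, SimpleGraph.comap_adj] at hw
      exact Finset.mem_filter.2 ⟨w.2, hw⟩
    · intros; rfl
    · intros; rfl
  calc ∑ v ∈ Z, (Z.filter (G.Adj v)).card
      ≤ ∑ v ∈ Z, ∑ j, (Z.filter ((F j).Adj v)).card := by
        refine Finset.sum_le_sum fun v _ => ?_
        refine le_trans (Finset.card_le_card ?_) Finset.card_biUnion_le
        intro w hw
        rw [Finset.mem_filter, ← hG, SimpleGraph.iSup_adj] at hw
        obtain ⟨hw, j, hj⟩ := hw
        exact Finset.mem_biUnion.2 ⟨j, Finset.mem_univ _, Finset.mem_filter.2 ⟨hw, hj⟩⟩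
    _ = ∑ j, ∑ v ∈ Z, (Z.filter ((F j).Adj v)).card := Finset.sum_comm
    _ ≤ ∑ j : Fin G.arboricity, 2 * Z.card := Finset.sum_le_sum fun j _ => h1 j
    _ = _ := by simp; ring

section

variable {n : ℕ} {E : ℕ → ℕ → Bool} {lvl : ℕ → ℕ} {G : SimpleGraph (Fin n)}

/-- If the degree scale is at least the arboricity, at most half of the vertices on a level or
above are above this level. -/
lemma two_mul_card_le (hE : IsGraph n E) (hG : ∀ u v : Fin n, G.Adj u v ↔ E u v = true)
    (hset : ∀ v < n, Settled n E lvl v) {l : ℕ} (hl : G.arboricity ≤ scale n l) :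
    2 * (Finset.univ.filter fun v : Fin n => l + 1 ≤ lvl v).card ≤
      (Finset.univ.filter fun v : Fin n => l ≤ lvl v).card := by
  classical
  set Z := Finset.univ.filter fun v : Fin n => l ≤ lvl v with hZ
  set Y := Finset.univ.filter fun v : Fin n => l + 1 ≤ lvl v with hY
  have hsub : Y ⊆ Z := fun v => by
    simp only [hZ, hY, Finset.mem_filter, Finset.mem_univ, true_and]; omega
  have h1 : ∀ v ∈ Y, 4 * scale n l ≤ (Z.filter (G.Adj v)).card := by
    intro v hv
    simp only [hY, Finset.mem_filter, Finset.mem_univ, true_and] at hv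
    have h2 := (hset v v.2).2 (by omega)
    have h3 := scale_mono n (by omega : l ≤ lvl v - 1)
    have h4 := Finset.card_le_card (upNbrs_anti n E lvl v (by omega : l ≤ lvl v - 1))
    have h5 : (upNbrs n E lvl v l).card ≤ (Z.filter (G.Adj v)).card := by
      rw [← Finset.card_map Fin.valEmbedding (s := Z.filter (G.Adj v))]
      refine Finset.card_le_card fun w hw => ?_
      rw [mem_upNbrs hE] at hw
      have hwn := (hE.lt _ _ hw.1).2
      rw [Finset.mem_map]
      exact ⟨⟨w, hwn⟩, by simp [hZ, hG, hw], rfl⟩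
    omega
  have h6 := sum_card_adj_le G Z
  have h7 : Y.card * (4 * scale n l) ≤ 2 * G.arboricity * Z.card :=
    ((Finset.card_nsmul_le_sum _ _ _ h1).trans (Finset.sum_le_sum_of_subset hsub)).trans h6
  have h8 : 2 * G.arboricity * Z.card ≤ 2 * scale n l * Z.card := by gcongr
  have h9 := scale_pos n l
  by_contra! hlt
  have h10 : 2 * scale n l * Z.card < 2 * scale n l * (2 * Y.card) := by gcongr
  nlinarith

lemma card_mul_pow_le (hE : IsGraph n E) (hG : ∀ u v : Fin n, G.Adj u v ↔ E u v = true)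
    (hset : ∀ v < n, Settled n E lvl v) {l : ℕ} (hl : G.arboricity ≤ scale n l) (k : ℕ) :
    2 ^ k * (Finset.univ.filter fun v : Fin n => l + k ≤ lvl v).card ≤ n := by
  induction k with
  | zero =>
    rw [pow_zero, one_mul]
    exact (Finset.card_filter_le _ _).trans (by simp)
  | succ k ih =>
    have h := two_mul_card_le hE hG hset (l := l + k) (hl.trans (scale_mono n (by omega)))
    calc _ = 2 ^ k * (2 * (Finset.univ.filter fun v : Fin n => l + k + 1 ≤ lvl v).card) := by
          rw [pow_succ]; ring_nf
      _ ≤ 2 ^ k * (Finset.univ.filter fun v : Fin n => l + k ≤ lvl v).card := by gcongr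
      _ ≤ n := ih

/-- The levels of settled vertices stay within the groups of levels whose degree scales are at most
twice the arboricity. -/
lemma lvl_lt_of_settled (hE : IsGraph n E)
    (hG : ∀ u v : Fin n, G.Adj u v ↔ E u v = true) (hset : ∀ v < n, Settled n E lvl v) {v : ℕ}
    (hv : v < n) : lvl v + 1 < (Nat.clog 2 (max G.arboricity 1) + 1) * grp n := by
  set g := Nat.clog 2 (max G.arboricity 1) with hg
  have hgrp : 0 < grp n := Nat.succ_pos _
  have hscale : G.arboricity ≤ scale n (g * grp n) := by
    rw [scale, Nat.mul_div_cancel _ hgrp]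
    exact (le_max_left _ 1).trans (Nat.le_pow_clog (by omega) _)
  have h1 := card_mul_pow_le hE hG hset hscale (lg n + 1)
  have h2 := le_pw n
  have h3 : (Finset.univ.filter fun v : Fin n => g * grp n + (lg n + 1) ≤ lvl v).card = 0 := by
    by_contra h0
    have h4 : 2 ^ (lg n + 1) * 1 ≤ 2 ^ (lg n + 1) *
        (Finset.univ.filter fun v : Fin n => g * grp n + (lg n + 1) ≤ lvl v).card := by
      gcongr
      omega
    have h5 : 2 ^ (lg n + 1) = 2 * pw n := by rw [pow_succ, mul_comm]
    have := Nat.two_pow_pos (lg n)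
    omega
  rw [Finset.card_eq_zero, Finset.filter_eq_empty_iff] at h3
  have h4 := h3 (Finset.mem_univ (⟨v, hv⟩ : Fin n))
  simp only at h4
  rw [add_mul]
  unfold grp at h4 ⊢
  omega

end

lemma sum_scale_groups (n g : ℕ) :
    ∑ j ∈ Finset.range (g * grp n), scale n j + grp n = grp n * 2 ^ g := by
  induction g with
  | zero => simp
  | succ g ih =>
    have hgrp : 0 < grp n := Nat.succ_pos _
    have h : ∑ x ∈ Finset.range (grp n), scale n (g * grp n + x) = grp n * 2 ^ g := by
      rw [Finset.sum_congr rfl (g := fun _ => 2 ^ g)]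
      · simp
      · intro x hx
        rw [Finset.mem_range] at hx
        rw [scale, mul_comm, Nat.mul_add_div hgrp, Nat.div_eq_of_lt hx, add_zero]
    rw [add_mul, one_mul, Finset.sum_range_add, pow_succ, ← mul_assoc, ← ih]
    rw [← ih] at h
    omega

lemma one_le_logb {n : ℕ} (hn : 2 ≤ n) : 1 ≤ Real.logb 2 n := by
  rw [Real.le_logb_iff_rpow_le (by norm_num) (by positivity)]
  norm_num
  exact_mod_cast hn

lemma lg_le_logb {n : ℕ} (hn : 2 ≤ n) : (lg n : ℝ) ≤ Real.logb 2 n + 1 := by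
  have h4 : 2 ^ (lg n - 1) < n := Nat.pow_pred_clog_lt_self (by omega) (by omega)
  have h5 : ((lg n - 1 : ℕ) : ℝ) ≤ Real.logb 2 n := by
    rw [Real.le_logb_iff_rpow_le (by norm_num) (by positivity), Real.rpow_natCast]
    exact_mod_cast h4.le
  have h6 : (lg n : ℝ) ≤ ((lg n - 1 : ℕ) : ℝ) + 1 := by exact_mod_cast (by omega)
  linarith

/-- The number of colors is `O(α log n)`. -/
lemma base_groups_le {n a : ℕ} (hn : 2 ≤ n) (ha : 1 ≤ a) :
    (base n ((Nat.clog 2 a + 1) * grp n) : ℝ) ≤ 256 * a * Real.logb 2 n := by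
  have h1 := sum_scale_groups n (Nat.clog 2 a + 1)
  have h2 : 2 ^ Nat.clog 2 a ≤ 2 * a := by
    rcases Nat.lt_or_ge 1 a with h | h
    · have h4 : 2 ^ (Nat.clog 2 a - 1) < a := Nat.pow_pred_clog_lt_self (by omega) h
      have h3 : Nat.clog 2 a = Nat.clog 2 a - 1 + 1 := by
        have := Nat.clog_pos (b := 2) (by omega) h
        omega
      rw [h3, pow_succ]
      omega
    · have : a = 1 := by omega
      subst this; simp
  have hlog1 := one_le_logb hn
  have hlg := lg_le_logb hn
  have h7 : base n ((Nat.clog 2 a + 1) * grp n) ≤ 64 * (lg n + 2) * a := by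
    have h8 : grp n * 2 ^ (Nat.clog 2 a + 1) ≤ grp n * (2 * a * 2) := by rw [pow_succ]; gcongr
    unfold base
    have h9 : 1 ≤ grp n := Nat.succ_pos _
    have : grp n * (2 * a * 2) = 4 * ((lg n + 2) * a) := by unfold grp; ring
    have : 64 * (lg n + 2) * a = 64 * ((lg n + 2) * a) := by ring
    omega
  calc (base n ((Nat.clog 2 a + 1) * grp n) : ℝ) ≤ 64 * (lg n + 2) * a := by exact_mod_cast h7
    _ ≤ 64 * (4 * Real.logb 2 n) * a := by gcongr; linarith
    _ = _ := by ring

/-! ### Processing the stack -/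

lemma Good.congr {K : Machine} {n : ℕ} {E : ℕ → ℕ → Bool} {s s' : St} (h : Good K n E s)
    (h3 : s'.r 3 = s.r 3) (hm : ∀ k < 7, s'.m k = s.m k) : Good K n E s' := by
  have e : s'.lvl = s.lvl := by simp [St.lvl, hm]
  have e' : s'.col = s.col := by simp [St.col, hm]
  refine ⟨h3.trans h.r3, ?_, ?_, ?_, ?_, ?_, ?_⟩
  · simpa [hm] using h.scale
  · simpa [hm] using h.base
  · rw [e]; exact h.lvl_le
  · rw [e]; simpa [Lists, hm] using h.lists
  · rw [e, e']; exact h.palette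
  · rw [e']; exact h.proper

/-- A recoloring with a free color keeps the data structure in order. -/
lemma Good.recolor {K : Machine} {n : ℕ} {E : ℕ → ℕ → Bool} {s s' : St} (hE : IsGraph n E)
    (h : Good K n E s) {x c : ℕ} (hc : c ∈ freeColors n E s x)
    (hf : Frame {8, 14, 15, 17, 18} {0, 8, 9} s s') (hcol : s'.col = upd s.col x c) :
    Good K n E s' := by
  have hm : ∀ k, k ≠ 0 → k < 7 → s'.m k = s.m k := fun k h0 h7 => hf.2 k (by
    simp only [Finset.mem_insert, Finset.mem_singleton]; omega)
  have e : s'.lvl = s.lvl := by simp [St.lvl, hm]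
  rw [freeColors, Finset.mem_filter, Finset.mem_Ico] at hc
  obtain ⟨⟨hc1, hc2⟩, hc3⟩ := hc
  have hc0 : c ≠ 0 := by have := base_pos n (s.lvl x); omega
  -- the neighbors below have colors of other palettes
  have hfree : ∀ w, E x w = true → s.col w ≠ c := by
    intro w hw hwc
    by_cases hl : s.lvl x ≤ s.lvl w
    · exact hc3 w ((mem_upNbrs hE).2 ⟨hw, hl⟩) hwc
    · have hp := h.palette w (hE.lt _ _ hw).2 (by omega)
      have := base_mono n (by omega : s.lvl w + 1 ≤ s.lvl x)
      omega
  refine ⟨(hf.1 3 (by simp)).trans h.r3, ?_, ?_, ?_, ?_, ?_, ?_⟩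
  · simpa [hm] using h.scale
  · simpa [hm] using h.base
  · rw [e]; exact h.lvl_le
  · rw [e]; simpa [Lists, hm] using h.lists
  · rw [e, hcol]
    intro v hv hv0
    simp only [upd] at hv0 ⊢
    split_ifs with hvx
    · rw [hvx]; exact ⟨hc1, hc2⟩
    · rw [if_neg hvx] at hv0; exact h.palette v hv hv0
  · rw [hcol]
    intro u hu v hv huv hu0
    simp only [upd] at hu0 ⊢
    by_cases hux : u = x
    · have hvx : v ≠ x := by rintro rfl; rw [hux, hE.irrefl] at huv; cases huv
      rw [if_pos hux, if_neg hvx]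
      exact (hfree v (hux ▸ huv)).symm
    · rw [if_neg hux] at hu0 ⊢
      by_cases hvx : v = x
      · rw [if_pos hvx]
        rw [hvx, hE.symm] at huv
        exact hfree u huv
      · rw [if_neg hvx]
        exact h.proper u hu v hv huv hu0

/-- The total degree scale of the vertices that have to be recolored. -/
def zeroPot (n : ℕ) (lvl col : ℕ → ℕ) : ℕ :=
  ∑ v ∈ Finset.range n, if col v = 0 then scale n (lvl v) else 0

lemma zeroPot_discard (n : ℕ) (lvl col : ℕ → ℕ) (x l : ℕ) :
    zeroPot n (upd lvl x l) (upd col x 0) ≤ zeroPot n lvl col + scale n l := by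
  have h : zeroPot n (upd lvl x l) (upd col x 0) ≤ ∑ v ∈ Finset.range n,
      ((if col v = 0 then scale n (lvl v) else 0) + if v = x then scale n l else 0) := by
    refine Finset.sum_le_sum fun v _ => ?_
    by_cases hv : v = x
    · simp [upd, hv]
    · simp [upd, hv]
  refine h.trans ?_
  rw [Finset.sum_add_distrib, Finset.sum_ite_eq', zeroPot]
  split_ifs <;> omega

lemma zeroPot_discard' (n : ℕ) (lvl col : ℕ → ℕ) (x : ℕ) :
    zeroPot n lvl (upd col x 0) ≤ zeroPot n lvl col + scale n (lvl x) := by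
  have := zeroPot_discard n lvl col x (lvl x)
  rwa [upd_same] at this

lemma zeroPot_recolor {n : ℕ} (lvl : ℕ → ℕ) {col : ℕ → ℕ} {x c : ℕ} (hx : x < n) (h : col x = 0)
    (hc : c ≠ 0) : zeroPot n lvl (upd col x c) + scale n (lvl x) = zeroPot n lvl col := by
  have hmem : x ∈ Finset.range n := Finset.mem_range.2 hx
  rw [zeroPot, zeroPot, ← Finset.sum_erase_add _ _ hmem, ← Finset.sum_erase_add (Finset.range n)
    (fun v => if col v = 0 then scale n (lvl v) else 0) hmem, upd_self_eq, if_neg hc, if_pos h,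
    add_zero]
  congr 1
  refine Finset.sum_congr rfl fun v hv => ?_
  simp only [upd, Finset.ne_of_mem_erase hv, if_false]

/-- The state while the stack is processed: every vertex that violates its degree conditions or has
no color is on the stack. -/
structure Pending (K : Machine) (n : ℕ) (E : ℕ → ℕ → Bool) (s : St) : Prop where
  good : Good K n E s
  stk_lt : ∀ i < s.r 4, s.stk i < n
  pending : ∀ v < n, ¬ Settled n E s.lvl v ∨ s.col v = 0 → ∃ i < s.r 4, s.stk i = v

lemma settled_upd {n : ℕ} {E : ℕ → ℕ → Bool} (hE : IsGraph n E) {lvl : ℕ → ℕ} {x l' v : ℕ}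
    (hl : lvl x ≤ l' + 1) (hv : v ≠ x) (h : E v x = true → lvl v < lvl x) :
    Settled n E (upd lvl x l') v ↔ Settled n E lvl v := by
  have e : upd lvl x l' v = lvl v := if_neg hv
  unfold Settled
  rw [e, upNbrs_upd_eq hE v fun hh => by have := h hh; omega,
    upNbrs_upd_eq hE v fun hh => by have := h hh; omega]

lemma Pending.move {K : Machine} {n : ℕ} {E : ℕ → ℕ → Bool} (hE : IsGraph n E) {s s₁ s₂ : St}
    (h : Pending K n E s) {x l' : ℕ} (h4 : 0 < s.r 4) (hx : s.stk (s.r 4 - 1) = x)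
    (hf : Frame {5, 6, 7, 19} ∅ s s₁) (hl : s.lvl x ≤ l' + 1) (hm : Moved K n E x l' s₁ s₂) :
    Pending K n E s₂ := by
  have r4 : s₁.r 4 = s.r 4 := hf.1 4 (by simp)
  have hmem : s₁.m = s.m := funext fun k => hf.2 k (by simp)
  have e1 : s₁.lvl = s.lvl := by simp [St.lvl, hmem]
  have e2 : s₁.col = s.col := by simp [St.col, hmem]
  have e3 : s₁.stk = s.stk := by simp [St.stk, hmem]
  have hsp := hm.sp
  have hlow := hm.low
  rw [r4] at hsp hlow
  rw [e3] at hlow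
  refine ⟨hm.good, fun i hi => ?_, fun v hv hv' => ?_⟩
  · by_cases hi' : i < s.r 4
    · rw [hlow i hi']; exact h.stk_lt i hi'
    · exact hm.high i hi (by omega)
  · by_cases hvx : v = x
    · exact ⟨s.r 4 - 1, by omega, by rw [hlow _ (by omega), hx, hvx]⟩
    · by_cases hp : E v x = true ∧ s.lvl x ≤ s.lvl v
      · exact hm.pushed v (by rw [hE.symm]; exact hp.1) (by rw [e1]; exact hp.2)
      · obtain ⟨i, hi, hi'⟩ := h.pending v hv (by
          rw [hm.lvl, hm.col, e1, e2, settled_upd hE hl hvx fun hh => by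
            by_contra hlt; exact hp ⟨hh, by omega⟩] at hv'
          simpa [upd, hvx] using hv')
        exact ⟨i, by omega, by rw [hlow i hi, hi']⟩

/-- The stack loop pays for itself from the potentials. A move of a vertex with `D` neighbors to
be treated takes time `1000 * D`, pushes `D` entries worth `2000` each, and adds at most the new
degree scale to `zeroPot`; the level potential pays for all of this. A recoloring on degree scale
`d` takes time `4000 * d` and raises `matchPot` by `d / 2` on average, which is worth `5000 * d`;
the decrease of `zeroPot` by `d` pays for both. The sum of the level potential and the height of
the stack decreases in each round, so that the loop terminates. -/
lemma wp_settleAll {K : Machine} {n : ℕ} (hK : Fits K n) (hτ : K.τ = 1) {E : ℕ → ℕ → Bool}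
    (hE : IsGraph n E) (r : List (EdgeUpdate n)) (f : St → ℝ≥0∞) (b : ℝ≥0∞)
    (hf : ∀ s, Pending K n E s → s.r 4 = 0 →
      f s ≤ (3000 * levelPot n E s.lvl : ℕ) + 10000 * matchPot n s.lvl s.col (pairWeight 0 r) + b)
    (N : ℕ) (hN : N < K.M) (s : St) (hs : Pending K n E s)
    (hsN : levelPot n E s.lvl + s.r 4 ≤ N) :
    K.wp settleAll f s ≤
      (3000 * levelPot n E s.lvl + 2000 * s.r 4 + 10000 * zeroPot n s.lvl s.col : ℕ) +
        10000 * matchPot n s.lvl s.col (pairWeight 0 r) + (b + 5) := by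
  induction N using Nat.strong_induction_on generalizing s with
  | _ N ih =>
  have hG := hs.good
  have hW := hK.word
  have hlarge := hK.large
  unfold settleAll
  refine (wp_loop _ ?_ ?_).trans ?_
  · simp [Ex.Ok]; omega
  · simp [Ex.Ok]
  have hlen : (Ex.len z + (Ex.var 4).len + 2 : ℕ) = 5 := by simp [Ex.len]
  rw [hlen, hτ, one_mul]
  split_ifs with h4
  swap
  · have h4' : s.r 4 = 0 := by simpa [Ex.eval] using h4
    calc ((5 : ℕ) : ℝ≥0∞) + f s ≤ (5 : ℕ) + ((3000 * levelPot n E s.lvl : ℕ) +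
          10000 * matchPot n s.lvl s.col (pairWeight 0 r) + b) := by
          gcongr
          exact hf s hs h4'
      _ = (3000 * levelPot n E s.lvl : ℕ) +
          10000 * matchPot n s.lvl s.col (pairWeight 0 r) + (b + 5) := by push_cast; ring
      _ ≤ _ := by gcongr; omega
  have h4' : 0 < s.r 4 := by simpa [Ex.eval] using h4
  obtain ⟨x, hx⟩ : ∃ x, s.stk (s.r 4 - 1) = x := ⟨_, rfl⟩
  have hxn : x < n := hx ▸ hs.stk_lt _ (by omega)
  set L := levelPot n E s.lvl with hL
  set Z := zeroPot n s.lvl s.col with hZ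
  set Mp := matchPot n s.lvl s.col (pairWeight 0 r) with hMp
  set sp := s.r 4 with hsp
  set g : St → ℝ≥0∞ := fun s' => 1 + K.wp (.loop z (.var 4) processTop) f s' with hg
  have hT := top_lt n
  have hlx := hG.lvl_le x hxn
  have hins : inspect.len ≤ 600 := by decide
  suffices h : K.wp processTop g s ≤ (3000 * L + 2000 * sp + 10000 * Z : ℕ) + 10000 * Mp + b by
    calc ((5 : ℕ) : ℝ≥0∞) + K.wp processTop g s ≤ (5 : ℕ) +
          ((3000 * L + 2000 * sp + 10000 * Z : ℕ) + 10000 * Mp + b) := by gcongr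
      _ = _ := by push_cast; ring
  unfold processTop
  refine (wp_seq _ _ _ _).trans ?_
  have hdpos := scale_pos n (s.lvl x)
  refine (tri_inspect hK hG h4' (by omega) hx hxn _
    ((3000 * L + 2000 * sp + 10000 * Z - 600 : ℕ) + 10000 * Mp + b) ?_).trans ?_
  swap
  · rw [hτ, one_mul]
    calc (inspect.len : ℝ≥0∞) + ((3000 * L + 2000 * sp + 10000 * Z - 600 : ℕ) + 10000 * Mp + b)
        = ((inspect.len + (3000 * L + 2000 * sp + 10000 * Z - 600) : ℕ) : ℝ≥0∞) +
          10000 * Mp + b := by push_cast; ring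
      _ ≤ _ := add_le_add (add_le_add (Nat.cast_le.2 (by omega)) le_rfl) le_rfl
  intro s₁ hi
  have r4 : s₁.r 4 = s.r 4 := hi.frame.1 4 (by simp)
  have r3 : s₁.r 3 = s.r 3 := hi.frame.1 3 (by simp)
  have hmem : s₁.m = s.m := funext fun k => hi.frame.2 k (by simp)
  have e1 : s₁.lvl = s.lvl := by simp [St.lvl, hmem]
  have e2 : s₁.col = s.col := by simp [St.col, hmem]
  have e3 : s₁.stk = s.stk := by simp [St.stk, hmem]
  have hG₁ : Good K n E s₁ := hG.congr r3 fun k _ => by rw [hmem]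
  refine (wp_ite _ ?_ ?_).trans ?_
  · simp [Ex.Ok]; omega
  · simp [Ex.Ok]
  have hlen : (Ex.len z + (Ex.var 19).len + 1 : ℕ) = 4 := by simp [Ex.len]
  rw [hlen, hτ, one_mul]
  split_ifs with h19
  · -- the vertex moves
    simp [Ex.eval] at h19
    obtain ⟨l', h7, hll, hl', hmove⟩ : ∃ l', s₁.r 7 = l' ∧ s.lvl x ≤ l' + 1 ∧ l' ≤ lg n * grp n ∧
        ((l' = s.lvl x + 1 ∧ 12 * scale n (s.lvl x) < (upNbrs n E s.lvl x (s.lvl x)).card) ∨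
      (l' + 1 = s.lvl x ∧ (upNbrs n E s.lvl x l').card < 4 * scale n l')) := by
      rcases hi.cases with ⟨-, h7, hD⟩ | ⟨-, h7, hD⟩ | ⟨h0, -⟩
      · refine ⟨_, h7, by omega, ?_, Or.inl ⟨rfl, hD⟩⟩
        -- a vertex on the top level cannot have too many neighbors
        by_contra hlt
        have hle : s.lvl x = lg n * grp n := by omega
        have hDn : (upNbrs n E s.lvl x (s.lvl x)).card ≤ n :=
          (Finset.card_filter_le _ _).trans (by simp)
        have hsc : scale n (s.lvl x) = pw n := by
          rw [hle, scale, Nat.mul_div_cancel _ (Nat.succ_pos _)]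
        have := le_pw n
        omega
      · exact ⟨_, rfl, by omega, by omega, Or.inr ⟨h7, hD⟩⟩
      · omega
    have hpot := levelPot_move hE hxn (by omega) hmove
    set D := (upNbrs n E s.lvl x (s.lvl x)).card with hD
    have hd'pos := scale_pos n l'
    have hD₁ : (upNbrs n E s₁.lvl x (s₁.lvl x)).card = D := by rw [e1]
    have htri := tri_move hK hE hG₁ hi.r5 hxn (by rw [hi.r6, e1]) h7 (by rw [e1]; exact hll) hl'
      (by rw [hD₁, r4]; omega) g ((3000 * L + 2000 * sp + 10000 * Z - 1000 * D - 1700 : ℕ) +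
        10000 * Mp + b) ?_
    · rw [hD₁, hτ, one_mul] at htri
      calc ((4 : ℕ) : ℝ≥0∞) + K.wp move g s₁ ≤ (4 : ℕ) + ((1000 * D + 1000 : ℕ) +
            ((3000 * L + 2000 * sp + 10000 * Z - 1000 * D - 1700 : ℕ) + 10000 * Mp + b)) := by
            gcongr
        _ = ((4 + (1000 * D + 1000 + (3000 * L + 2000 * sp + 10000 * Z - 1000 * D - 1700)) : ℕ) :
            ℝ≥0∞) + 10000 * Mp + b := by push_cast; ring
        _ ≤ _ := add_le_add (add_le_add (Nat.cast_le.2 (by omega)) le_rfl) le_rfl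
    · intro s₂ hm
      have hp₂ := hs.move hE h4' hx hi.frame hll hm
      have el : s₂.lvl = upd s.lvl x l' := by rw [hm.lvl, e1]
      have ec : s₂.col = upd s.col x 0 := by rw [hm.col, e2]
      have esp : s₂.r 4 = sp + D := by rw [hm.sp, r4, hD₁]
      have hih := ih (levelPot n E s₂.lvl + s₂.r 4) (by rw [el, esp]; omega)
        (by rw [el, esp]; omega) s₂ hp₂ le_rfl
      rw [el, ec, esp] at hih
      have hz := zeroPot_discard n s.lvl s.col x l'
      have hmp := matchPot_discard n s.lvl s.col (pairWeight 0 r) x l'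
      rw [← hMp] at hmp
      rw [hg]
      calc 1 + K.wp (.loop z (.var 4) processTop) f s₂ ≤ 1 + _ := add_le_add le_rfl hih
        _ ≤ 1 + ((3000 * levelPot n E (upd s.lvl x l') + 2000 * (sp + D) + 10000 *
            (Z + scale n l') : ℕ) + 10000 * Mp + (b + 5)) :=
          add_le_add le_rfl (add_le_add (add_le_add (Nat.cast_le.2 (by omega))
            (mul_le_mul_right hmp _)) le_rfl)
        _ = ((3000 * levelPot n E (upd s.lvl x l') + 2000 * (sp + D) + 10000 *
            (Z + scale n l') + 6 : ℕ) : ℝ≥0∞) + 10000 * Mp + b := by push_cast; ring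
        _ ≤ _ := add_le_add (add_le_add (Nat.cast_le.2 (by omega)) le_rfl) le_rfl
  · -- the vertex stays
    have h190 : s₁.r 19 = 0 := by simpa [Ex.eval] using h19
    have hset : Settled n E s.lvl x := by
      rcases hi.cases with ⟨h, -⟩ | ⟨h, -⟩ | ⟨-, h⟩
      · omega
      · omega
      · exact h
    refine (add_le_add le_rfl (wp_seq _ _ _ _)).trans ?_
    refine (add_le_add le_rfl (wp_asg _ ?_)).trans ?_
    · simp [Ex.Ok, Ex.eval]; omega
    have hlen' : ((Ex.sub (.var 4) (.lit 1)).len + 2 : ℕ) = 6 := by decide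
    have hev : (Ex.sub (.var 4) (.lit 1)).eval s₁ = sp - 1 := by simp [Ex.eval, r4, hsp]
    rw [hev, hlen', hτ, one_mul]
    set s₂ := s₁.set 4 (sp - 1) with hs₂
    have el : s₂.lvl = s.lvl := by rw [← e1]; rfl
    have ec : s₂.col = s.col := by rw [← e2]; rfl
    have ek : s₂.stk = s.stk := by rw [← e3]; rfl
    have e4 : s₂.r 4 = sp - 1 := by simp [hs₂]
    have e5 : s₂.r 5 = x := by simp [hs₂, hi.r5]
    have e6 : s₂.r 6 = s₂.lvl x := by rw [el]; simp [hs₂, hi.r6]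
    have e30 : s₂.r 3 = K.M := by simp [hs₂, r3, hG.r3]
    have hG₂ : Good K n E s₂ := hG₁.congr (by simp [hs₂]) fun k _ => rfl
    have hstk : ∀ v < n, v ≠ x → (¬ Settled n E s.lvl v ∨ s.col v = 0) →
        ∃ i < sp - 1, s.stk i = v := by
      intro v hv hvx hv'
      obtain ⟨i, hi, hi'⟩ := hs.pending v hv hv'
      refine ⟨i, ?_, hi'⟩
      by_contra hcon
      have : i = sp - 1 := by omega
      rw [this] at hi'
      exact hvx (hi'.symm.trans hx)
    have hscL : 0 < scale n (s.lvl x) := scale_pos _ _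
    -- the cost of the rest of the loop, once the vertex has its color
    have hrest : ∀ s₃ c, Good K n E s₃ → s₃.r 4 = sp - 1 → s₃.stk = s.stk → s₃.lvl = s.lvl →
        s₃.col = upd s.col x c → c ≠ 0 → K.wp (.loop z (.var 4) processTop) f s₃ ≤
        (3000 * L + 2000 * (sp - 1) + 10000 * zeroPot n s.lvl (upd s.col x c) : ℕ) +
          10000 * matchPot n s.lvl (upd s.col x c) (pairWeight 0 r) + (b + 5) := by
      intro s₃ c hG₃ h4₃ hk₃ hl₃ hc₃ hc0
      have := ih (L + (sp - 1)) (by omega) (by omega) s₃ ⟨hG₃, fun i hi => ?_, fun v hv hv' => ?_⟩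
        (by rw [hl₃, h4₃])
      · rwa [hl₃, h4₃, hc₃] at this
      · rw [hk₃]; exact hs.stk_lt i (by omega)
      · rw [hl₃, hc₃] at hv'
        rw [hk₃, h4₃]
        by_cases hvx : v = x
        · rw [hvx, upd_self_eq] at hv'
          exact absurd hset (hv'.resolve_right hc0)
        · exact hstk v hv hvx (by simpa [upd, hvx] using hv')
    suffices h : K.wp (.ite (colorE (.var 5)) (.lit 1) recolor .skip) (fun s' => 1 + g s') s₂ ≤
        (3000 * L + 2000 * sp + 10000 * Z - 700 : ℕ) + 10000 * Mp + b by
      calc ((4 : ℕ) : ℝ≥0∞) + (((6 : ℕ) : ℝ≥0∞) + K.wp (.ite (colorE (.var 5)) (.lit 1) recolor .skip)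
            (fun s' => 1 + g s') s₂) ≤ (4 : ℕ) + ((6 : ℕ) +
              ((3000 * L + 2000 * sp + 10000 * Z - 700 : ℕ) + 10000 * Mp + b)) := by gcongr
        _ = ((10 + (3000 * L + 2000 * sp + 10000 * Z - 700) : ℕ) : ℝ≥0∞) + 10000 * Mp + b := by
            push_cast; ring
        _ ≤ _ := add_le_add (add_le_add (Nat.cast_le.2 (by omega)) le_rfl) le_rfl
    refine (wp_ite _ ?_ ?_).trans ?_
    · simp [Ex.Ok, Ex.eval, e30, e5]; have := hK.lt; omega
    · simp [Ex.Ok]; omega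
    have hlen : ((colorE (.var 5)).len + (Ex.lit 1).len + 1 : ℕ) = 14 := by decide
    have hev : (colorE (.var 5)).eval s₂ = s.col x := by
      rw [← ec]; simp [Ex.eval, e5]
    rw [hlen, hτ, one_mul, hev]
    have hev1 : (Ex.lit 1).eval s₂ = 1 := rfl
    rw [hev1]
    split_ifs with hcol
    · -- the vertex is recolored
      have hcol0 : s.col x = 0 := by omega
      set d := scale n (s.lvl x) with hd
      have hdZ : ∀ c, c ≠ 0 → zeroPot n s.lvl (upd s.col x c) + d = Z :=
        fun c hc => zeroPot_recolor s.lvl hxn hcol0 hc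
      have hdZ' : d ≤ Z := by have := hdZ 1 one_ne_zero; omega
      have hfree : freeColors n E s₂ x = freeColors n E s x := by simp only [freeColors, el, ec]
      set C := freeColors n E s x with hC
      have hcard := card_freeColors hset.1
      rw [← hC, ← hd] at hcard
      have hwp := wp_recolor hK hE hG₂ hxn e5 e6 (by rw [el]; exact hset.1) (fun s' => 1 + g s')
        (fun c => ((3000 * L + 2000 * (sp - 1) + 10000 * (Z - d) + 7 : ℕ) + b) +
          10000 * matchPot n s.lvl (upd s.col x c) (pairWeight 0 r)) ?_
      · rw [hfree, el, ← hd, hτ, one_mul] at hwp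
        refine (add_le_add le_rfl hwp).trans ?_
        have hC0 : (C.card : ℝ≥0∞) ≠ 0 := by
          have : C.card ≠ 0 := by omega
          exact_mod_cast this
        rw [Finset.sum_add_distrib, Finset.sum_const, nsmul_eq_mul, ← Finset.mul_sum,
          ENNReal.add_div, ENNReal.mul_div_right_comm, ENNReal.div_self hC0 (by simp), one_mul,
          mul_div_assoc]
        have havg := matchPot_recolor s.lvl s.col (pairWeight_symm 0 r) hxn C hcol0 hcard
          (sum_pairWeight_le 0 r hdpos x)
        set A := (∑ c ∈ C, matchPot n s.lvl (upd s.col x c) (pairWeight 0 r)) / (C.card : ℝ≥0∞)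
        calc _ = ((14 + (4000 * d + 500) + (3000 * L + 2000 * (sp - 1) + 10000 * (Z - d) + 7) : ℕ) :
              ℝ≥0∞) + 5000 * (2 * A) + b := by push_cast; ring
          _ ≤ ((14 + (4000 * d + 500) + (3000 * L + 2000 * (sp - 1) + 10000 * (Z - d) + 7) : ℕ) :
              ℝ≥0∞) + 5000 * (2 * Mp + d) + b := by gcongr
          _ = ((14 + (4000 * d + 500) + (3000 * L + 2000 * (sp - 1) + 10000 * (Z - d) + 7) +
              5000 * d : ℕ) : ℝ≥0∞) + 10000 * Mp + b := by push_cast; ring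
          _ ≤ _ := add_le_add (add_le_add (Nat.cast_le.2 (by omega)) le_rfl) le_rfl
      · intro c hc s₃ hf₃ hcol₃
        have hc0 : c ≠ 0 := by
          rw [freeColors, Finset.mem_filter, Finset.mem_Ico] at hc
          have := base_pos n (s₂.lvl x)
          omega
        have h1 := hrest s₃ c (hG₂.recolor hE hc hf₃ hcol₃) ((hf₃.1 4 (by simp)).trans e4)
          (by rw [← ek]; simp [St.stk, hf₃.2 7 (by simp)])
          (by rw [← el]; simp [St.lvl, hf₃.2 1 (by simp)]) (by rw [hcol₃, ec]) hc0
        rw [hg]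
        refine (add_le_add le_rfl (add_le_add le_rfl h1)).trans (le_of_eq ?_)
        have : zeroPot n s.lvl (upd s.col x c) = Z - d := by have := hdZ c hc0; omega
        rw [this]
        push_cast
        ring
    · refine (add_le_add le_rfl (wp_skip _ _)).trans ?_
      have h1 := hrest s₂ (s.col x) hG₂ e4 ek el (by rw [upd_same, ec]) (by omega)
      rw [upd_same, ← hZ, ← hMp] at h1
      rw [hg]
      calc ((14 : ℕ) : ℝ≥0∞) + (1 + (1 + (1 + K.wp (.loop z (.var 4) processTop) f s₂))) ≤
            (14 : ℕ) + (1 + (1 + (1 + ((3000 * L + 2000 * (sp - 1) + 10000 * Z : ℕ) +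
              10000 * Mp + (b + 5))))) := by gcongr
        _ = ((3000 * L + 2000 * (sp - 1) + 10000 * Z + 22 : ℕ) : ℝ≥0∞) + 10000 * Mp + b := by
            push_cast; ring
        _ ≤ _ := add_le_add (add_le_add (Nat.cast_le.2 (by omega)) le_rfl) le_rfl

/-! ### Processing an update -/

lemma tri_edgeLevel {K : Machine} {n : ℕ} (hK : Fits K n) {s : St} {E : ℕ → ℕ → Bool}
    (hG : Good K n E s) {a b : ℕ} (h1 : s.r 1 = a) (h2 : s.r 2 = b) (ha : a < n) (hb : b < n) :
    K.Tri edgeLevel s edgeLevel.len fun s' =>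
      Frame {6, 10} ∅ s s' ∧ s'.r 10 = min (s.lvl a) (s.lvl b) := by
  have hn := hK.lt
  have hW := hK.word
  have hlarge := hK.large
  have hM := hG.r3
  unfold edgeLevel
  refine tri_asg_seq ?_ (tri_asg_seq ?_ (tri_ite ?_ ?_ (fun h => tri_asg ?_ ?_)
    (fun h => tri_skip ?_)))
  · simp [Ex.Ok, Ex.eval, hM, h1]; omega
  · simp [Ex.Ok, Ex.eval, hM, h2]; omega
  · simp [Ex.Ok]
  · simp [Ex.Ok]
  · simp [Ex.Ok]
  · simp [Ex.eval, h1, h2] at h ⊢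
    refine ⟨⟨fun i hi => ?_, fun k _ => rfl⟩, ?_⟩
    · simp only [Finset.mem_insert, Finset.mem_singleton, not_or] at hi
      simp [hi]
    · simp [St.lvl]; omega
  · simp [Ex.eval, h1, h2] at h ⊢
    refine ⟨⟨fun i hi => ?_, fun k _ => rfl⟩, ?_⟩
    · simp only [Finset.mem_insert, Finset.mem_singleton, not_or] at hi
      simp [hi]
    · simp [St.lvl]; omega

lemma tri_resolveConflict {K : Machine} {n : ℕ} (hK : Fits K n) {s : St} (hM : s.r 3 = K.M)
    {a b : ℕ} (h1 : s.r 1 = a) (h2 : s.r 2 = b) (ha : a < n) (hb : b < n) :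
    K.Tri resolveConflict s resolveConflict.len fun s' => Frame ∅ {0} s s' ∧
      s'.col = if s.col a = s.col b then upd (upd s.col a 0) b 0 else s.col := by
  have hn := hK.lt
  have hW := hK.word
  have hlarge := hK.large
  unfold resolveConflict
  refine tri_ite ?_ ?_ (fun h => tri_skip ?_) (fun h => tri_ite ?_ ?_ (fun h' => tri_skip ?_)
    (fun h' => tri_wr_seq ?_ ?_ (tri_wr ?_ ?_ ?_)))
  · simp [Ex.Ok, Ex.eval, hM, h1]; omega
  · simp [Ex.Ok, Ex.eval, hM, h2]; omega
  · simp [Ex.eval, h1, h2] at h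
    exact ⟨⟨fun _ _ => rfl, fun _ _ => rfl⟩, by rw [if_neg]; simp only [St.col]; omega⟩
  · simp [Ex.Ok, Ex.eval, hM, h2]; omega
  · simp [Ex.Ok, Ex.eval, hM, h1]; omega
  · simp [Ex.eval, h1, h2] at h'
    exact ⟨⟨fun _ _ => rfl, fun _ _ => rfl⟩, by rw [if_neg]; simp only [St.col]; omega⟩
  · simp [Ex.Ok, Ex.eval, hM, h1]; omega
  · simp [Ex.Ok]; omega
  · simp [Ex.Ok, Ex.eval, hM, h2]; omega
  · simp [Ex.Ok]; omega
  · simp [Ex.eval, h1, h2] at h h'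
    refine ⟨⟨fun _ _ => rfl, fun k hk => ?_⟩, ?_⟩
    · simp only [Finset.mem_singleton] at hk
      funext x y w
      simp [hk]
    · rw [if_pos (by simp only [St.col]; omega)]
      funext w
      simp [St.col, Ex.eval, h1, h2, upd]

lemma tri_pushEnds {K : Machine} {n : ℕ} (hK : Fits K n) {s : St} (hM : s.r 3 = K.M) :
    K.Tri pushEnds s pushEnds.len fun s' => Frame {4} {7} s s' ∧ s'.r 4 = 2 ∧
      s'.stk 0 = s.r 1 ∧ s'.stk 1 = s.r 2 := by
  have hW := hK.word
  have hlarge := hK.large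
  unfold pushEnds
  refine tri_wr_seq ?_ ?_ (tri_wr_seq ?_ ?_ (tri_asg ?_ ?_))
  · simp [Ex.Ok, Ex.eval, hM]; omega
  · simp [Ex.Ok]
  · simp [Ex.Ok, Ex.eval, hM]; omega
  · simp [Ex.Ok]
  · simp [Ex.Ok]; omega
  · refine ⟨⟨fun i hi => ?_, fun k hk => ?_⟩, ?_, ?_, ?_⟩
    · simp only [Finset.mem_singleton] at hi
      simp [hi]
    · simp only [Finset.mem_singleton] at hk
      funext x y w
      simp [hk]
    · simp [Ex.eval]
    · simp [Ex.eval, St.stk]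
    · simp [Ex.eval, St.stk]

/-- The coin of `x` is paid for by the potential of the pairs of vertices. -/
lemma wp_coin {K : Machine} {n : ℕ} (hK : Fits K n) (hτ : K.τ = 1) {s : St} {E : ℕ → ℕ → Bool}
    (hG : Good K n E s) {a x : ℕ} (ha : a < 11) (hra : s.r a = x) (hx : x < n) {t : ℕ → ℕ}
    (ht : t x = 1) (r : List (EdgeUpdate n)) (g : St → ℝ≥0∞) (k : ℕ) (b : ℝ≥0∞)
    (hg : ∀ s', Frame {11} {0} s s' → (s'.col = s.col ∨ s'.col = upd s.col x 0) →
      g s' ≤ (k + 10000 * zeroPot n s.lvl s'.col : ℕ) +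
        10000 * matchPot n s.lvl s'.col (pairWeight (upd t x 0) r) + b) :
    K.wp (coin a) g s ≤ (k + 11000 + 10000 * zeroPot n s.lvl s.col : ℕ) +
        10000 * matchPot n s.lvl s.col (pairWeight t r) + b := by
  have hn := hK.lt
  have hW := hK.word
  have hlarge := hK.large
  have hM := hG.r3
  have hT := top_lt n
  have hlx := hG.lvl_le x hx
  set d := scale n (s.lvl x) with hd
  have hdpos : 0 < d := scale_pos _ _
  have hlM : s.lvl x < K.M := by have := hK.lvls_lt; omega
  have hsc : s.m 2 0 0 (s.lvl x) = d := hG.scale _ (by omega)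
  have hslt := hK.scale_lt (l := s.lvl x) (by omega)
  rw [← hd] at hslt
  have hev : (Ex.sub (scaleE (lvlE (.var a))) (.lit 1)).eval s + 1 = d := by
    simp only [Ex.eval, hra, hsc]
    omega
  unfold coin
  refine (wp_seq _ _ _ _).trans ((wp_rnd _ ?_).trans ?_)
  · obtain ⟨l, hl⟩ : ∃ l, s.m 1 0 0 x = l := ⟨_, rfl⟩
    rw [show s.lvl x = l from hl] at hsc hlM
    simp [Ex.Ok, Ex.eval, hM, hra, hl, hsc]
    omega
  rw [hev, hτ, one_mul]
  have hlen : (Ex.sub (scaleE (lvlE (.var a))) (.lit 1)).len + 1 ≤ 100 := by simp [Ex.len]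
  set Z := zeroPot n s.lvl s.col with hZ
  set M₀ := matchPot n s.lvl (upd s.col x 0) (pairWeight (upd t x 0) r) with hM₀
  set M₁ := matchPot n s.lvl s.col (pairWeight (upd t x 0) r) with hM₁
  have hwp : ∀ y, K.wp (.ite (.var 11) (.lit 1) (.wr 0 z z (.var a) z) .skip) g (s.set 11 y) ≤
      ((100 + k + 10000 * Z : ℕ) + b) +
        (if y = 0 then ((10000 * d : ℕ) : ℝ≥0∞) + 10000 * M₀ else 10000 * M₁) := by
    intro y
    refine (wp_ite _ ?_ ?_).trans ?_
    · simp [Ex.Ok]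
    · simp [Ex.Ok]; omega
    rw [show ((Ex.var 11).len + (Ex.lit 1).len + 1 : ℕ) = 4 by decide, hτ, one_mul]
    have e1 : (Ex.var 11).eval (s.set 11 y) = y := by simp [Ex.eval]
    have e2 : (Ex.lit 1).eval (s.set 11 y) = 1 := rfl
    rw [e1, e2]
    have hne : a ≠ 11 := by omega
    have hra' : (s.set 11 y).r a = x := by simp [hne, hra]
    by_cases hy : y = 0
    · rw [if_pos (by omega), if_pos hy]
      have h1 : K.wp (.wr 0 z z (.var a) z) g (s.set 11 y) ≤ (90 : ℕ) +
          ((k + 10000 * zeroPot n s.lvl (upd s.col x 0) : ℕ) + 10000 * M₀ + b) := by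
        refine (wp_wr _ ?_ ?_).trans ?_
        · simp [Ex.Ok, Ex.eval, hM, hne, hra]; omega
        · simp [Ex.Ok]; omega
        · rw [hτ, one_mul]
          have hcol : ((s.set 11 y).upd 0 (z.eval (s.set 11 y)) (z.eval (s.set 11 y))
              ((Ex.var a).eval (s.set 11 y)) (z.eval (s.set 11 y))).col = upd s.col x 0 := by
            funext v
            simp [Ex.eval, hne, hra, St.col, upd]
          refine add_le_add (Nat.cast_le.2 (by simp [Cmd.len, Ex.len])) ((hg _ ⟨fun j hj => ?_,
            fun j hj => ?_⟩ (Or.inr hcol)).trans_eq (by rw [hcol]))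
          · simp only [Finset.mem_singleton] at hj
            simp [hj]
          · simp only [Finset.mem_singleton] at hj
            funext u v w
            simp [hj]
      have hz := zeroPot_discard' n s.lvl s.col x
      calc _ ≤ ((4 : ℕ) : ℝ≥0∞) + ((90 : ℕ) + ((k + 10000 * (Z + d) : ℕ) + 10000 * M₀ + b)) := by
            refine add_le_add le_rfl (h1.trans (add_le_add le_rfl (add_le_add (add_le_add
              (Nat.cast_le.2 ?_) le_rfl) le_rfl)))
            omega
        _ = ((94 + k + 10000 * Z : ℕ) + b) + (((10000 * d : ℕ) : ℝ≥0∞) + 10000 * M₀) := by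
            push_cast; ring
        _ ≤ _ := by gcongr; omega
    · rw [if_neg (by omega), if_neg hy]
      have h1 := hg (s.set 11 y) ⟨fun j hj => by
        simp only [Finset.mem_singleton] at hj; simp [hj], fun j hj => rfl⟩ (Or.inl rfl)
      calc _ ≤ ((4 : ℕ) : ℝ≥0∞) + (1 + ((k + 10000 * Z : ℕ) + 10000 * M₁ + b)) := by
            refine add_le_add le_rfl ((wp_skip _ _).trans (add_le_add le_rfl h1))
        _ = ((5 + k + 10000 * Z : ℕ) + b) + 10000 * M₁ := by push_cast; ring
        _ ≤ _ := by gcongr; omega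
  have hd0 : (d : ℝ≥0∞) ≠ 0 := by exact_mod_cast hdpos.ne'
  have hsum : ∑ y ∈ Finset.range d,
      K.wp (.ite (.var 11) (.lit 1) (.wr 0 z z (.var a) z) .skip) g (s.set 11 y) ≤
      d * ((100 + k + 10000 * Z + 10000 : ℕ) + b) +
        10000 * (M₀ + ((d - 1 : ℕ) : ℝ≥0∞) * M₁) := by
    refine (Finset.sum_le_sum fun y _ => hwp y).trans (le_of_eq ?_)
    rw [Finset.sum_add_distrib, Finset.sum_const, Finset.card_range, nsmul_eq_mul]
    obtain ⟨d', hd'⟩ : ∃ d', d = d' + 1 := ⟨d - 1, by omega⟩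
    rw [hd', Finset.sum_range_succ']
    simp only [Nat.add_sub_cancel, Nat.succ_ne_zero, if_false, if_true, Finset.sum_const,
      Finset.card_range, nsmul_eq_mul]
    push_cast
    ring
  have hcoin := matchPot_pairWeight_coin s.lvl s.col t r hx ht
  rw [← hd, ← hM₀, ← hM₁] at hcoin
  calc _ ≤ ((100 : ℕ) : ℝ≥0∞) + (d * ((100 + k + 10000 * Z + 10000 : ℕ) + b) +
        10000 * (M₀ + ((d - 1 : ℕ) : ℝ≥0∞) * M₁)) / d := by
        gcongr
    _ = ((100 : ℕ) : ℝ≥0∞) + (((100 + k + 10000 * Z + 10000 : ℕ) + b) +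
        10000 * ((M₀ + ((d - 1 : ℕ) : ℝ≥0∞) * M₁) / d)) := by
        rw [ENNReal.add_div, mul_comm (d : ℝ≥0∞), ENNReal.mul_div_cancel_right hd0 (by simp),
          mul_div_assoc]
    _ ≤ ((100 : ℕ) : ℝ≥0∞) + (((100 + k + 10000 * Z + 10000 : ℕ) + b) +
        10000 * matchPot n s.lvl s.col (pairWeight t r)) := by gcongr
    _ = ((10200 + k + 10000 * Z : ℕ) : ℝ≥0∞) +
        10000 * matchPot n s.lvl s.col (pairWeight t r) + b := by push_cast; ring
    _ ≤ _ := add_le_add (add_le_add (Nat.cast_le.2 (by omega)) le_rfl) le_rfl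

/-- The data structure is in order, all vertices satisfy their degree conditions and have a
color. -/
structure Ready (K : Machine) (n : ℕ) (E : ℕ → ℕ → Bool) (s : St) : Prop where
  good : Good K n E s
  settled : ∀ v < n, Settled n E s.lvl v
  colored : ∀ v < n, s.col v ≠ 0

lemma Pending.ready {K : Machine} {n : ℕ} {E : ℕ → ℕ → Bool} {s : St} (h : Pending K n E s)
    (h4 : s.r 4 = 0) : Ready K n E s := by
  have key : ∀ v < n, ¬ (¬ Settled n E s.lvl v ∨ s.col v = 0) := fun v hv hv' => by
    obtain ⟨i, hi, -⟩ := h.pending v hv hv'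
    omega
  exact ⟨h.good, fun v hv => by_contra fun hh => key v hv (Or.inl hh),
    fun v hv hh => key v hv (Or.inr hh)⟩

/-- If only the endpoints of the edge of the update may violate their conditions, pushing them on
the stack and processing the stack repairs the data structure. -/
lemma wp_pushEnds_settleAll {K : Machine} {n : ℕ} (hK : Fits K n) (hτ : K.τ = 1)
    {E : ℕ → ℕ → Bool} (hE : IsGraph n E) (r : List (EdgeUpdate n)) (f : St → ℝ≥0∞) (b : ℝ≥0∞)
    (hf : ∀ s, Ready K n E s →
      f s ≤ (3000 * levelPot n E s.lvl : ℕ) + 10000 * matchPot n s.lvl s.col (pairWeight 0 r) + b)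
    {s : St} (hG : Good K n E s) {u v : ℕ} (h1 : s.r 1 = u) (h2 : s.r 2 = v) (hu : u < n)
    (hv : v < n) (hset : ∀ x < n, x ≠ u → x ≠ v → Settled n E s.lvl x ∧ s.col x ≠ 0) :
    K.wp (pushEnds ;; settleAll) f s ≤
      (3000 * levelPot n E s.lvl + 5000 + 10000 * zeroPot n s.lvl s.col : ℕ) +
        10000 * matchPot n s.lvl s.col (pairWeight 0 r) + b := by
  refine (wp_seq _ _ _ _).trans ?_
  refine (tri_pushEnds hK hG.r3 _ ((3000 * levelPot n E s.lvl + 4005 + 10000 *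
    zeroPot n s.lvl s.col : ℕ) + 10000 * matchPot n s.lvl s.col (pairWeight 0 r) + b) ?_).trans ?_
  · rintro s' ⟨hf', h4, hk0, hk1⟩
    have hm : ∀ k, k ≠ 7 → s'.m k = s.m k := fun k hk => hf'.2 k (by simpa using hk)
    have el : s'.lvl = s.lvl := by simp [St.lvl, hm]
    have ec : s'.col = s.col := by simp [St.col, hm]
    have hP : Pending K n E s' := by
      refine ⟨hG.congr (hf'.1 3 (by simp)) fun k hk => hm k (by omega), fun i hi => ?_,
        fun x hx hx' => ?_⟩
      · have : i = 0 ∨ i = 1 := by omega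
        rcases this with rfl | rfl
        · rw [hk0, h1]; exact hu
        · rw [hk1, h2]; exact hv
      · by_cases hxu : x = u
        · exact ⟨0, by omega, by rw [hk0, h1, hxu]⟩
        · by_cases hxv : x = v
          · exact ⟨1, by omega, by rw [hk1, h2, hxv]⟩
          · have := hset x hx hxu hxv
            rw [el, ec] at hx'
            tauto
    have hpot := levelPot_le hK.two_le E (lvl := s.lvl) fun x hx => by
      have := hG.lvl_le x hx
      have := top_lt n
      omega
    have hM := hK.le 9 4 (by omega)
    have hp2 : 2 ^ 4 ≤ pw n ^ 4 := Nat.pow_le_pow_left (two_le_pw hK.two_le) 4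
    have := wp_settleAll hK hτ hE r f b (fun s hs h4 => hf s (hs.ready h4))
      (levelPot n E s'.lvl + s'.r 4) (by rw [el]; omega) s' hP le_rfl
    rw [el, ec, h4] at this
    refine this.trans (le_of_eq ?_)
    push_cast
    ring
  · rw [hτ, one_mul]
    have hlen : pushEnds.len ≤ 500 := by decide
    calc (pushEnds.len : ℝ≥0∞) + ((3000 * levelPot n E s.lvl + 4005 + 10000 *
          zeroPot n s.lvl s.col : ℕ) + 10000 * matchPot n s.lvl s.col (pairWeight 0 r) + b)
        = ((pushEnds.len + (3000 * levelPot n E s.lvl + 4005 + 10000 *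
          zeroPot n s.lvl s.col) : ℕ) : ℝ≥0∞) +
            10000 * matchPot n s.lvl s.col (pairWeight 0 r) + b := by push_cast; ring
      _ ≤ _ := add_le_add (add_le_add (Nat.cast_le.2 (by omega)) le_rfl) le_rfl

lemma bucket_change (E : ℕ → ℕ → Bool) (lvl : ℕ → ℕ) (ins : Bool) (u v : ℕ) :
    bucket (change ins u v E) lvl = assign (assign (bucket E lvl) u v
      (if ins then some (min (lvl u) (lvl v)) else none)) v u
        (if ins then some (min (lvl u) (lvl v)) else none) := by
  funext x y
  simp only [bucket, change, assign]
  by_cases h1 : x = u ∧ y = v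
  · obtain ⟨rfl, rfl⟩ := h1
    by_cases h2 : x = y ∧ y = x
    · simp [h2.1]
    · simp [h2]
  · by_cases h2 : x = v ∧ y = u
    · obtain ⟨rfl, rfl⟩ := h2
      simp [min_comm]
    · simp [h1, h2]

/-- The degree conditions of a vertex depend only on its own edges. -/
lemma settled_change {n : ℕ} {E : ℕ → ℕ → Bool} {lvl : ℕ → ℕ} (ins : Bool) {u v x : ℕ}
    (hu : x ≠ u) (hv : x ≠ v) : Settled n (change ins u v E) lvl x ↔ Settled n E lvl x := by
  have h : ∀ w, change ins u v E x w = E x w := fun w => by rw [change, if_neg (by tauto)]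
  simp only [Settled, upNbrs, h]

/-- Colors of vertices on different levels are different. -/
lemma Good.lvl_eq {K : Machine} {n : ℕ} {E : ℕ → ℕ → Bool} {s : St} (h : Good K n E s) {u v : ℕ}
    (hu : u < n) (hv : v < n) (hc : s.col u = s.col v) (h0 : s.col v ≠ 0) : s.lvl u = s.lvl v := by
  have h1 := h.palette u hu (hc ▸ h0)
  have h2 := h.palette v hv h0
  rcases lt_trichotomy (s.lvl u) (s.lvl v) with hl | hl | hl
  · have := base_mono n (by omega : s.lvl u + 1 ≤ s.lvl v); omega
  · exact hl
  · have := base_mono n (by omega : s.lvl v + 1 ≤ s.lvl u); omega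

lemma zeroPot_eq_zero {n : ℕ} (lvl : ℕ → ℕ) {col : ℕ → ℕ} (h : ∀ v < n, col v ≠ 0) :
    zeroPot n lvl col = 0 :=
  Finset.sum_eq_zero fun v hv => if_neg (h v (Finset.mem_range.1 hv))

/-- The colors that are discarded when an edge between two vertices of the same color is inserted
are paid for by the potential of this pair. -/
lemma conflict_potential {n : ℕ} {lvl col : ℕ → ℕ} (e : EdgeUpdate n) (r : List (EdgeUpdate n))
    (he : e.isInsert = true) (huv : e.u ≠ e.v) (hcol : ∀ v < n, col v ≠ 0)
    (hl : col e.u = col e.v → lvl e.u = lvl e.v) {col' : ℕ → ℕ}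
    (hcol' : col' = if col e.u = col e.v then upd (upd col e.u 0) e.v 0 else col) :
    (zeroPot n lvl col' : ℝ≥0∞) + matchPot n lvl col' (pairWeight (touch e) r) ≤
      matchPot n lvl col (pairWeight 0 (e :: r)) := by
  split_ifs at hcol' with hc
  · rw [hcol']
    refine le_trans (add_le_add (Nat.cast_le.2 ?_) ?_)
      (matchPot_cons_conflict lvl col e r he huv hc (hcol _ e.v.2) (hl hc))
    · have h1 := zeroPot_discard' n lvl (upd col e.u 0) e.v
      have h2 := zeroPot_discard' n lvl col e.u
      rw [zeroPot_eq_zero lvl hcol] at h2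
      omega
    · exact (matchPot_discard' _ _ _ _ _).trans (matchPot_discard' _ _ _ _ _)
  · rw [hcol', zeroPot_eq_zero lvl hcol, Nat.cast_zero, zero_add]
    exact matchPot_cons_ge lvl col e r

lemma Good.discard {K : Machine} {n : ℕ} {E : ℕ → ℕ → Bool} {s s' : St} {x : ℕ}
    (h : Good K n E s) (h3 : s'.r 3 = s.r 3) (hm : ∀ k, k ≠ 0 → k < 7 → s'.m k = s.m k)
    (hcol : s'.col = s.col ∨ s'.col = upd s.col x 0) : Good K n E s' := by
  have e : s'.lvl = s.lvl := by simp [St.lvl, hm]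
  have hsub : ∀ v, s'.col v ≠ 0 → s'.col v = s.col v := by
    intro v hv
    rcases hcol with hc | hc
    · rw [hc]
    · rw [hc] at hv ⊢
      simp only [upd] at hv ⊢
      split_ifs at hv ⊢
      · exact absurd rfl hv
      · rfl
  refine ⟨h3.trans h.r3, ?_, ?_, ?_, ?_, ?_, ?_⟩
  · simpa [hm] using h.scale
  · simpa [hm] using h.base
  · rw [e]; exact h.lvl_le
  · rw [e]; simpa [Lists, hm] using h.lists
  · rw [e]
    intro v hv hv0
    rw [hsub v hv0]
    exact h.palette v hv (hsub v hv0 ▸ hv0)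
  · intro u hu v hv huv hu0 huv'
    have hv0 : s'.col v ≠ 0 := huv' ▸ hu0
    exact h.proper u hu v hv huv (hsub u hu0 ▸ hu0) (by rw [← hsub u hu0, ← hsub v hv0]; exact huv')

/-- The expected cost of an update is bounded by the change of the potentials and the number of
levels. -/
lemma wp_updateCmd {K : Machine} {n : ℕ} (hK : Fits K n) (hτ : K.τ = 1) {E : ℕ → ℕ → Bool}
    (hE : IsGraph n E) (e : EdgeUpdate n) (r : List (EdgeUpdate n)) (huv : e.u ≠ e.v)
    (hval : E e.u e.v = !e.isInsert) (f : St → ℝ≥0∞) (b : ℝ≥0∞)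
    (hf : ∀ s, Ready K n (change e.isInsert e.u e.v E) s →
      f s ≤ (3000 * levelPot n (change e.isInsert e.u e.v E) s.lvl : ℕ) +
        10000 * matchPot n s.lvl s.col (pairWeight 0 r) + b)
    {s : St} (hs : Ready K n E s) (h0 : s.r 0 = if e.isInsert then 1 else 0)
    (h1 : s.r 1 = e.u) (h2 : s.r 2 = e.v) :
    K.wp updateCmd f s ≤ (3000 * levelPot n E s.lvl + 200000 * lvls n : ℕ) +
      10000 * matchPot n s.lvl s.col (pairWeight 0 (e :: r)) + b := by
  obtain ⟨u, hu⟩ : ∃ u, u = (e.u : ℕ) := ⟨_, rfl⟩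
  obtain ⟨v, hv⟩ : ∃ v, v = (e.v : ℕ) := ⟨_, rfl⟩
  have hun : u < n := hu ▸ e.u.2
  have hvn : v < n := hv ▸ e.v.2
  have huv' : u ≠ v := fun h => huv (Fin.ext (by omega))
  rw [← hu] at h1
  rw [← hv] at h2
  rw [← hu, ← hv] at hf hval
  have hG := hs.good
  have hW := hK.word
  have hlarge := hK.large
  set E' := change e.isInsert u v E with hE'
  have hgE' : IsGraph n E' := hE.change _ hun hvn huv'
  have hT := top_lt n
  have hpot := levelPot_change hE (lvl := s.lvl)
    (fun x hx => by have := hG.lvl_le x hx; omega) e.isInsert hun hvn huv'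
  rw [← hE'] at hpot
  have hlu := hG.lvl_le u hun
  have hTM := hK.lvls_lt
  set M := matchPot n s.lvl s.col (pairWeight 0 (e :: r)) with hM
  -- what remains to be done once the lists belong to the new graph
  have hfin : ∀ s', Good K n E' s' → s'.r 1 = u → s'.r 2 = v → s'.lvl = s.lvl →
      (∀ x, x ≠ u → x ≠ v → s'.col x = s.col x) → K.wp (pushEnds ;; settleAll) f s' ≤
        (3000 * levelPot n E' s.lvl + 5000 + 10000 * zeroPot n s.lvl s'.col : ℕ) +
          10000 * matchPot n s.lvl s'.col (pairWeight 0 r) + b := by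
    intro s' hG' h1' h2' hl' hc'
    have := wp_pushEnds_settleAll hK hτ hgE' r f b hf hG' h1' h2' hun hvn fun x hx hxu hxv => by
      rw [hl', hc' x hxu hxv, settled_change _ hxu hxv]
      exact ⟨hs.settled x hx, hs.colored x hx⟩
    rwa [hl'] at this
  unfold updateCmd
  refine (wp_seq _ _ _ _).trans ?_
  refine (tri_edgeLevel hK hG h1 h2 hun hvn _
    ((3000 * levelPot n E' s.lvl + 30000 : ℕ) + 10000 * M + b) ?_).trans ?_
  swap
  · rw [hτ, one_mul]
    have hlen : edgeLevel.len ≤ 500 := by decide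
    have hl0 : 0 < lvls n := by omega
    calc (edgeLevel.len : ℝ≥0∞) + ((3000 * levelPot n E' s.lvl + 30000 : ℕ) + 10000 * M + b)
        = ((edgeLevel.len + (3000 * levelPot n E' s.lvl + 30000) : ℕ) : ℝ≥0∞) +
            10000 * M + b := by push_cast; ring
      _ ≤ _ := add_le_add (add_le_add (Nat.cast_le.2 (by omega)) le_rfl) le_rfl
  rintro s₁ ⟨hf₁, h10⟩
  have hm₁ : s₁.m = s.m := funext fun k => hf₁.2 k (by simp)
  have el₁ : s₁.lvl = s.lvl := by simp [St.lvl, hm₁]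
  have ec₁ : s₁.col = s.col := by simp [St.col, hm₁]
  have r₁ : ∀ i, i ≠ 6 → i ≠ 10 → s₁.r i = s.r i := fun i h6 h10 => hf₁.1 i (by simp [h6, h10])
  have hG₁ : Good K n E s₁ := hG.congr (r₁ 3 (by decide) (by decide)) fun k _ => by rw [hm₁]
  have hl₁ : Lists n (bucket E s.lvl) s₁.m := by rw [← el₁]; exact hG₁.lists
  have hM3 : s₁.r 3 = K.M := hG₁.r3
  have h1₁ : s₁.r 1 = u := (r₁ 1 (by decide) (by decide)).trans h1
  have h2₁ : s₁.r 2 = v := (r₁ 2 (by decide) (by decide)).trans h2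
  have h0₁ : s₁.r 0 = if e.isInsert then 1 else 0 := (r₁ 0 (by decide) (by decide)).trans h0
  have h10M : s₁.r 10 < K.M := by omega
  refine (wp_seq _ _ _ _).trans ((wp_ite _ ?_ ?_).trans ?_)
  · simp [Ex.Ok]; omega
  · simp [Ex.Ok]
  rw [show ((Ex.lit 0).len + (Ex.var 0).len + 1 : ℕ) = 4 by decide, hτ, one_mul]
  have hz0 : z.eval s₁ = 0 := rfl
  have hr0 : (Ex.var 0).eval s₁ = if e.isInsert then 1 else 0 := h0₁
  rw [hz0, hr0]
  have hsymm : ∀ x y, E x y = E y x := hE.symm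
  cases hins : e.isInsert with
  | true =>
    rw [hins] at hval hE'
    simp only [if_true, Nat.zero_lt_one]
    have hnone : bucket E s.lvl u v = none := by simp [bucket, hval]
    have hnone' : bucket E s.lvl v u = none := by simp [bucket, hsymm v u, hval]
    -- the coloring may be improper until the conflict is resolved, so both commands are treated
    -- together
    have htri : K.Tri (link 1 2 10 ;; resolveConflict) s₁
        (link 1 2 10 ;; resolveConflict).len fun s₃ =>
        Good K n E' s₃ ∧ s₃.r 1 = u ∧ s₃.r 2 = v ∧ s₃.lvl = s.lvl ∧
          s₃.col = if s.col u = s.col v then upd (upd s.col u 0) v 0 else s.col := by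
      refine Tri.seq_len (tri_link (a := 1) (b := 2) (j := 10) hK hM3 hl₁ (by rw [h1₁]; exact hun)
        (by rw [h2₁]; exact hvn) h10M (by decide) (by rw [h1₁, h2₁]; exact huv')
        (by rw [h1₁, h2₁]; exact hnone) (by rw [h1₁, h2₁]; exact hnone')) ?_
      rintro s₂ ⟨hf₂, hl₂⟩
      have r₂ : ∀ i < 11, s₂.r i = s₁.r i := fun i hi => hf₂.1 i (by simp; omega)
      have m₂ : ∀ k, k < 4 → s₂.m k = s.m k := fun k hk => by
        rw [← hm₁]; exact hf₂.2 k (by simp; omega)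
      have el₂ : s₂.lvl = s.lvl := by simp [St.lvl, m₂]
      have ec₂ : s₂.col = s.col := by simp [St.col, m₂]
      rw [h1₁, h2₁, h10] at hl₂
      have hb := bucket_change E s.lvl true u v
      rw [if_pos rfl, ← hE'] at hb
      rw [← hb] at hl₂
      refine (tri_resolveConflict hK (s := s₂) ((r₂ 3 (by omega)).trans hM3)
        ((r₂ 1 (by omega)).trans h1₁) ((r₂ 2 (by omega)).trans h2₁) hun hvn).mono le_rfl ?_
      rintro s₃ ⟨hf₃, hc₃⟩
      have r₃ : ∀ i, s₃.r i = s₂.r i := fun i => hf₃.1 i (by simp)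
      have m₃ : ∀ k, k ≠ 0 → s₃.m k = s₂.m k := fun k hk => hf₃.2 k (by simpa using hk)
      have el₃ : s₃.lvl = s.lvl := by rw [← el₂]; simp [St.lvl, m₃]
      rw [ec₂] at hc₃
      have hsub : ∀ x, s₃.col x ≠ 0 → s₃.col x = s.col x := by
        intro x hx
        rw [hc₃] at hx ⊢
        split_ifs at hx ⊢ with hc
        · simp only [upd] at hx ⊢
          split_ifs at hx ⊢ <;> simp_all
        · rfl
      refine ⟨⟨?_, ?_, ?_, ?_, ?_, ?_, ?_⟩, ?_, ?_, el₃, hc₃⟩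
      · rw [r₃, r₂ 3 (by omega), hM3]
      · intro l hl
        rw [m₃ 2 (by decide), m₂ 2 (by decide)]; exact hG.scale l hl
      · intro l hl
        rw [m₃ 3 (by decide), m₂ 3 (by decide)]; exact hG.base l hl
      · rw [el₃]; exact hG.lvl_le
      · rw [el₃]; simpa [Lists, m₃] using hl₂
      · rw [el₃]
        intro x hx hx0
        rw [hsub x hx0]
        exact hG.palette x hx (hs.colored x hx)
      · intro x hx y hy hxy hx0 hxy'
        have hy0 : s₃.col y ≠ 0 := hxy' ▸ hx0
        have hx1 := hsub x hx0
        have hy1 := hsub y hy0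
        rw [hE', change] at hxy
        split_ifs at hxy with hc
        · have hcuv : s.col u = s.col v := by
            rcases hc with ⟨rfl, rfl⟩ | ⟨rfl, rfl⟩
            · rw [← hx1, hxy', hy1]
            · rw [← hx1, hxy', hy1]
          rw [hc₃, if_pos hcuv] at hx0
          simp only [upd] at hx0
          rcases hc with ⟨rfl, rfl⟩ | ⟨rfl, rfl⟩ <;> simp at hx0
        · exact hG.proper x hx y hy hxy (hs.colored x hx) (by rw [← hx1, ← hy1]; exact hxy')
      · rw [r₃, r₂ 1 (by omega), h1₁]
      · rw [r₃, r₂ 2 (by omega), h2₁]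
    refine (add_le_add le_rfl ((wp_seq _ _ _ _).trans (htri _
      ((3000 * levelPot n E' s.lvl + 27000 : ℕ) + 10000 * M + b) ?_))).trans ?_
    swap
    · rw [hτ, one_mul]
      have hlen : (link 1 2 10 ;; resolveConflict).len ≤ 2000 := by decide
      calc ((4 : ℕ) : ℝ≥0∞) + (((link 1 2 10 ;; resolveConflict).len : ℝ≥0∞) +
            ((3000 * levelPot n E' s.lvl + 27000 : ℕ) + 10000 * M + b))
          = ((4 + (link 1 2 10 ;; resolveConflict).len + (3000 * levelPot n E' s.lvl + 27000) : ℕ) :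
            ℝ≥0∞) + 10000 * M + b := by push_cast; ring
        _ ≤ _ := add_le_add (add_le_add (Nat.cast_le.2 (by omega)) le_rfl) le_rfl
    rintro s₃ ⟨hG₃, h1₃, h2₃, el₃, hc₃⟩
    have htu : touch e u = 1 := if_pos ⟨hins, Or.inl hu.symm⟩
    have htv : touch e v = 1 := if_pos ⟨hins, Or.inr hv.symm⟩
    -- after the coins of `u` and `v`, none is outstanding
    have ht0 : upd (upd (touch e) u 0) v 0 = 0 := by
      funext x
      simp only [upd, Pi.zero_apply]
      split_ifs with hxv hxu
      · rfl
      · rfl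
      · exact if_neg fun hh => by rw [← hu, ← hv] at hh; tauto
    have hcoins := wp_coin hK hτ hG₃ (a := 1) (by omega) h1₃ hun htu r
      (K.wp (coin 2) (K.wp (pushEnds ;; settleAll) f)) (3000 * levelPot n E' s.lvl + 5000 + 11000) b ?_
    · refine (wp_seq _ _ _ _).trans (hcoins.trans ?_)
      have hconf := conflict_potential e r hins huv hs.colored
        (fun hc => hG.lvl_eq e.u.2 e.v.2 hc (hs.colored _ e.v.2)) (col' := s₃.col)
        (by rw [hc₃, hu, hv])
      rw [el₃]
      calc _ = ((3000 * levelPot n E' s.lvl + 5000 + 11000 + 11000 : ℕ) : ℝ≥0∞) +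
            10000 * (zeroPot n s.lvl s₃.col + matchPot n s.lvl s₃.col (pairWeight (touch e) r)) +
            b := by push_cast; ring
        _ ≤ _ := add_le_add (add_le_add (Nat.cast_le.2 (by omega))
            (mul_le_mul_right hconf _)) le_rfl
    · rintro s₄ hf₄ hc₄
      have r₄ : ∀ i < 11, s₄.r i = s₃.r i := fun i hi => hf₄.1 i (by simp; omega)
      have m₄ : ∀ k, k ≠ 0 → s₄.m k = s₃.m k := fun k hk => hf₄.2 k (by simpa using hk)
      have el₄ : s₄.lvl = s.lvl := by rw [← el₃]; simp [St.lvl, m₄]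
      have hG₄ : Good K n E' s₄ := hG₃.discard (r₄ 3 (by omega)) (fun k h0 _ => m₄ k h0) hc₄
      rw [el₃, ← el₄]
      refine wp_coin hK hτ hG₄ (a := 2) (t := upd (touch e) u 0) (by omega)
        ((r₄ 2 (by omega)).trans h2₃) hvn (by simp [upd, huv'.symm, htv]) r _ _ b ?_
      rintro s₅ hf₅ hc₅
      have r₅ : ∀ i < 11, s₅.r i = s₄.r i := fun i hi => hf₅.1 i (by simp; omega)
      have m₅ : ∀ k, k ≠ 0 → s₅.m k = s₄.m k := fun k hk => hf₅.2 k (by simpa using hk)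
      have el₅ : s₅.lvl = s.lvl := by rw [← el₄]; simp [St.lvl, m₅]
      have hG₅ : Good K n E' s₅ := hG₄.discard (r₅ 3 (by omega)) (fun k h0 _ => m₅ k h0) hc₅
      rw [ht0, el₄]
      refine hfin s₅ hG₅ (by rw [r₅ 1 (by omega), r₄ 1 (by omega), h1₃])
        (by rw [r₅ 2 (by omega), r₄ 2 (by omega), h2₃]) el₅ fun x hxu hxv => ?_
      have e5 : s₅.col x = s₄.col x := by
        rcases hc₅ with h | h
        · rw [h]
        · rw [h]; simp [upd, hxv]
      have e4 : s₄.col x = s₃.col x := by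
        rcases hc₄ with h | h
        · rw [h]
        · rw [h]; simp [upd, hxu]
      rw [e5, e4, hc₃]
      split_ifs <;> simp
  | false =>
    rw [hins] at hval hE'
    simp only [Bool.false_eq_true, if_false, lt_irrefl]
    have hsome : bucket E s.lvl u v = some (s₁.r 10) := by simp [bucket, hval, h10]
    have hsome' : bucket E s.lvl v u = some (s₁.r 10) := by
      simp [bucket, hsymm v u, hval, h10, min_comm]
    refine (add_le_add le_rfl (tri_unlink (a := 1) (b := 2) (j := 10) hK hM3 hl₁
      (by rw [h1₁]; exact hun) (by rw [h2₁]; exact hvn) h10M (by decide)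
      (by rw [h1₁, h2₁]; exact huv') (by rw [h1₁, h2₁]; exact hsome)
      (by rw [h1₁, h2₁]; exact hsome') _
      ((3000 * levelPot n E' s.lvl + 6000 : ℕ) + 10000 * M + b) ?_)).trans ?_
    swap
    · rw [hτ, one_mul]
      have hlen : (unlink 1 2 10).len ≤ 2000 := by decide
      calc ((4 : ℕ) : ℝ≥0∞) + (((unlink 1 2 10).len : ℝ≥0∞) +
            ((3000 * levelPot n E' s.lvl + 6000 : ℕ) + 10000 * M + b))
          = ((4 + (unlink 1 2 10).len + (3000 * levelPot n E' s.lvl + 6000) : ℕ) :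
            ℝ≥0∞) + 10000 * M + b := by push_cast; ring
        _ ≤ _ := add_le_add (add_le_add (Nat.cast_le.2 (by omega)) le_rfl) le_rfl
    rintro s₂ ⟨hf₂, hl₂⟩
    have r₂ : ∀ i < 11, s₂.r i = s₁.r i := fun i hi => hf₂.1 i (by simp; omega)
    have m₂ : ∀ k, k < 4 → s₂.m k = s.m k := fun k hk => by
      rw [← hm₁]; exact hf₂.2 k (by simp; omega)
    have el₂ : s₂.lvl = s.lvl := by simp [St.lvl, m₂]
    have ec₂ : s₂.col = s.col := by simp [St.col, m₂]
    rw [h1₁, h2₁] at hl₂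
    have hb := bucket_change E s.lvl false u v
    simp only [Bool.false_eq_true, if_false, ← hE'] at hb
    rw [← hb] at hl₂
    have hG₂ : Good K n E' s₂ := by
      refine ⟨(r₂ 3 (by omega)).trans hM3, ?_, ?_, ?_, ?_, ?_, ?_⟩
      · rw [m₂ 2 (by decide)]; exact hG.scale
      · rw [m₂ 3 (by decide)]; exact hG.base
      · rw [el₂]; exact hG.lvl_le
      · rw [el₂]; exact hl₂
      · rw [el₂, ec₂]; exact hG.palette
      · rw [ec₂]
        intro x hx y hy hxy hx0
        rw [hE', change] at hxy
        split_ifs at hxy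
        exact hG.proper x hx y hy hxy hx0
    have h3 := hfin s₂ hG₂ ((r₂ 1 (by omega)).trans h1₁) ((r₂ 2 (by omega)).trans h2₁) el₂
      fun x _ _ => by rw [ec₂]
    rw [ec₂, zeroPot_eq_zero s.lvl hs.colored] at h3
    have ht : touch e = 0 := by
      funext x
      simp [touch, hins]
    have hmono := matchPot_cons_ge s.lvl s.col e r
    rw [ht, ← hM] at hmono
    calc 1 + K.wp (pushEnds ;; settleAll) f s₂ ≤ 1 + ((3000 * levelPot n E' s.lvl + 5000 : ℕ) +
          10000 * M + b) :=
          add_le_add le_rfl (h3.trans (add_le_add (add_le_add (Nat.cast_le.2 (by omega))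
            (mul_le_mul_right hmono _)) le_rfl))
      _ = ((3000 * levelPot n E' s.lvl + 5001 : ℕ) : ℝ≥0∞) + 10000 * M + b := by push_cast; ring
      _ ≤ _ := add_le_add (add_le_add (Nat.cast_le.2 (by omega)) le_rfl) le_rfl

/-! ### Initialization -/

/-- The state at the start: register `0` holds `n`, everything else is zero. -/
def St.start (n : ℕ) : St where
  r := fun j => if j = 0 then n else 0
  m := fun _ _ _ _ => 0

lemma tri_computeLog {K : Machine} {n : ℕ} (hK : Fits K n) :
    K.Tri (.asg 5 (.lit 1) ;; .loop (.var 5) (.var 0)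
      (.asg 5 (.add (.var 5) (.var 5)) ;; .asg 6 (.add (.var 6) (.lit 1)))) (St.start n)
      (30 * lg n + 30) fun s => s.r 0 = n ∧ s.r 5 = pw n ∧ s.r 6 = lg n ∧ s.r 8 = 0 ∧
        s.r 12 = 0 ∧ s.m = fun _ _ _ _ => 0 := by
  have hW := hK.word
  have hlarge := hK.large
  have hpw := hK.pw_lt
  have hlg := lg_lt_pw n
  refine Tri.seq (k₂ := 30 * lg n + 25) (P := fun s => s = (St.start n).set 5 1)
    (tri_asg ?_ rfl) ?_ (by simp [Cmd.len, Ex.len]; omega)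
  · simp [Ex.Ok]; omega
  rintro _ rfl
  refine (tri_loop (i := lg n) (k := 17) (fun i s => i ≤ lg n ∧ s.r 0 = n ∧
    s.r 5 = 2 ^ (lg n - i) ∧ s.r 6 = lg n - i ∧ s.r 8 = 0 ∧ s.r 12 = 0 ∧
    s.m = fun _ _ _ _ => 0) ?_ ?_ ?_ ?_).mono ?_ ?_
  · intro i s _
    simp [Ex.Ok]
  · rintro s ⟨-, h0, h5, -⟩
    simp [Ex.eval, h0, h5, le_pw]
  · rintro i s ⟨hi, h0, h5, h6, h8, h12, hm⟩
    have hlt : 2 ^ (lg n - (i + 1)) < n := (Nat.lt_clog_iff_pow_lt (by omega)).1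
      (show lg n - (i + 1) < lg n by omega)
    have hpow : 2 ^ (lg n - i) = 2 ^ (lg n - (i + 1)) + 2 ^ (lg n - (i + 1)) := by
      rw [show lg n - i = lg n - (i + 1) + 1 by omega, pow_succ]; ring
    have hn := hK.lt
    generalize 2 ^ (lg n - (i + 1)) = q at h5 hlt hpow
    refine ⟨by simp [Ex.eval, h0, h5, hlt], ?_⟩
    refine (tri_asg_seq ?_ (tri_asg ?_ ?_)).mono (by decide) fun _ h => h
    · simp [Ex.Ok, Ex.eval, h5]; omega
    · simp [Ex.Ok, Ex.eval, h6]; omega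
    · simp [Ex.eval, h0, h5, h6, h8, h12, hm, hpow]
      omega
  · simp [St.start]
  · simp [Ex.len]; omega
  · rintro s ⟨-, h⟩
    simpa using h

lemma tri_computeParameters {K : Machine} {n : ℕ} (hK : Fits K n) {s : St} (h0 : s.r 0 = n)
    (h5 : s.r 5 = pw n) (h6 : s.r 6 = lg n) (h8 : s.r 8 = 0) (h12 : s.r 12 = 0)
    (hm : s.m = fun _ _ _ _ => 0) :
    K.Tri (.asg 3 (.mul (.var 5) (.var 5)) ;; .asg 3 (.mul (.var 3) (.var 3)) ;;
      .asg 3 (.mul (.var 3) (.var 3)) ;; .asg 3 (.mul (.var 3) (.var 3)) ;;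
      .asg 7 (.add (.var 6) (.lit 2)) ;;
      .asg 11 (.mul (.add (.var 6) (.lit 1)) (.var 7)) ;;
      .asg 9 (.lit 1) ;; .asg 10 (.lit 1)) s 100 fun s' => s'.r 0 = n ∧ s'.r 3 = K.M ∧
        s'.r 7 = grp n ∧ s'.r 11 = lvls n ∧ s'.r 9 = 1 ∧ s'.r 10 = 1 ∧ s'.r 8 = 0 ∧
        s'.r 12 = 0 ∧ s'.m = fun _ _ _ _ => 0 := by
  have hW := hK.word
  have hlarge := hK.large
  have hpw := hK.pw_lt
  have hlg := lg_lt_pw n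
  have hlv := hK.lvls_lt
  have e2 : pw n * pw n = pw n ^ 2 := by ring
  have e4 : pw n ^ 2 * pw n ^ 2 = pw n ^ 4 := by ring
  have e8 : pw n ^ 4 * pw n ^ 4 = pw n ^ 8 := by ring
  have e16 : pw n ^ 8 * pw n ^ 8 = K.M := by rw [hK.stride]; ring
  have b2 := hK.le 0 2 (by omega)
  have b4 := hK.le 0 4 (by omega)
  have b8 := hK.le 0 8 (by omega)
  rw [pow_zero, one_mul] at b2 b4 b8
  have elv : (lg n + 1) * (lg n + 2) = lvls n := rfl
  generalize pw n ^ 2 = q2 at *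
  generalize pw n ^ 4 = q4 at *
  generalize pw n ^ 8 = q8 at *
  generalize hT : lvls n = T at *
  refine (tri_asg_seq ?_ (tri_asg_seq ?_ (tri_asg_seq ?_ (tri_asg_seq ?_ (tri_asg_seq ?_
    (tri_asg_seq ?_ (tri_asg_seq ?_ (tri_asg ?_ ?_)))))))).mono (by decide) fun _ h => h
  · simp [Ex.Ok, Ex.eval, h5, e2]; omega
  · simp [Ex.Ok, Ex.eval, h5, e2, e4]; omega
  · simp [Ex.Ok, Ex.eval, h5, e2, e4, e8]; omega
  · simp [Ex.Ok, Ex.eval, h5, e2, e4, e8, e16]; omega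
  · simp [Ex.Ok, Ex.eval, h6]; omega
  · simp [Ex.Ok, Ex.eval, h6, elv]; omega
  · simp [Ex.Ok]; omega
  · simp [Ex.Ok]; omega
  · simp [Ex.eval, h0, h5, h6, h8, h12, hm, e2, e4, e8, e16, elv]

lemma tri_fillTables {K : Machine} {n : ℕ} (hK : Fits K n) {s : St} (h0 : s.r 0 = n)
    (h3 : s.r 3 = K.M) (h7 : s.r 7 = grp n) (h11 : s.r 11 = lvls n) (h9 : s.r 9 = 1)
    (h10 : s.r 10 = 1) (h8 : s.r 8 = 0) (h12 : s.r 12 = 0) (hm : s.m = fun _ _ _ _ => 0) :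
    K.Tri (.loop (.var 8) (.var 11)
    (.wr 2 z z (.var 8) (.var 9) ;;
      .wr 3 z z (.var 8) (.var 10) ;;
      .asg 10 (.add (.var 10) (.mul (.lit 16) (.var 9))) ;;
      .asg 8 (.add (.var 8) (.lit 1)) ;;
      .asg 12 (.add (.var 12) (.lit 1)) ;;
      .ite (.var 12) (.var 7) .skip (.asg 12 z ;; .asg 9 (.add (.var 9) (.var 9))))) s
      (200 * lvls n + 10) fun s' => s'.r 0 = n ∧ s'.r 3 = K.M ∧
        (∀ l < lvls n, s'.m 2 0 0 l = scale n l) ∧ (∀ l < lvls n, s'.m 3 0 0 l = base n l) ∧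
        ∀ k, k ≠ 2 → k ≠ 3 → s'.m k = fun _ _ _ => 0 := by
  have hW := hK.word
  have hlarge := hK.large
  have hlv := hK.lvls_lt
  have hg : 0 < grp n := Nat.succ_pos _
  have hgd : grp n = lg n + 2 := rfl
  refine (tri_loop (i := lvls n) (k := 150) (fun i s' => i ≤ lvls n ∧ s'.r 0 = n ∧
    s'.r 3 = K.M ∧ s'.r 7 = grp n ∧ s'.r 11 = lvls n ∧ s'.r 8 = lvls n - i ∧
    s'.r 9 = scale n (lvls n - i) ∧ s'.r 10 = base n (lvls n - i) ∧
    s'.r 12 = (lvls n - i) % grp n ∧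
    (∀ l < lvls n - i, s'.m 2 0 0 l = scale n l) ∧
    (∀ l < lvls n - i, s'.m 3 0 0 l = base n l) ∧
    ∀ k, k ≠ 2 → k ≠ 3 → s'.m k = fun _ _ _ => 0) ?_ ?_ ?_ ?_).mono ?_ ?_
  · intro i s' _
    simp [Ex.Ok]
  · rintro s' ⟨-, -, -, -, g11, g8, -⟩
    simp [Ex.eval, g11, g8]
  · rintro i s' ⟨hi, g0, g3, g7, g11, g8, g9, g10, g12, m2, m3, mo⟩
    obtain ⟨j, hj⟩ : ∃ j, j = lvls n - (i + 1) := ⟨_, rfl⟩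
    have hj' : lvls n - i = j + 1 := by omega
    rw [← hj] at g8 g9 g10 g12 m2 m3
    have hsc := hK.scale_lt (l := j) (by omega)
    have hbs := hK.base_lt (l := j + 1) (by omega)
    have hbase := base_succ n j
    have hmod : j % grp n < grp n := Nat.mod_lt _ hg
    have hgl : grp n ≤ lvls n := Nat.le_mul_of_pos_left _ (by omega)
    have hscs : scale n (j + 1) = if j % grp n + 1 < grp n then scale n j
        else scale n j + scale n j := by
      unfold scale
      rw [Nat.succ_div]
      have hdvd : grp n ∣ j + 1 ↔ ¬ (j % grp n + 1 < grp n) := by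
        rw [Nat.dvd_iff_mod_eq_zero, Nat.add_mod]
        constructor
        · intro h hlt
          rw [Nat.mod_eq_of_lt (a := 1) (by omega), Nat.mod_eq_of_lt hlt] at h
          omega
        · intro h
          rw [Nat.mod_eq_of_lt (a := 1) (by simp), show j % grp n + 1 = grp n by omega,
            Nat.mod_self]
      by_cases h : j % grp n + 1 < grp n
      · rw [if_pos h, if_neg (by rw [hdvd]; exact fun h' => h' h), add_zero]
      · rw [if_neg h, if_pos (hdvd.2 h), pow_succ]; ring
    have hmods : (j + 1) % grp n = if j % grp n + 1 < grp n then j % grp n + 1 else 0 := by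
      rw [Nat.add_mod, Nat.mod_eq_of_lt (a := 1) (by simp)]
      split_ifs with h
      · exact Nat.mod_eq_of_lt h
      · rw [show j % grp n + 1 = grp n by omega, Nat.mod_self]
    rw [hj']
    refine ⟨by simp [Ex.eval, g8, g11]; omega, ?_⟩
    refine (tri_wr_seq ?_ ?_ (tri_wr_seq ?_ ?_ (tri_asg_seq ?_ (tri_asg_seq ?_ (tri_asg_seq ?_
      (tri_ite ?_ ?_ (fun h => tri_skip ?_) (fun h => tri_asg_seq ?_ (tri_asg ?_ ?_)))))))).mono
        (by decide) fun _ h => h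
    · simp [Ex.Ok, Ex.eval, g3, g8]; omega
    · simp [Ex.Ok]
    · simp [Ex.Ok, Ex.eval, g3, g8]; omega
    · simp [Ex.Ok]
    · simp [Ex.Ok, Ex.eval, g9, g10]; omega
    · simp [Ex.Ok, Ex.eval, g8]; omega
    · simp [Ex.Ok, Ex.eval, g12]; omega
    · simp [Ex.Ok]
    · simp [Ex.Ok]
    · have h' : j % grp n + 1 < grp n := by simp [Ex.eval, g12, g7] at h; omega
      rw [if_pos h'] at hscs hmods
      refine ⟨by omega, by simp [g0], by simp [g3], by simp [g7], by simp [g11],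
        by simp [Ex.eval, g8], by simp [g9, hscs], by simp [Ex.eval, g10, g9, hbase],
        by simp [Ex.eval, g12, hmods], fun l hl => ?_, fun l hl => ?_, fun k h2 h3 => ?_⟩
      · simp [Ex.eval, g8, g9]
        split_ifs with hne
        · rw [hne]
        · exact m2 l (by omega)
      · simp [Ex.eval, g8, g10]
        split_ifs with hne
        · rw [hne]
        · exact m3 l (by omega)
      · funext x y w
        simp [h2, h3, mo]
    · simp [Ex.Ok]; omega
    · simp [Ex.Ok, Ex.eval, g9]; omega
    · have h' : grp n ≤ j % grp n + 1 := by simp [Ex.eval, g12, g7] at h; omega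
      rw [if_neg (by omega)] at hscs hmods
      refine ⟨by omega, by simp [g0], by simp [g3], by simp [g7], by simp [g11],
        by simp [Ex.eval, g8], by simp [Ex.eval, g9, hscs], by simp [Ex.eval, g10, g9, hbase],
        by simp [Ex.eval, g12, hmods], fun l hl => ?_, fun l hl => ?_, fun k h2 h3 => ?_⟩
      · simp [Ex.eval, g8, g9]
        split_ifs with hne
        · rw [hne]
        · exact m2 l (by omega)
      · simp [Ex.eval, g8, g10]
        split_ifs with hne
        · rw [hne]
        · exact m3 l (by omega)
      · funext x y w
        simp [h2, h3, mo]
  · simp [h0, h3, h7, h11, h8, h9, h10, h12, hm, scale, base]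
  · simp [Ex.len]; omega
  · rintro s' ⟨-, g0, g3, -, -, -, -, -, -, m2, m3, mo⟩
    exact ⟨g0, g3, m2, m3, mo⟩

lemma tri_initColors {K : Machine} {n : ℕ} (hK : Fits K n) {s : St} (h0 : s.r 0 = n)
    (h3 : s.r 3 = K.M) :
    K.Tri (.asg 8 z ;; .loop (.var 8) (.var 0)
      (.wr 0 z z (.var 8) (.lit 1) ;; .asg 8 (.add (.var 8) (.lit 1)))) s (60 * n + 20)
      fun s' => Frame {8} {0} s s' ∧ ∀ v < n, s'.col v = 1 := by
  have hW := hK.word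
  have hlarge := hK.large
  have hn := hK.lt
  refine Tri.seq (k₂ := 60 * n + 10) (P := fun s' => s' = s.set 8 0)
    (tri_asg ?_ rfl) ?_ (by simp [Cmd.len, Ex.len]; omega)
  · simp [Ex.Ok]; omega
  rintro _ rfl
  refine (tri_loop (i := n) (k := 45) (fun i s' => Frame {8} {0} s s' ∧ i ≤ n ∧
    s'.r 8 = n - i ∧ ∀ v < n - i, s'.col v = 1) ?_ ?_ ?_ ?_).mono ?_ ?_
  · intro i s' _
    simp [Ex.Ok]
  · rintro s' ⟨hf, -, h8, -⟩
    simp [Ex.eval, h8, hf.1 0 (by simp), h0]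
  · rintro i s' ⟨hf, hi, h8, hc⟩
    have g3 : s'.r 3 = K.M := (hf.1 3 (by simp)).trans h3
    refine ⟨by simp [Ex.eval, h8, hf.1 0 (by simp), h0]; omega, ?_⟩
    refine (tri_wr_seq ?_ ?_ (tri_asg ?_ ?_)).mono (by decide) fun _ h => h
    · simp [Ex.Ok, Ex.eval, h8, g3]; omega
    · simp [Ex.Ok]; omega
    · simp [Ex.Ok, Ex.eval, h8]; omega
    · refine ⟨⟨fun j hj => ?_, fun k hk => ?_⟩, by omega, ?_, fun v hv => ?_⟩
      · simp only [Finset.mem_singleton] at hj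
        simp [hj, hf.1 j (by simp [hj])]
      · simp only [Finset.mem_singleton] at hk
        funext x y w
        simp [hk, hf.2 k (by simp [hk])]
      · simp [Ex.eval, h8]; omega
      · simp only [St.col, Ex.eval, St.set_m, St.upd_m, h8, true_and]
        split_ifs with h
        · rfl
        · exact hc v (by omega)
  · refine ⟨⟨fun j hj => ?_, fun k hk => rfl⟩, le_rfl, by simp, fun v hv => by omega⟩
    simp only [Finset.mem_singleton] at hj
    simp [hj]
  · simp [Ex.len]; omega
  · rintro s' ⟨hf, -, -, h⟩
    exact ⟨hf, by simpa using h⟩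

lemma lg_le_lvls (n : ℕ) : lg n ≤ lvls n := by
  have : 1 ≤ grp n := Nat.succ_pos _
  calc lg n ≤ lg n + 1 := Nat.le_succ _
    _ = (lg n + 1) * 1 := (mul_one _).symm
    _ ≤ _ := Nat.mul_le_mul_left _ this

/-- The initialization takes time proportional to the number of vertices and levels. -/
lemma tri_initCmd {K : Machine} {n : ℕ} (hK : Fits K n) :
    K.Tri initCmd (St.start n) (100 * n + 300 * lvls n) fun s =>
      Ready K n (fun _ _ => false) s ∧ ∀ v < n, s.lvl v = 0 := by
  have h2 := hK.two_le
  have hlg := lg_le_lvls n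
  have hlv := top_lt n
  unfold initCmd
  refine Tri.seq (k₂ := 100 * n + 270 * lvls n - 30) (tri_computeLog hK) ?_ (by omega)
  rintro s₁ ⟨h0, h5, h6, h8, h12, hm⟩
  refine Tri.seq (k₂ := 100 * n + 270 * lvls n - 130)
    (tri_computeParameters hK h0 h5 h6 h8 h12 hm) ?_ (by omega)
  rintro s₂ ⟨h0, h3, h7, h11, h9, h10, h8, h12, hm⟩
  refine Tri.seq (k₂ := 60 * n + 20) (tri_fillTables hK h0 h3 h7 h11 h9 h10 h8 h12 hm) ?_
    (by omega)
  rintro s₃ ⟨h0, h3, m2, m3, mo⟩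
  refine (tri_initColors hK h0 h3).mono le_rfl ?_
  rintro s₄ ⟨hf, hc⟩
  have hmem : ∀ k, k ≠ 0 → s₄.m k = s₃.m k := fun k hk => hf.2 k (by simpa using hk)
  have hl : ∀ v, s₄.lvl v = 0 := fun v => by simp [St.lvl, hmem, mo]
  refine ⟨⟨⟨?_, ?_, ?_, ?_, ?_, ?_, ?_⟩, fun v hv => ⟨?_, ?_⟩, ?_⟩, fun v _ => hl v⟩
  · exact (hf.1 3 (by simp)).trans h3
  · rw [hmem 2 (by decide)]; exact m2
  · rw [hmem 3 (by decide)]; exact m3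
  · intro v _; rw [hl]; exact Nat.zero_le _
  · refine ⟨fun v _ w _ l h => by simp [bucket] at h, fun v _ l i hi => ?_⟩
    rw [hmem 4 (by decide), mo 4 (by decide) (by decide)] at hi
    exact absurd hi (Nat.not_lt_zero _)
  · intro v hv _
    rw [hl, hc v hv]
    have := base_succ n 0
    have h0 : base n 0 = 1 := by simp [base]
    have := scale_pos n 0
    omega
  · intro u _ v _ h; cases h
  · simp [upNbrs]
  · rw [hl]; omega
  · intro v hv; rw [hc v hv]; decide

/-! ### The data structure -/

/-- The adjacency relation of a graph, as a function on natural numbers. -/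
noncomputable def adjFn {n : ℕ} (G : SimpleGraph (Fin n)) : ℕ → ℕ → Bool := by
  classical
  exact fun u v => decide (∃ (hu : u < n) (hv : v < n), G.Adj ⟨u, hu⟩ ⟨v, hv⟩)

lemma adjFn_iff {n : ℕ} (G : SimpleGraph (Fin n)) (u v : ℕ) :
    adjFn G u v = true ↔ ∃ (hu : u < n) (hv : v < n), G.Adj ⟨u, hu⟩ ⟨v, hv⟩ := by
  simp [adjFn]

lemma adjFn_fin {n : ℕ} (G : SimpleGraph (Fin n)) (u v : Fin n) :
    G.Adj u v ↔ adjFn G u v = true := by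
  simp [adjFn_iff]

lemma isGraph_adjFn {n : ℕ} (G : SimpleGraph (Fin n)) : IsGraph n (adjFn G) where
  symm u v := by
    rw [Bool.eq_iff_iff, adjFn_iff, adjFn_iff]
    exact ⟨fun ⟨hu, hv, h⟩ => ⟨hv, hu, h.symm⟩, fun ⟨hu, hv, h⟩ => ⟨hv, hu, h.symm⟩⟩
  irrefl u := by
    rw [Bool.eq_false_iff, Ne, adjFn_iff]
    rintro ⟨_, _, h⟩
    exact h.ne rfl
  lt u v h := by
    obtain ⟨hu, hv, -⟩ := (adjFn_iff _ _ _).1 h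
    exact ⟨hu, hv⟩

lemma adjFn_bot (n : ℕ) : adjFn (⊥ : SimpleGraph (Fin n)) = fun _ _ => false := by
  funext u v
  rw [Bool.eq_false_iff, Ne, adjFn_iff]
  rintro ⟨_, _, h⟩
  exact h

lemma adjFn_apply {n : ℕ} (G : SimpleGraph (Fin n)) (e : EdgeUpdate n) (huv : e.u ≠ e.v) :
    adjFn (e.apply G) = change e.isInsert e.u e.v (adjFn G) := by
  funext u v
  rw [Bool.eq_iff_iff, adjFn_iff]
  simp only [change]
  cases hins : e.isInsert with
  | true =>
    simp only [EdgeUpdate.apply, hins, if_true, SimpleGraph.sup_adj, SimpleGraph.edge_adj, Fin.ext_iff]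
    split_ifs with h
    · simp only [iff_true]
      rcases h with ⟨rfl, rfl⟩ | ⟨rfl, rfl⟩
      · exact ⟨e.u.2, e.v.2, Or.inr ⟨Or.inl ⟨rfl, rfl⟩, by simpa using huv⟩⟩
      · exact ⟨e.v.2, e.u.2, Or.inr ⟨Or.inr ⟨rfl, rfl⟩, by simpa using huv.symm⟩⟩
    · rw [adjFn_iff]
      constructor
      · rintro ⟨hu, hv, h' | h'⟩
        · exact ⟨hu, hv, h'⟩
        · exact absurd h'.1 (by omega)
      · rintro ⟨hu, hv, h'⟩
        exact ⟨hu, hv, Or.inl h'⟩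
  | false =>
    simp only [EdgeUpdate.apply, hins, Bool.false_eq_true, if_false, SimpleGraph.deleteEdges_adj,
      Set.mem_singleton_iff, Sym2.eq_iff, Fin.ext_iff]
    split_ifs with h
    · simp only [iff_false]
      rintro ⟨hu, hv, -, h'⟩
      exact h' h
    · rw [adjFn_iff]
      exact ⟨fun ⟨hu, hv, h', _⟩ => ⟨hu, hv, h'⟩, fun ⟨hu, hv, h'⟩ => ⟨hu, hv, h', h⟩⟩

lemma graphAfter_succ {n : ℕ} {σ : List (EdgeUpdate n)} {i : ℕ} {e : EdgeUpdate n}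
    (h : σ[i]? = some e) : graphAfter σ (i + 1) = e.apply (graphAfter σ i) := by
  simp [graphAfter, List.take_add_one, h, List.foldl_append]

/-- The dynamic coloring data structure. -/
def coloring : DataStructure where
  init := initCmd.code 0
  update := updateCmd.code 0

/-- Memory holds a proper coloring of the current graph with few colors. -/
def Colored {n : ℕ} (σ : List (EdgeUpdate n)) (s : Situation) : Prop :=
  (∀ u v : Fin n, (graphAfter σ s.received).Adj u v → s.cfg.mem u ≠ s.cfg.mem v) ∧
    ∀ v : Fin n, 1 ≤ s.cfg.mem v ∧ (s.cfg.mem v : ℝ) ≤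
      3000000 * max ((graphAfter σ s.received).arboricity : ℝ) 1 * Real.logb 2 n

/-- An execution of the program that runs after `i` updates, as a machine. Its cost is the expected
total cost from a configuration on; `τ` bounds the cost of one instruction. -/
noncomputable def machine (w : ℕ) {n : ℕ} (σ : List (EdgeUpdate n)) (κ : Situation → ℝ≥0∞) (i : ℕ)
    (τ : ℝ≥0∞) (hτ : ∀ c, coloring.Busy ⟨i, c⟩ → κ ⟨i, c⟩ ≤ τ)
    (hM : 16 * stride n ^ 3 ≤ 2 ^ w) (hw : 1 < 2 ^ w) : Machine where
  prog := if i = 0 then coloring.init else coloring.update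
  w := w
  M := stride n
  τ := τ
  X := fun c => coloring.total w σ κ ⟨i, c⟩
  le_of_step := fun c ins h => by
    have hp : (coloring.program ⟨i, c⟩)[c.pc]? = some ins := h
    rw [DataStructure.total_eq, DataStructure.step]
    simp only [hp, ev_map]
    refine add_le_add (hτ c ?_) le_rfl
    exact (List.getElem?_eq_some_iff.1 hp).1
  stride_le := hM
  one_lt := hw

/-- The coloring of a settled data structure has few colors. -/
lemma Ready.colored_memory {K : Machine} {n : ℕ} (hK : Fits K n) {σ : List (EdgeUpdate n)} {i : ℕ}
    {s : St} (h : Ready K n (adjFn (graphAfter σ i)) s) {c : Config} (hr : Rep K.M s c) :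
    Colored σ ⟨i, c⟩ := by
  have hM := hK.lt
  have hmem : ∀ v : Fin n, c.mem v = s.col v := by
    intro v
    have := hr.2 0 0 0 v (by omega) (by omega) (by omega)
    simpa [addr] using this
  refine ⟨fun u v huv => ?_, fun v => ?_⟩
  · simp only [hmem]
    exact h.good.proper u u.2 v v.2 ((adjFn_fin _ _ _).1 huv) (h.colored u u.2)
  · simp only [hmem]
    refine ⟨Nat.one_le_iff_ne_zero.2 (h.colored v v.2), ?_⟩
    have h1 := lvl_lt_of_settled (isGraph_adjFn _) (adjFn_fin _) h.settled v.2
    have h2 := (h.good.palette v v.2 (h.colored v v.2)).2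
    have h3 := base_mono n h1.le
    have h4 := base_groups_le hK.two_le (le_max_right (graphAfter σ i).arboricity 1)
    have hlog : 0 ≤ Real.logb 2 n := Real.logb_nonneg (by norm_num) (by
      have := hK.two_le
      exact_mod_cast (by omega : 1 ≤ n))
    calc (s.col v : ℝ) ≤ (base n ((Nat.clog 2 (max (graphAfter σ i).arboricity 1) + 1) * grp n) :
          ℝ) := by exact_mod_cast (h2.le.trans h3)
      _ ≤ 256 * ((max (graphAfter σ i).arboricity 1 : ℕ) : ℝ) * Real.logb 2 n := h4
      _ ≤ 3000000 * ((max (graphAfter σ i).arboricity 1 : ℕ) : ℝ) * Real.logb 2 n := by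
          gcongr
          norm_num
      _ = _ := by rw [Nat.cast_max, Nat.cast_one]

open scoped Classical in
/-- The cost of a situation: one for an instruction executed during an update, and infinity if the
machine has halted without the right coloring. -/
noncomputable def updateCost {n : ℕ} (σ : List (EdgeUpdate n)) (s : Situation) : ℝ≥0∞ :=
  if coloring.Busy s then (if s.received ≠ 0 then 1 else 0) else if Colored σ s then 0 else ⊤

lemma codeAt_self (c : Cmd) : CodeAt (c.code 0) 0 (c.code 0) := fun i ins h => by rwa [zero_add]

section

variable {n w : ℕ} {σ : List (EdgeUpdate n)}

/-- The expected total cost from the moment on at which the machine is ready to receive update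
number `i`. -/
lemma total_updateCost_le (hn : 2 ≤ n) (hM : 16 * stride n ^ 3 ≤ 2 ^ w) (hw : 1 < 2 ^ w)
    (hσ : ValidUpdates σ) (k i : ℕ) (hi : i + k = σ.length) (c : Config) (s : St) (K : Machine)
    (hK : Fits K n) (hs : Ready K n (adjFn (graphAfter σ i)) s) (hr : Rep K.M s c)
    (hpc : ¬ coloring.Busy ⟨i, c⟩) :
    coloring.total w σ (updateCost σ) ⟨i, c⟩ ≤
      (3000 * levelPot n (adjFn (graphAfter σ i)) s.lvl : ℕ) +
        10000 * matchPot n s.lvl s.col (pairWeight 0 (σ.drop i)) + (200000 * lvls n * k : ℕ) := by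
  induction k generalizing i c s K with
  | zero =>
    have hcost : updateCost σ ⟨i, c⟩ = 0 := by
      rw [updateCost, if_neg hpc, if_pos (hs.colored_memory hK hr)]
    rw [DataStructure.total_eq_zero_of_fixed _ _ _ _ _ hcost]
    · exact zero_le
    · have h1 : (coloring.program ⟨i, c⟩)[c.pc]? = none :=
        List.getElem?_eq_none (not_lt.1 hpc)
      have h2 : σ[i]? = none := List.getElem?_eq_none (by omega)
      simp only [DataStructure.step, h1, h2]
  | succ k ih =>
    have hcost : updateCost σ ⟨i, c⟩ = 0 := by
      rw [updateCost, if_neg hpc, if_pos (hs.colored_memory hK hr)]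
    have h1 : (coloring.program ⟨i, c⟩)[c.pc]? = none := List.getElem?_eq_none (not_lt.1 hpc)
    have hlt : i < σ.length := by omega
    obtain ⟨e, he⟩ : ∃ e, σ[i]? = some e := ⟨_, List.getElem?_eq_getElem hlt⟩
    have hdrop : σ.drop i = e :: σ.drop (i + 1) := by
      rw [List.drop_eq_getElem_cons hlt]
      rw [List.getElem?_eq_getElem hlt, Option.some_inj] at he
      rw [he]
    obtain ⟨huv, hins⟩ := hσ i e he
    have hE := adjFn_apply (graphAfter σ i) e huv
    rw [← graphAfter_succ he] at hE
    have hval : adjFn (graphAfter σ i) e.u e.v = !e.isInsert := by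
      rw [adjFn_fin] at hins
      cases hb : e.isInsert <;> simp_all
    set K' := machine w σ (updateCost σ) (i + 1) 1 (fun c hc => by
      rw [updateCost, if_pos hc]; split_ifs <;> simp) hM hw with hK'
    have hfits : Fits K' n := ⟨hn, rfl⟩
    have hKM : K.M = K'.M := hK.stride
    have hnw : n < 2 ^ w := by
      have h1 := hfits.lt
      have h2 := hfits.word
      have : K'.W = 2 ^ w := rfl
      omega
    -- the state when the update has been received
    set s' := ((s.set 0 (if e.isInsert then 1 else 0)).set 1 e.u).set 2 e.v with hs'
    have hs'r : Ready K' n (adjFn (graphAfter σ i)) s' := by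
      obtain ⟨hG, hset, hcol⟩ := hs
      obtain ⟨g1, g2, g3, g4, g5, g6, g7⟩ := hG
      refine ⟨⟨?_, g2, g3, g4, g5, g6, g7⟩, hset, hcol⟩
      rw [← hKM, ← g1]
      simp [hs']
    obtain ⟨c', hc'⟩ : ∃ c', (DataStructure.receive w e ⟨i, c⟩).cfg = c' := ⟨_, rfl⟩
    have hrep : Rep K'.M s' c' := by
      rw [← hKM]
      have hb : (if e.isInsert = true then 1 else 0) % 2 ^ w = if e.isInsert = true then 1 else 0 :=
        Nat.mod_eq_of_lt (by split_ifs <;> omega)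
      have hu : (e.u : ℕ) % 2 ^ w = e.u := Nat.mod_eq_of_lt (by omega)
      have hv : (e.v : ℕ) % 2 ^ w = e.v := Nat.mod_eq_of_lt (by omega)
      rw [← hc']
      refine ⟨fun j hj => ?_, hr.2⟩
      simp only [DataStructure.receive, hb, hu, hv, Function.update_apply, hs', St.set_r,
        hr.1 j hj]
    have hpc' : c'.pc = 0 := by rw [← hc']; rfl
    have hstep : coloring.total w σ (updateCost σ) ⟨i, c⟩ = K'.X c' := by
      rw [DataStructure.total_eq, hcost, zero_add]
      simp only [DataStructure.step, h1, he, ev_pure]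
      rw [hK', ← hc']
      rfl
    rw [hstep, hdrop]
    have h2 := le_cost hrep
    rw [hpc'] at h2
    refine h2.trans ((cost_le_wp (K := K') (p := 0) (codeAt_self updateCmd)
      (fun s' => le_rfl) s').trans ?_)
    refine (wp_updateCmd hfits rfl (isGraph_adjFn _) e (σ.drop (i + 1)) huv hval _
      (200000 * lvls n * k : ℕ) ?_ hs'r ?_ ?_ ?_).trans (le_of_eq ?_)
    · rw [← hE]
      intro s₂ hs₂
      refine iSup₂_le fun c₂ hc₂ => ?_
      refine ih (i + 1) (by omega) c₂ s₂ K' hfits hs₂ hc₂.1 ?_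
      have hlen : (coloring.program ⟨i + 1, c₂⟩).length = updateCmd.len :=
        Cmd.length_code _ _
      rw [DataStructure.Busy, hlen]
      have := hc₂.2
      change ¬ c₂.pc < _
      omega
    · simp [hs']
    · simp [hs']
    · simp [hs']
    · have e1 : s'.lvl = s.lvl := rfl
      have e2 : s'.col = s.col := rfl
      rw [e1, e2]
      push_cast
      ring

lemma start_rep (hn : n < 2 ^ w) (M : ℕ) :
    Rep M (St.start n) (DataStructure.start w n).cfg := by
  refine ⟨fun i _ => ?_, fun k a b d _ _ _ => rfl⟩
  simp only [DataStructure.start, St.start, Function.update_apply, Nat.mod_eq_of_lt hn]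

/-- The part of the process that follows the initialization determines the cost up to the cost of
the initialization. -/
lemma total_start_le (hn : 2 ≤ n) (hM : 16 * stride n ^ 3 ≤ 2 ^ w) (hw : 1 < 2 ^ w)
    (κ : Situation → ℝ≥0∞) (τ : ℝ≥0∞) (hτ : ∀ c, coloring.Busy ⟨0, c⟩ → κ ⟨0, c⟩ ≤ τ) (b : ℝ≥0∞)
    (hb : ∀ (K : Machine) (s : St) (c : Config), Fits K n → Ready K n (fun _ _ => false) s →
      (∀ v < n, s.lvl v = 0) → Rep K.M s c → ¬ coloring.Busy ⟨0, c⟩ →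
        coloring.total w σ κ ⟨0, c⟩ ≤ b) :
    coloring.total w σ κ (DataStructure.start w n) ≤ τ * (100 * n + 300 * lvls n : ℕ) + b := by
  set K := machine w σ κ 0 τ hτ hM hw with hK
  have hfits : Fits K n := ⟨hn, rfl⟩
  have hnw : n < 2 ^ w := by
    have h1 := hfits.lt
    have h2 := hfits.word
    have : K.W = 2 ^ w := rfl
    omega
  have h1 := le_cost (K := K) (start_rep hnw K.M)
  refine h1.trans ((cost_le_wp (K := K) (p := 0) (codeAt_self initCmd) (fun s' => le_rfl) _).trans ?_)
  refine tri_initCmd hfits _ b ?_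
  rintro s ⟨hs, hl⟩
  refine iSup₂_le fun c hc => hb K s c hfits hs hl hc.1 ?_
  have hlen : (coloring.program ⟨0, c⟩).length = initCmd.len := Cmd.length_code _ _
  rw [DataStructure.Busy, hlen]
  have := hc.2
  change ¬ c.pc < _
  omega

lemma total_updateCost_start_le (hn : 2 ≤ n) (hM : 16 * stride n ^ 3 ≤ 2 ^ w) (hw : 1 < 2 ^ w)
    (hσ : ValidUpdates σ) : coloring.total w σ (updateCost σ) (DataStructure.start w n) ≤
      (220000 * lvls n * σ.length : ℕ) := by
  refine (total_start_le hn hM hw _ 0 (fun c hc => ?_) (220000 * lvls n * σ.length : ℕ)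
    fun K s c hK hs hl hr hpc => ?_).trans (by simp)
  · rw [updateCost, if_pos hc]
    simp
  · have hE : adjFn (graphAfter σ 0) = fun _ _ => false := adjFn_bot n
    have h := total_updateCost_le hn hM hw hσ σ.length 0 (by omega) c s K hK
      (by rw [hE]; exact hs) hr hpc
    refine h.trans ?_
    have h0 : levelPot n (adjFn (graphAfter σ 0)) s.lvl = 0 := by
      rw [hE, levelPot]
      have : ∑ v ∈ Finset.range n, vertexPot n (fun _ _ => false) s.lvl v = 0 :=
        Finset.sum_eq_zero fun v hv => by
          rw [vertexPot, hl v (Finset.mem_range.1 hv), Finset.range_zero, Finset.sum_empty]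
      rw [this]
      simp [pairPot]
    have h1 := matchPot_start_le hl s.col σ
    have h2 := top_lt n
    rw [h0, List.drop_zero]
    calc _ ≤ ((3000 * 0 : ℕ) : ℝ≥0∞) + 10000 * (2 * σ.length : ℕ) +
          (200000 * lvls n * σ.length : ℕ) := by gcongr
      _ = ((20000 * σ.length + 200000 * lvls n * σ.length : ℕ) : ℝ≥0∞) := by push_cast; ring
      _ ≤ _ := Nat.cast_le.2 ?_
    have h3 : 1 * σ.length ≤ lvls n * σ.length := Nat.mul_le_mul_right _ (by omega)
    nlinarith

lemma expectedInitTime_le (hn : 2 ≤ n) (hM : 16 * stride n ^ 3 ≤ 2 ^ w) (hw : 1 < 2 ^ w)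
    (σ : List (EdgeUpdate n)) :
    coloring.expectedInitTime w σ ≤ (100 * n + 300 * lvls n : ℕ) := by
  classical
  rw [DataStructure.expectedInitTime, DataStructure.expected_eq_total]
  refine (total_start_le hn hM hw _ 1 (fun c hc => ?_) 0 fun K s c hK hs hl hr hpc => ?_).trans
    (by simp)
  · split_ifs <;> simp
  · have hzero := DataStructure.total_eq_zero_of_received coloring w σ
      (fun s => if coloring.Busy s ∧ s.received = 0 then 1 else 0) (fun s hs => by simp [hs])
    have h0 : (if coloring.Busy ⟨0, c⟩ ∧ (0 : ℕ) = 0 then (1 : ℝ≥0∞) else 0) = 0 :=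
      if_neg fun h => hpc h.1
    have h1 : (coloring.program ⟨0, c⟩)[c.pc]? = none := List.getElem?_eq_none (not_lt.1 hpc)
    cases he : σ[0]? with
    | none =>
      refine (DataStructure.total_eq_zero_of_fixed _ _ _ _ _ h0 ?_).le
      simp only [DataStructure.step, h1, he]
    | some e =>
      rw [DataStructure.total_eq]
      simp only [DataStructure.step, h1, he, ev_pure]
      rw [hzero _ (by simp [DataStructure.receive]), add_zero]
      exact le_of_eq (if_neg fun h => hpc h.1)

end

lemma lvls_le_logb {n : ℕ} (hn : 2 ≤ n) :
    1 ≤ Real.logb 2 n ∧ (lvls n : ℝ) ≤ 12 * Real.logb 2 n ^ 2 := by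
  have hlog1 := one_le_logb hn
  have hlg := lg_le_logb hn
  refine ⟨hlog1, ?_⟩
  have : (lvls n : ℝ) = (lg n + 1) * (lg n + 2) := by unfold lvls grp; push_cast; ring
  rw [this]
  calc ((lg n : ℝ) + 1) * (lg n + 2) ≤ (3 * Real.logb 2 n) * (4 * Real.logb 2 n) := by
        gcongr <;> linarith
    _ = _ := by ring

lemma stride_le_word {n w : ℕ} (hn : 2 ≤ n) (hw : 52 * Nat.clog 2 n ≤ w) :
    16 * stride n ^ 3 ≤ 2 ^ w ∧ 1 < 2 ^ w := by
  have h2 := two_le_pw hn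
  have h1 : pw n ^ 52 ≤ 2 ^ w := by
    rw [← pow_mul, mul_comm]
    exact Nat.pow_le_pow_right (by omega) hw
  have h3 : 16 * stride n ^ 3 ≤ pw n ^ 52 := by
    calc 16 * stride n ^ 3 = 2 ^ 4 * pw n ^ 48 := by unfold stride; rw [← pow_mul]; norm_num
      _ ≤ pw n ^ 4 * pw n ^ 48 := by gcongr
      _ = _ := by rw [← pow_add]
  have h4 : 1 ≤ stride n ^ 3 := Nat.one_le_pow _ _ (by positivity)
  exact ⟨h3.trans h1, by omega⟩

end DynColoring

theorem theorem1 :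
    ∃ (D : DynColoring.DataStructure) (c : ℕ) (C : ℝ),
      ∀ n : ℕ, 2 ≤ n → ∀ w : ℕ, c * Nat.clog 2 n ≤ w →
      ∀ σ : List (DynColoring.EdgeUpdate n), DynColoring.ValidUpdates σ →
        -- whatever the random choices, whenever the machine has halted, cells `0, …, n-1` of the
        -- memory hold a proper coloring of the current graph with few colors
        (∀ t : ℕ, ∀ s ∈ (D.dist w σ t).support, ¬ D.Busy s →
          (∀ u v : Fin n, (DynColoring.graphAfter σ s.received).Adj u v →
            s.cfg.mem u ≠ s.cfg.mem v) ∧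
          ∀ v : Fin n, 1 ≤ s.cfg.mem v ∧
            (s.cfg.mem v : ℝ) ≤
              C * max ((DynColoring.graphAfter σ s.received).arboricity : ℝ) 1 * Real.logb 2 n) ∧
        D.expectedInitTime w σ ≤ ENNReal.ofReal (C * n * Real.logb 2 n ^ 2) ∧
        D.expectedUpdateTime w σ ≤ ENNReal.ofReal (C * σ.length * Real.logb 2 n ^ 2) := by
  classical
  refine ⟨DynColoring.coloring, 52, 3000000, fun n hn w hw σ hσ => ?_⟩
  obtain ⟨hM, hw1⟩ := DynColoring.stride_le_word hn hw
  obtain ⟨hlog, hlvls⟩ := DynColoring.lvls_le_logb hn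
  have htotal := DynColoring.total_updateCost_start_le hn hM hw1 hσ
  refine ⟨fun t s hs hbusy => ?_, ?_, ?_⟩
  · have h := DynColoring.DataStructure.not_mem_support_of_total_ne_top _ _ _ _
      (ne_top_of_le_ne_top (ENNReal.natCast_ne_top _) htotal) t s hs
    rw [DynColoring.updateCost, if_neg hbusy] at h
    by_contra hcon
    exact h (if_neg hcon)
  · refine (DynColoring.expectedInitTime_le hn hM hw1 σ).trans ?_
    rw [← ENNReal.ofReal_natCast]
    refine ENNReal.ofReal_le_ofReal ?_
    clear htotal
    generalize DynColoring.lvls n = T at hlvls ⊢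
    push_cast
    have hn1 : (1 : ℝ) ≤ n := by exact_mod_cast (by omega : 1 ≤ n)
    have hsq : (1 : ℝ) ≤ Real.logb 2 n ^ 2 := one_le_pow₀ hlog
    nlinarith
  · refine le_trans ?_ (htotal.trans ?_)
    · rw [DynColoring.DataStructure.expectedUpdateTime,
        DynColoring.DataStructure.expected_eq_total]
      refine DynColoring.DataStructure.total_mono _ _ _ (fun s => ?_) _
      unfold DynColoring.updateCost
      split_ifs <;> simp_all
    · rw [← ENNReal.ofReal_natCast]
      refine ENNReal.ofReal_le_ofReal ?_
      clear htotal
      generalize DynColoring.lvls n = T at hlvls ⊢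
      push_cast
      have hm : (0 : ℝ) ≤ σ.length := Nat.cast_nonneg _
      have hsq : (0 : ℝ) ≤ Real.logb 2 n ^ 2 := sq_nonneg _
      calc (220000 : ℝ) * (T : ℝ) * σ.length
          ≤ 220000 * (12 * Real.logb 2 n ^ 2) * σ.length := by gcongr
        _ = 2640000 * (σ.length * Real.logb 2 n ^ 2) := by ring
        _ ≤ 3000000 * (σ.length * Real.logb 2 n ^ 2) := by gcongr; norm_num
        _ = 3000000 * σ.length * Real.logb 2 n ^ 2 := by ring
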